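/- By a compact Riemannian manifold $(M,g)$ we mean a compact connected smooth orientable manifold $M$ without boundary with a smooth Riemannian metric $g$; $\Gamma(TM)$ and $C^\infty(M)$ denote its smooth vector fields and smooth real functions, $\nabla$ the Levi-Civita connection, $\mathrm{grad}_g$ the gradient and $\mathrm{div}_g$ the divergence of $g$. The incompressible Euler equations on $(M,g)$, for $u(t)\in\Gamma(TM)$ and $p(t)\in C^\infty(M)$, are $$\partial_t u+\nabla_u u=-\mathrm{grad}_g\,p,\qquad \mathrm{div}_g\,u=0 .$$ A symmetric bilinear map $B\colon\mathbb R^n\times\mathbb R^n\to\mathbb R^n$ can be embedded into the Euler equations on $(M,g)$ if there are an injective linear map $U\colon\mathbb R^n\to\Gamma(TM)$ and a map $P\colon\mathbb R^n\to C^\infty(M)$ such that, whenever $y$ solves $\partial_t y=B(y,y)$ on some time interval $I$, the fields $u(t)=U(y(t))$ and $p(t)=P(y(t))$ solve the Euler equations on $I$. **Theorem.** Let $B\colon\mathbb R^n\times\mathbb R^n\to\mathbb R^n$ be a symmetric bilinear map. Then the following are equivalent: (i) $B$ can be embedded into the Euler equations on some compact Riemannian manifold $(M,g)$. (ii) There is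 a positive definite inner product $\langle\cdot,\cdot\rangle$ on $\mathbb R^n$ such that $\langle B(y,y),y\rangle=0$ for all $y\in\mathbb R^n$. -/

import Mathlib

open Bundle Set
open scoped Manifold ContDiff

noncomputable section

namespace EulerEmbedding

section Operators

variable {E : Type*} [NormedAddCommGroup E] [NormedSpace ℝ E]
  {M : Type*} [TopologicalSpace M] [ChartedSpace E M]

variable (E M) in
/-- The space `Γ(TM)` of smooth vector fields on `M`. -/
abbrev VectorFields [IsManifold 𝓘(ℝ, E) ∞ M] : Type _ :=
  Cₛ^∞⟮𝓘(ℝ, E); E, (TangentSpace 𝓘(ℝ, E) : M → Type _)⟯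

variable (E M) in
/-- The space `C^∞(M)` of smooth scalar fields on `M`. -/
abbrev ScalarFields : Type _ := C^∞⟮𝓘(ℝ, E), M; 𝓘(ℝ, ℝ), ℝ⟯

variable (E M) in
/-- Smooth Riemannian metrics on `M`. -/
abbrev RiemMetric [IsManifold 𝓘(ℝ, E) ∞ M] : Type _ :=
  ContMDiffRiemannianMetric 𝓘(ℝ, E) ∞ E (TangentSpace 𝓘(ℝ, E) : M → Type _)

variable (E M) in
/-- Affine connections on `M`; `cov Y x v` is `∇_v Y` at the point `x`. -/
abbrev Connection [IsManifold 𝓘(ℝ, E) ∞ M] : Type _ :=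
  CovariantDerivative 𝓘(ℝ, E) E (TangentSpace 𝓘(ℝ, E) : M → Type _)

variable [IsManifold 𝓘(ℝ, E) ∞ M]

variable (E M) in
/-- `M` is orientable: it carries a smooth nowhere vanishing differential form of top degree.
Smoothness of the form is expressed by evaluating it on smooth vector fields. -/
def IsOrientable : Prop :=
  ∃ vol : (x : M) → TangentSpace 𝓘(ℝ, E) x [⋀^Fin (Module.finrank ℝ E)]→ₗ[ℝ] ℝ,
    (∀ x, vol x ≠ 0) ∧
    ∀ X : Fin (Module.finrank ℝ E) → VectorFields E M,
      ContMDiff 𝓘(ℝ, E) 𝓘(ℝ, ℝ) ∞ (fun x ↦ vol x (fun i ↦ X i x))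

/-- The Levi-Civita connection of `g` is the connection `∇` that is
torsion free, `∇_X Y - ∇_Y X = [X, Y]`, and
compatible with the metric, `d(g(Y, Z))(v) = g(∇_v Y, Z) + g(Y, ∇_v Z)`. -/
structure IsLeviCivita (g : RiemMetric E M) (cov : Connection E M) : Prop where
  torsion_free : ∀ (X Y : (x : M) → TangentSpace 𝓘(ℝ, E) x) (x : M),
    MDiffAt (T% X) x → MDiffAt (T% Y) x →
      cov Y x (X x) - cov X x (Y x) = VectorField.mlieBracket 𝓘(ℝ, E) X Y x
  metric_compatible : ∀ (Y Z : (x : M) → TangentSpace 𝓘(ℝ, E) x) (x : M),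
    MDiffAt (T% Y) x → MDiffAt (T% Z) x → ∀ v : TangentSpace 𝓘(ℝ, E) x,
      mvfderiv 𝓘(ℝ, E) (fun z ↦ g.inner z (Y z) (Z z)) x v =
        g.inner x (cov Y x v) (Z x) + g.inner x (Y x) (cov Z x v)

/-- The divergence of a vector field with respect to a connection `∇`: the trace of the
endomorphism `v ↦ ∇_v X` of each tangent space. For the Levi-Civita connection of `g` this is
the divergence `div_g`. -/
def divergence (cov : Connection E M) (X : (x : M) → TangentSpace 𝓘(ℝ, E) x) (x : M) : ℝ :=
  LinearMap.trace ℝ (TangentSpace 𝓘(ℝ, E) x) (cov X x).toLinearMap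

/-- The inner product of `g` on the tangent space at `x`, as a bilinear form. -/
def metricForm (g : RiemMetric E M) (x : M) : LinearMap.BilinForm ℝ (TangentSpace 𝓘(ℝ, E) x) :=
  (g.inner x).toLinearMap₁₂

theorem metricForm_apply (g : RiemMetric E M) (x : M) (v w : TangentSpace 𝓘(ℝ, E) x) :
    metricForm g x v w = g.inner x v w := rfl

theorem metricForm_nondegenerate (g : RiemMetric E M) (x : M) : (metricForm g x).Nondegenerate := by
  refine ⟨fun v hv ↦ ?_, fun v hv ↦ ?_⟩ <;>
  · by_contra h
    exact (g.pos x v h).ne' (hv v)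

variable [FiniteDimensional ℝ E]

instance finiteDimensional_tangentSpace (x : M) : FiniteDimensional ℝ (TangentSpace 𝓘(ℝ, E) x) :=
  inferInstanceAs (FiniteDimensional ℝ E)

/-- The gradient `grad_g f`: the vector field with `g(grad_g f, v) = df(v)` for all `v`. -/
def gradient (g : RiemMetric E M) (f : M → ℝ) (x : M) : TangentSpace 𝓘(ℝ, E) x :=
  (LinearMap.BilinForm.toDual (metricForm g x) (metricForm_nondegenerate g x)).symm
    (mvfderiv 𝓘(ℝ, E) f x).toLinearMap

theorem inner_gradient (g : RiemMetric E M) (f : M → ℝ) (x : M) (v : TangentSpace 𝓘(ℝ, E) x) :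
    g.inner x (gradient g f x) v = mvfderiv 𝓘(ℝ, E) f x v :=
  LinearMap.BilinForm.apply_toDual_symm_apply (B := metricForm g x)
    (hB := metricForm_nondegenerate g x) (mvfderiv 𝓘(ℝ, E) f x).toLinearMap v

end Operators

/-- A compact Riemannian manifold: a compact connected Hausdorff smooth orientable manifold
without boundary, of finite dimension, with a smooth Riemannian metric. The charts take values in
a finite-dimensional real normed space `E`, so that there is no boundary. -/
structure CompactRiemannianManifold where
  E : Type
  [normedAddCommGroup : NormedAddCommGroup E]
  [normedSpace : NormedSpace ℝ E]
  [finiteDimensional : FiniteDimensional ℝ E]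
  M : Type
  [topologicalSpace : TopologicalSpace M]
  [chartedSpace : ChartedSpace E M]
  [isManifold : IsManifold 𝓘(ℝ, E) ∞ M]
  [t2Space : T2Space M]
  [compactSpace : CompactSpace M]
  [connectedSpace : ConnectedSpace M]
  orientable : IsOrientable E M
  g : RiemMetric E M

attribute [instance] CompactRiemannianManifold.normedAddCommGroup
  CompactRiemannianManifold.normedSpace CompactRiemannianManifold.finiteDimensional
  CompactRiemannianManifold.topologicalSpace CompactRiemannianManifold.chartedSpace
  CompactRiemannianManifold.isManifold CompactRiemannianManifold.t2Space
  CompactRiemannianManifold.compactSpace CompactRiemannianManifold.connectedSpace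

/-- A time interval: an interval of the real line with more than one point. -/
def IsTimeInterval (J : Set ℝ) : Prop := J.OrdConnected ∧ J.Nontrivial

/-- The incompressible Euler equations
`∂ₜ u + ∇_u u = - grad_g p`, `div_g u = 0` on the time interval `J`, where `cov` is the
Levi-Civita connection. The time derivative at an end point of `J` is one-sided. -/
def SolvesEulerOn (N : CompactRiemannianManifold) (cov : Connection N.E N.M)
    (u : ℝ → VectorFields N.E N.M) (p : ℝ → ScalarFields N.E N.M) (J : Set ℝ) : Prop :=
  ∀ t ∈ J, ∀ x : N.M,
    (∃ dudt : TangentSpace 𝓘(ℝ, N.E) x,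
      HasDerivWithinAt (fun s ↦ u s x) dudt J t ∧
      dudt + cov (u t) x (u t x) = - gradient N.g (p t) x) ∧
    divergence cov (u t) x = 0

/-- `y` solves the ODE `∂ₜ y = B(y, y)` on `J`. -/
def SolvesODEOn {V : Type*} [NormedAddCommGroup V] [NormedSpace ℝ V] (B : V →ₗ[ℝ] V →ₗ[ℝ] V)
    (y : ℝ → V) (J : Set ℝ) : Prop :=
  ∀ t ∈ J, HasDerivWithinAt y (B (y t) (y t)) J t

/-- `B` can be linearly embedded into the Euler equations on `N`. -/
def EmbedsIntoEuler {V : Type*} [NormedAddCommGroup V] [NormedSpace ℝ V]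
    (B : V →ₗ[ℝ] V →ₗ[ℝ] V) (N : CompactRiemannianManifold) : Prop :=
  ∃ cov : Connection N.E N.M, IsLeviCivita N.g cov ∧
  ∃ (U : V →ₗ[ℝ] VectorFields N.E N.M) (P : V → ScalarFields N.E N.M),
    Function.Injective U ∧
    ∀ (J : Set ℝ) (y : ℝ → V), IsTimeInterval J → SolvesODEOn B y J →
      SolvesEulerOn N cov (fun t ↦ U (y t)) (fun t ↦ P (y t)) J

end EulerEmbedding

end

open Bundle Set
open scoped Manifold ContDiff

noncomputable section

namespace EulerEmbedding

open VectorField Filter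
open scoped Topology InnerProductSpace

/-! (i) ⇒ (ii) is conservation of kinetic energy. Every `y` is the initial value of a local solution
of the ODE, so an embedding gives, for each `y`, the identity `U (B y y) + ∇_{U y} (U y) = - grad (P
y)` with `U y` divergence free (`euler_of_embedding`). Put `Q y z = ∫ g(U y, U z)`, which is
positive definite because `U` is injective. By metric compatibility, `g(U (B y y), U y)` is minus
the derivative of `|U y|² / 2 + P y` along `U y`, and such a derivative along a divergence free
field has integral zero. Only a positive linear functional with this property is needed
(`exists_riemannianIntegral`). It is glued from chart integrals against `√det g` by a partition of
unity, and `fderiv_density` reduces the divergence theorem to integration by parts in a vector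
space.

(ii) ⇒ (i) is realized on SO(n) × Tⁿ. This is the quotient of the Euclidean group SO(n) ⋉ ℝⁿ by a
lattice of translations acting on the right, so the right-invariant fields descend to a global frame
with the structure constants of 𝔰𝔬(n) ⋉ ℝⁿ. Any inner product on the Lie algebra gives a metric on
the manifold. A frame field `a` then satisfies `∇_a a = - ad_a^* a` and `div a = - tr ad_a`
(`christoffel_self`, `divergence_frame`), and the trace vanishes. With zero pressure the Euler
equations become the Euler–Arnold equation `∂ₜ a = ad_a^* a`.

To find `B` inside it, choose coordinates in which `Q` is the Euclidean inner product. Polarizing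
the conservation law gives `B(y, y) = A(y) y` with `A(y)` skew and linear in `y`
(`skewPartOf_apply_self`). Embed `y` as `(A y, y)`, with the inner product for which the graph of
`A` is orthogonal to 𝔰𝔬(n) and projects isometrically to ℝⁿ. Pairing with `(A y, y)` sees only the
ℝⁿ component, so `⟪[(A y, y), (η, w)], (A y, y)⟫ = ⟪η y - A(y) w, y⟫ = ⟪w, B(y, y)⟫`: `ad^*` at the
image of `y` is the image of `B(y, y)`. -/

theorem two_le_infty : (2 : ℕ∞ω) ≤ ∞ := ENat.LEInfty.out

/-! ### Vector fields, Lie brackets and derivatives in a chart. -/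

section ChartTools

variable {E : Type*} [NormedAddCommGroup E] [NormedSpace ℝ E]
  {M : Type*} [TopologicalSpace M] [ChartedSpace E M]

/-- The derivative of the inverse of the chart at `c`. -/
def chartDeriv (c : M) (e : E) : E →L[ℝ] TangentSpace 𝓘(ℝ, E) ((extChartAt 𝓘(ℝ, E) c).symm e) :=
  mfderiv 𝓘(ℝ, E) 𝓘(ℝ, E) (extChartAt 𝓘(ℝ, E) c).symm e

/-- The expression of a vector field in the chart at `c`. -/
def fieldInChart (c : M) (X : (x : M) → TangentSpace 𝓘(ℝ, E) x) (e : E) : E :=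
  mpullback 𝓘(ℝ, E) 𝓘(ℝ, E) (extChartAt 𝓘(ℝ, E) c).symm X e

/-- The coordinate vector field in the direction `v` of the chart at `c`. -/
def coordField (c : M) (v : E) (x : M) : TangentSpace 𝓘(ℝ, E) x :=
  (mfderiv 𝓘(ℝ, E) 𝓘(ℝ, E) (extChartAt 𝓘(ℝ, E) c) x).inverse v

variable [IsManifold 𝓘(ℝ, E) ∞ M] (c : M) {e : E}

theorem contMDiffAt_chart_symm (he : e ∈ (extChartAt 𝓘(ℝ, E) c).target) :
    ContMDiffAt 𝓘(ℝ, E) 𝓘(ℝ, E) ∞ (extChartAt 𝓘(ℝ, E) c).symm e :=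
  (contMDiffOn_extChartAt_symm c).contMDiffAt ((isOpen_extChartAt_target c).mem_nhds he)

theorem contMDiffAt_chart {x : M} (hx : x ∈ (extChartAt 𝓘(ℝ, E) c).source) :
    ContMDiffAt 𝓘(ℝ, E) 𝓘(ℝ, E) ∞ (extChartAt 𝓘(ℝ, E) c) x :=
  contMDiffAt_extChartAt' (by simpa using hx)

theorem isInvertible_mfderiv_chart_symm (he : e ∈ (extChartAt 𝓘(ℝ, E) c).target) :
    (mfderiv 𝓘(ℝ, E) 𝓘(ℝ, E) (extChartAt 𝓘(ℝ, E) c).symm e).IsInvertible := by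
  have : IsManifold 𝓘(ℝ, E) 1 M := IsManifold.of_le (n := ∞) (by simp)
  have h := isInvertible_mfderivWithin_extChartAt_symm (I := 𝓘(ℝ, E)) he
  rw [ModelWithCorners.range_eq_univ, mfderivWithin_univ] at h
  exact h

theorem isInvertible_chartDeriv (he : e ∈ (extChartAt 𝓘(ℝ, E) c).target) :
    (chartDeriv c e).IsInvertible := isInvertible_mfderiv_chart_symm c he

theorem chartDeriv_fieldInChart (he : e ∈ (extChartAt 𝓘(ℝ, E) c).target)
    (X : (x : M) → TangentSpace 𝓘(ℝ, E) x) :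
    chartDeriv c e (fieldInChart c X e) = X ((extChartAt 𝓘(ℝ, E) c).symm e) :=
  (isInvertible_chartDeriv c he).self_apply_inverse _

theorem fieldInChart_eq (he : e ∈ (extChartAt 𝓘(ℝ, E) c).target)
    (X : (x : M) → TangentSpace 𝓘(ℝ, E) x) (v : E)
    (h : X ((extChartAt 𝓘(ℝ, E) c).symm e) = chartDeriv c e v) : fieldInChart c X e = v := by
  apply (isInvertible_chartDeriv c he).injective
  rw [chartDeriv_fieldInChart c he, h]

theorem differentiableAt_fieldInChart (he : e ∈ (extChartAt 𝓘(ℝ, E) c).target)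
    [CompleteSpace E]
    {X : (x : M) → TangentSpace 𝓘(ℝ, E) x}
    (hX : MDiffAt (T% X) ((extChartAt 𝓘(ℝ, E) c).symm e)) :
    DifferentiableAt ℝ (fieldInChart c X) e := by
  have : IsManifold 𝓘(ℝ, E) 1 M := IsManifold.of_le (n := ∞) (by simp)
  have h := hX.mpullback_vectorField (contMDiffAt_chart_symm c he)
    (isInvertible_mfderiv_chart_symm c he) two_le_infty
  have h' : MDifferentiableAt 𝓘(ℝ, E) 𝓘(ℝ, E) (fieldInChart c X) e :=
    ((contMDiff_snd_tangentBundle_modelSpace E 𝓘(ℝ, E) (n := 1)).contMDiffAt.mdifferentiableAt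
      one_ne_zero).comp e h
  exact h'.differentiableAt

theorem contDiffAt_fieldInChart (he : e ∈ (extChartAt 𝓘(ℝ, E) c).target)
    [CompleteSpace E]
    {X : (x : M) → TangentSpace 𝓘(ℝ, E) x}
    (hX : CMDiffAt ∞ (T% X) ((extChartAt 𝓘(ℝ, E) c).symm e)) :
    ContDiffAt ℝ ∞ (fieldInChart c X) e := by
  have : IsManifold 𝓘(ℝ, E) 1 M := IsManifold.of_le (n := ∞) (by simp)
  have h := hX.mpullback_vectorField_preimage (contMDiffAt_chart_symm c he)
    (isInvertible_mfderiv_chart_symm c he) (by simp)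
  exact (contMDiffAt_vectorSpace_iff_contDiffAt (V := fieldInChart c X)).1 h

theorem coordField_symm (he : e ∈ (extChartAt 𝓘(ℝ, E) c).target) (v : E) :
    coordField c v ((extChartAt 𝓘(ℝ, E) c).symm e) = chartDeriv c e v := by
  have : IsManifold 𝓘(ℝ, E) 1 M := IsManifold.of_le (n := ∞) (by simp)
  have h := mfderiv_extChartAt_comp_mfderivWithin_extChartAt_symm (I := 𝓘(ℝ, E)) he
  rw [ModelWithCorners.range_eq_univ, mfderivWithin_univ] at h
  have hi := isInvertible_mfderiv_extChartAt (I := 𝓘(ℝ, E))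
    ((extChartAt 𝓘(ℝ, E) c).map_target he)
  apply hi.injective
  exact (hi.self_apply_inverse _).trans (DFunLike.congr_fun h v).symm

theorem fieldInChart_coordField (he : e ∈ (extChartAt 𝓘(ℝ, E) c).target) (v : E) :
    fieldInChart c (coordField c v) e = v :=
  fieldInChart_eq c he _ _ (coordField_symm c he v)

theorem mdifferentiableAt_coordField [CompleteSpace E]
    {x : M} (hx : x ∈ (extChartAt 𝓘(ℝ, E) c).source) (v : E) :
    MDiffAt (T% (coordField c v)) x := by
  have : IsManifold 𝓘(ℝ, E) 1 M := IsManifold.of_le (n := ∞) (by simp)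
  let V : (e : E) → TangentSpace 𝓘(ℝ, E) e := fun _ ↦ v
  have hv : MDiffAt (T% V) (extChartAt 𝓘(ℝ, E) c x) :=
    ((contMDiffAt_vectorSpace_iff_contDiffAt (n := 1) (V := V)
      (x := extChartAt 𝓘(ℝ, E) c x)).2 contDiffAt_const).mdifferentiableAt one_ne_zero
  exact hv.mpullback_vectorField (contMDiffAt_chart c hx) (isInvertible_mfderiv_extChartAt hx)
    two_le_infty

/-- The Lie bracket is natural under pullback by the inverse chart. -/
theorem fieldInChart_mlieBracket [CompleteSpace E]
    (he : e ∈ (extChartAt 𝓘(ℝ, E) c).target)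
    {X Y : (x : M) → TangentSpace 𝓘(ℝ, E) x}
    (hX : MDiffAt (T% X) ((extChartAt 𝓘(ℝ, E) c).symm e))
    (hY : MDiffAt (T% Y) ((extChartAt 𝓘(ℝ, E) c).symm e)) :
    fieldInChart c (mlieBracket 𝓘(ℝ, E) X Y) e =
      fderiv ℝ (fieldInChart c Y) e (fieldInChart c X e) -
        fderiv ℝ (fieldInChart c X) e (fieldInChart c Y e) := by
  have : IsManifold 𝓘(ℝ, E) (minSmoothness ℝ 3) M := by
    rw [minSmoothness_of_isRCLikeNormedField]
    exact IsManifold.of_le (n := ∞) ENat.LEInfty.out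
  have h := mpullback_mlieBracket (n := ∞) hX hY (contMDiffAt_chart_symm c he)
    (by rw [minSmoothness_of_isRCLikeNormedField]; exact two_le_infty)
  rw [← mlieBracketWithin_univ (I := 𝓘(ℝ, E)) (M := E),
    mlieBracketWithin_eq_lieBracketWithin] at h
  have h' : fieldInChart c (mlieBracket 𝓘(ℝ, E) X Y) e =
    lieBracketWithin ℝ (fieldInChart c X) (fieldInChart c Y) univ e := h
  rwa [lieBracketWithin_univ] at h'

/-- The chain rule for a function read in a chart. -/
theorem fderiv_comp_chart_symm {F : Type*} [NormedAddCommGroup F] [NormedSpace ℝ F]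
    (he : e ∈ (extChartAt 𝓘(ℝ, E) c).target) {f : M → F}
    (hf : MDiffAt f ((extChartAt 𝓘(ℝ, E) c).symm e)) :
    HasFDerivAt (fun e ↦ f ((extChartAt 𝓘(ℝ, E) c).symm e))
      ((mvfderiv 𝓘(ℝ, E) f ((extChartAt 𝓘(ℝ, E) c).symm e)).comp (chartDeriv c e)) e := by
  have h := hf.hasMFDerivAt.comp e
    ((contMDiffAt_chart_symm c he).mdifferentiableAt (by simp)).hasMFDerivAt
  exact h.hasFDerivAt

theorem contDiffAt_comp_chart_symm {F : Type*} [NormedAddCommGroup F] [NormedSpace ℝ F]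
    (he : e ∈ (extChartAt 𝓘(ℝ, E) c).target) {f : M → F}
    (hf : ContMDiffAt 𝓘(ℝ, E) 𝓘(ℝ, F) ∞ f ((extChartAt 𝓘(ℝ, E) c).symm e)) :
    ContDiffAt ℝ ∞ (fun e ↦ f ((extChartAt 𝓘(ℝ, E) c).symm e)) e :=
  contMDiffAt_iff_contDiffAt.1 (hf.comp e (contMDiffAt_chart_symm c he))

omit [IsManifold 𝓘(ℝ, E) ∞ M] in
theorem target_mem_nhds (he : e ∈ (extChartAt 𝓘(ℝ, E) c).target) :
    (extChartAt 𝓘(ℝ, E) c).target ∈ 𝓝 e := (isOpen_extChartAt_target c).mem_nhds he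

/-- In the chart each iterated derivative is a second derivative of `f` plus a first-order term. The
second derivatives cancel by symmetry, and the first-order terms form the coordinate expression of
the bracket. -/
theorem mvfderiv_mlieBracket_chart [CompleteSpace E]
    {F : Type*} [NormedAddCommGroup F] [NormedSpace ℝ F]
    {f : M → F} (hf : ContMDiff 𝓘(ℝ, E) 𝓘(ℝ, F) ∞ f)
    {X Y : (x : M) → TangentSpace 𝓘(ℝ, E) x} (he : e ∈ (extChartAt 𝓘(ℝ, E) c).target) {x : M}
    (hx : (extChartAt 𝓘(ℝ, E) c).symm e = x)
    (hX : MDiffAt (T% X) x) (hY : MDiffAt (T% Y) x)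
    (hfX : MDiffAt (fun z ↦ mvfderiv 𝓘(ℝ, E) f z (X z)) x)
    (hfY : MDiffAt (fun z ↦ mvfderiv 𝓘(ℝ, E) f z (Y z)) x) :
    mvfderiv 𝓘(ℝ, E) f x (mlieBracket 𝓘(ℝ, E) X Y x) =
      mvfderiv 𝓘(ℝ, E) (fun z ↦ mvfderiv 𝓘(ℝ, E) f z (Y z)) x (X x) -
        mvfderiv 𝓘(ℝ, E) (fun z ↦ mvfderiv 𝓘(ℝ, E) f z (X z)) x (Y x) := by
  subst hx
  set φ := (extChartAt 𝓘(ℝ, E) c).symm with hφ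
  set h : E → F := fun e ↦ f (φ e) with hh
  have hfd : MDiff f := hf.mdifferentiable (by simp)
  have hsm : ContDiffAt ℝ ∞ h e := contDiffAt_comp_chart_symm c he hf.contMDiffAt
  have hD : ∀ e' ∈ (extChartAt 𝓘(ℝ, E) c).target, ∀ Z : (x : M) → TangentSpace 𝓘(ℝ, E) x,
      mvfderiv 𝓘(ℝ, E) f (φ e') (Z (φ e')) = fderiv ℝ h e' (fieldInChart c Z e') := by
    intro e' he' Z
    rw [(fderiv_comp_chart_symm c he' (hfd _)).fderiv, ContinuousLinearMap.comp_apply,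
      chartDeriv_fieldInChart c he']
  have hdd : DifferentiableAt ℝ (fderiv ℝ h) e :=
    (hsm.fderiv_right (m := 1)
      (by rw [one_add_one_eq_two]; exact two_le_infty)).differentiableAt (by simp)
  have key : ∀ Z W : (x : M) → TangentSpace 𝓘(ℝ, E) x, MDiffAt (T% Z) (φ e) →
      MDiffAt (fun z ↦ mvfderiv 𝓘(ℝ, E) f z (Z z)) (φ e) →
      mvfderiv 𝓘(ℝ, E) (fun z ↦ mvfderiv 𝓘(ℝ, E) f z (Z z)) (φ e) (W (φ e)) =
        fderiv ℝ (fderiv ℝ h) e (fieldInChart c W e) (fieldInChart c Z e) +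
          fderiv ℝ h e (fderiv ℝ (fieldInChart c Z) e (fieldInChart c W e)) := by
    intro Z W hZ hfZ
    have h1 := fderiv_comp_chart_symm c he hfZ
    have h2 : HasFDerivAt (fun e ↦ fderiv ℝ h e (fieldInChart c Z e)) _ e :=
      hdd.hasFDerivAt.clm_apply (differentiableAt_fieldInChart c he hZ).hasFDerivAt
    have h3 := h1.unique (h2.congr_of_eventuallyEq (by
      filter_upwards [target_mem_nhds c he] with e' he'
      exact hD e' he' Z))
    have h4 := DFunLike.congr_fun h3 (fieldInChart c W e)
    rw [ContinuousLinearMap.comp_apply, chartDeriv_fieldInChart c he] at h4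
    rw [h4]
    simp [add_comm]
  rw [key Y X hY hfY, key X Y hX hfX, hD e he, fieldInChart_mlieBracket c he hX hY]
  have hs : IsSymmSndFDerivAt ℝ h e :=
    hsm.isSymmSndFDerivAt (by rw [minSmoothness_of_isRCLikeNormedField]; exact two_le_infty)
  rw [hs.eq, map_sub]
  abel

/-- The Lie bracket acts on functions as the commutator of derivations. -/
theorem mvfderiv_mlieBracket [CompleteSpace E] {F : Type*} [NormedAddCommGroup F] [NormedSpace ℝ F]
    {f : M → F} (hf : ContMDiff 𝓘(ℝ, E) 𝓘(ℝ, F) ∞ f)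
    {X Y : (x : M) → TangentSpace 𝓘(ℝ, E) x} {x : M}
    (hX : MDiffAt (T% X) x) (hY : MDiffAt (T% Y) x)
    (hfX : MDiffAt (fun z ↦ mvfderiv 𝓘(ℝ, E) f z (X z)) x)
    (hfY : MDiffAt (fun z ↦ mvfderiv 𝓘(ℝ, E) f z (Y z)) x) :
    mvfderiv 𝓘(ℝ, E) f x (mlieBracket 𝓘(ℝ, E) X Y x) =
      mvfderiv 𝓘(ℝ, E) (fun z ↦ mvfderiv 𝓘(ℝ, E) f z (Y z)) x (X x) -
        mvfderiv 𝓘(ℝ, E) (fun z ↦ mvfderiv 𝓘(ℝ, E) f z (X z)) x (Y x) :=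
  mvfderiv_mlieBracket_chart x hf (mem_extChartAt_target x) (extChartAt_to_inv x) hX hY hfX hfY

end ChartTools

/-! ### Smoothness criteria for sections, and a two-variable chain rule. -/

section Sections

variable {E : Type*} [NormedAddCommGroup E] [NormedSpace ℝ E]
  {M : Type*} [TopologicalSpace M] [ChartedSpace E M] [IsManifold 𝓘(ℝ, E) ∞ M]
  {F : Type*} [NormedAddCommGroup F] [NormedSpace ℝ F]

/-- `df(X)` is the fibre component of the tangent map of `f` composed with the section `X`. -/
theorem contMDiffAt_mvfderiv_apply {f : M → F} (hf : ContMDiff 𝓘(ℝ, E) 𝓘(ℝ, F) ∞ f)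
    {X : (x : M) → TangentSpace 𝓘(ℝ, E) x} {x : M} (hX : CMDiffAt ∞ (T% X) x) :
    ContMDiffAt 𝓘(ℝ, E) 𝓘(ℝ, F) ∞ (fun z ↦ mvfderiv 𝓘(ℝ, E) f z (X z)) x := by
  have : IsManifold 𝓘(ℝ, E) 1 M := IsManifold.of_le (n := ∞) (by simp)
  have h1 : ContMDiffAt 𝓘(ℝ, E) _ ∞ (fun z ↦ tangentMap 𝓘(ℝ, E) 𝓘(ℝ, F) f ⟨z, X z⟩) x :=
    (hf.contMDiff_tangentMap (m := ∞) (by simp)).contMDiffAt.comp x hX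
  exact (contMDiff_snd_tangentBundle_modelSpace F 𝓘(ℝ, F)).contMDiffAt.comp x h1

theorem mdifferentiableAt_mvfderiv_apply {f : M → F} (hf : ContMDiff 𝓘(ℝ, E) 𝓘(ℝ, F) ∞ f)
    {X : (x : M) → TangentSpace 𝓘(ℝ, E) x} {x : M} (hX : MDiffAt (T% X) x) :
    MDifferentiableAt 𝓘(ℝ, E) 𝓘(ℝ, F) (fun z ↦ mvfderiv 𝓘(ℝ, E) f z (X z)) x := by
  have : IsManifold 𝓘(ℝ, E) 1 M := IsManifold.of_le (n := ∞) (by simp)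
  have h1 : MDifferentiableAt 𝓘(ℝ, E) _ (fun z ↦ tangentMap 𝓘(ℝ, E) 𝓘(ℝ, F) f ⟨z, X z⟩) x :=
    ((hf.contMDiff_tangentMap (m := ∞) (by simp)).mdifferentiable (by simp) _).comp x hX
  exact ((contMDiff_snd_tangentBundle_modelSpace F 𝓘(ℝ, F) (n := 1)).mdifferentiable
    one_ne_zero _).comp x h1

theorem contMDiffAt_coordField [CompleteSpace E]
    (c : M) {x : M} (hx : x ∈ (extChartAt 𝓘(ℝ, E) c).source) (v : E) :
    CMDiffAt ∞ (T% (coordField c v)) x := by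
  have : IsManifold 𝓘(ℝ, E) 1 M := IsManifold.of_le (n := ∞) (by simp)
  let V : (e : E) → TangentSpace 𝓘(ℝ, E) e := fun _ ↦ v
  have hv : CMDiffAt ∞ (T% V) (extChartAt 𝓘(ℝ, E) c x) :=
    (contMDiffAt_vectorSpace_iff_contDiffAt (V := V)
      (x := extChartAt 𝓘(ℝ, E) c x)).2 contDiffAt_const
  exact hv.mpullback_vectorField_preimage (contMDiffAt_chart c hx)
    (isInvertible_mfderiv_extChartAt hx) (by simp)

-- In a finite basis `f` is the sum of the constant rank-one maps `bᵢ^* ⊗ f(bᵢ)`.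
omit [IsManifold 𝓘(ℝ, E) ∞ M] in
theorem contMDiffAt_clm_of_apply {V W : Type*} [NormedAddCommGroup V] [NormedSpace ℝ V]
    [NormedAddCommGroup W] [NormedSpace ℝ W] [FiniteDimensional ℝ V] {f : M → V →L[ℝ] W} {x : M}
    (h : ∀ v, ContMDiffAt 𝓘(ℝ, E) 𝓘(ℝ, W) ∞ (fun z ↦ f z v) x) :
    ContMDiffAt 𝓘(ℝ, E) 𝓘(ℝ, V →L[ℝ] W) ∞ f x := by
  let b := Module.finBasis ℝ V
  have hf : f = fun z ↦ ∑ i, (ContinuousLinearMap.smulRightL ℝ V W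
      (b.coord i).toContinuousLinearMap) (f z (b i)) := by
    funext z
    refine ContinuousLinearMap.coe_injective (b.ext fun j ↦ ?_)
    simp [Finsupp.single_apply]
  rw [hf]
  refine contMDiffAt_finsetSum fun i _ ↦ ?_
  exact (ContinuousLinearMap.contMDiff _).contMDiffAt.comp x (h _)

/-- A field of bilinear forms is smooth if its components in charts are smooth. -/
theorem contMDiff_bilin_of_coordField [FiniteDimensional ℝ E]
    (g : (x : M) → TangentSpace 𝓘(ℝ, E) x →L[ℝ] TangentSpace 𝓘(ℝ, E) x →L[ℝ] ℝ)
    (hg : ∀ (c : M) (v w : E), ContMDiffAt 𝓘(ℝ, E) 𝓘(ℝ, ℝ) ∞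
      (fun z ↦ g z (coordField c v z) (coordField c w z)) c) :
    ContMDiff 𝓘(ℝ, E) (𝓘(ℝ, E).prod 𝓘(ℝ, E →L[ℝ] E →L[ℝ] ℝ)) ∞
      (fun b ↦ TotalSpace.mk' (E →L[ℝ] E →L[ℝ] ℝ)
        (E := fun x : M ↦ TangentSpace 𝓘(ℝ, E) x →L[ℝ] TangentSpace 𝓘(ℝ, E) x →L[ℝ] ℝ)
        b (g b)) := by
  have : IsManifold 𝓘(ℝ, E) 1 M := IsManifold.of_le (n := ∞) (by simp)
  intro c
  rw [contMDiffAt_section]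
  refine contMDiffAt_clm_of_apply fun v ↦ contMDiffAt_clm_of_apply fun w ↦ ?_
  refine (hg c v w).congr_of_eventuallyEq ?_
  filter_upwards [(isOpen_extChartAt_source (I := 𝓘(ℝ, E)) c).mem_nhds (mem_extChartAt_source c)]
    with x hx
  have hx' : x ∈ (chartAt E c).source := by simpa using hx
  -- The tangent trivialization at `c` is the derivative of the chart, so its inverse sends constant
  -- vectors to coordinate fields.
  have hs : ∀ v : E, (trivializationAt E (TangentSpace 𝓘(ℝ, E)) c).symmL ℝ x v =
      coordField c v x := by
    intro v
    have hi := isInvertible_mfderiv_extChartAt (I := 𝓘(ℝ, E)) hx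
    have h1 := TangentBundle.continuousLinearMapAt_trivializationAt (I := 𝓘(ℝ, E)) hx'
    have h2 := (trivializationAt E (TangentSpace 𝓘(ℝ, E)) c).continuousLinearMapAt_symmL (R := ℝ)
      (b := x) (by simpa using hx') v
    have h3 := DFunLike.congr_fun h1
      ((trivializationAt E (TangentSpace 𝓘(ℝ, E)) c).symmL ℝ x v)
    exact (hi.inverse_apply_eq.2 (h2.symm.trans h3)).symm
  rw [hom_trivializationAt_apply]
  rw [← hs v, ← hs w]
  have hb : x ∈ (trivializationAt (E →L[ℝ] ℝ)
      (fun x : M ↦ TangentSpace 𝓘(ℝ, E) x →L[ℝ] ℝ) c).baseSet := by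
    simp [hom_trivializationAt_baseSet, hx']
  simp only [ContinuousLinearMap.inCoordinates, ContinuousLinearMap.comp_apply,
    Trivialization.continuousLinearMapAt_apply, Trivialization.linearMapAt_apply, if_pos hb]
  rw [hom_trivializationAt_apply]
  simp [ContinuousLinearMap.inCoordinates]

/-- The chain rule for a function of two vector-valued functions. -/
theorem mvfderiv_comp₂ {F₁ F₂ : Type*} [NormedAddCommGroup F₁] [NormedSpace ℝ F₁]
    [NormedAddCommGroup F₂] [NormedSpace ℝ F₂] {G : F₁ → F₂ → F} {f₁ : M → F₁} {f₂ : M → F₂}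
    {x : M} {G' : F₁ × F₂ →L[ℝ] F} (hG : HasFDerivAt (fun p : F₁ × F₂ ↦ G p.1 p.2) G' (f₁ x, f₂ x))
    (h₁ : MDifferentiableAt 𝓘(ℝ, E) 𝓘(ℝ, F₁) f₁ x)
    (h₂ : MDifferentiableAt 𝓘(ℝ, E) 𝓘(ℝ, F₂) f₂ x) (v : TangentSpace 𝓘(ℝ, E) x) :
    mvfderiv 𝓘(ℝ, E) (fun z ↦ G (f₁ z) (f₂ z)) x v =
      G' (mvfderiv 𝓘(ℝ, E) f₁ x v, mvfderiv 𝓘(ℝ, E) f₂ x v) := by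
  obtain ⟨c, e, he, rfl⟩ : ∃ c : M, ∃ e ∈ (extChartAt 𝓘(ℝ, E) c).target,
      (extChartAt 𝓘(ℝ, E) c).symm e = x := ⟨x, _, mem_extChartAt_target x, extChartAt_to_inv x⟩
  have hh₁ := fderiv_comp_chart_symm c he h₁
  have hh₂ := fderiv_comp_chart_symm c he h₂
  have hG' := hG.comp e (hh₁.prodMk hh₂)
  have hGm : MDifferentiableAt 𝓘(ℝ, E) 𝓘(ℝ, F) (fun z ↦ G (f₁ z) (f₂ z))
      ((extChartAt 𝓘(ℝ, E) c).symm e) :=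
    MDifferentiableAt.comp (f := fun z ↦ (f₁ z, f₂ z)) ((extChartAt 𝓘(ℝ, E) c).symm e)
      hG.differentiableAt.mdifferentiableAt (h₁.prodMk_space h₂)
  have h3 := (fderiv_comp_chart_symm c he hGm).unique hG'
  obtain ⟨w, rfl⟩ := (isInvertible_chartDeriv c he).surjective v
  exact DFunLike.congr_fun h3 w

end Sections

/-! ### Parallelized manifolds with constant structure constants and their Levi-Civita connection.
-/

/-- A global frame of a manifold with constant structure constants `bracket`. It is described
through a smooth map `emb` into a vector space, in which the frame takes the form
`rho (emb x) : 𝔥 → 𝒜`, with left inverse `lam (emb x)`. -/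
structure Framing (E : Type*) [NormedAddCommGroup E] [NormedSpace ℝ E]
    (M : Type*) [TopologicalSpace M] [ChartedSpace E M] [IsManifold 𝓘(ℝ, E) ∞ M]
    (𝒜 : Type*) [NormedAddCommGroup 𝒜] [NormedSpace ℝ 𝒜]
    (𝔥 : Type*) [NormedAddCommGroup 𝔥] [InnerProductSpace ℝ 𝔥] where
  emb : M → 𝒜
  contMDiff_emb : ContMDiff 𝓘(ℝ, E) 𝓘(ℝ, 𝒜) ∞ emb
  rho : 𝒜 → 𝔥 →L[ℝ] 𝒜
  contDiff_rho : ContDiff ℝ ∞ rho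
  lam : 𝒜 → 𝒜 →L[ℝ] 𝔥
  contDiff_lam : ContDiff ℝ ∞ lam
  frame : (x : M) → 𝔥 →L[ℝ] TangentSpace 𝓘(ℝ, E) x
  contMDiff_frame : ∀ a, CMDiff ∞ (T% (fun x ↦ frame x a))
  mvfderiv_frame : ∀ x a, mvfderiv 𝓘(ℝ, E) emb x (frame x a) = rho (emb x) a
  frame_lam : ∀ x v, frame x (lam (emb x) (mvfderiv 𝓘(ℝ, E) emb x v)) = v
  lam_rho : ∀ x a, lam (emb x) (rho (emb x) a) = a
  bracket : 𝔥 →L[ℝ] 𝔥 →L[ℝ] 𝔥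
  bracket_spec : ∀ x a b, fderiv ℝ rho (emb x) (rho (emb x) a) b -
    fderiv ℝ rho (emb x) (rho (emb x) b) a = rho (emb x) (bracket a b)

namespace Framing

variable {E : Type*} [NormedAddCommGroup E] [NormedSpace ℝ E]
  {M : Type*} [TopologicalSpace M] [ChartedSpace E M] [IsManifold 𝓘(ℝ, E) ∞ M]
  {𝒜 : Type*} [NormedAddCommGroup 𝒜] [NormedSpace ℝ 𝒜]
  {𝔥 : Type*} [NormedAddCommGroup 𝔥] [InnerProductSpace ℝ 𝔥] (Φ : Framing E M 𝒜 𝔥)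

/-- The coframe dual to the frame. -/
def coframe (x : M) : TangentSpace 𝓘(ℝ, E) x →L[ℝ] 𝔥 :=
  (Φ.lam (Φ.emb x)).comp (mvfderiv 𝓘(ℝ, E) Φ.emb x)

@[simp] theorem coframe_frame (x : M) (a : 𝔥) : Φ.coframe x (Φ.frame x a) = a := by
  rw [coframe, ContinuousLinearMap.comp_apply, Φ.mvfderiv_frame, Φ.lam_rho]

@[simp] theorem frame_coframe (x : M) (v : TangentSpace 𝓘(ℝ, E) x) :
    Φ.frame x (Φ.coframe x v) = v := Φ.frame_lam x v

/-- The coframe as a continuous linear equivalence. -/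
def coframeEquiv (x : M) : TangentSpace 𝓘(ℝ, E) x ≃L[ℝ] 𝔥 :=
  ContinuousLinearEquiv.equivOfInverse (Φ.coframe x) (Φ.frame x) (Φ.frame_coframe x)
    (Φ.coframe_frame x)

theorem mvfderiv_emb (x : M) (v : TangentSpace 𝓘(ℝ, E) x) :
    mvfderiv 𝓘(ℝ, E) Φ.emb x v = Φ.rho (Φ.emb x) (Φ.coframe x v) := by
  conv_lhs => rw [← Φ.frame_coframe x v, Φ.mvfderiv_frame]

/-- `emb` is an immersion, so identities between tangent vectors may be tested in `𝒜`. -/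
theorem mvfderiv_emb_injective (x : M) :
    Function.Injective (mvfderiv 𝓘(ℝ, E) Φ.emb x) := by
  intro v w h
  rw [← Φ.frame_lam x v, h, Φ.frame_lam]

theorem contMDiffAt_coframe_apply {Y : (x : M) → TangentSpace 𝓘(ℝ, E) x} {x : M}
    (hY : CMDiffAt ∞ (T% Y) x) :
    ContMDiffAt 𝓘(ℝ, E) 𝓘(ℝ, 𝔥) ∞ (fun z ↦ Φ.coframe z (Y z)) x :=
  (Φ.contDiff_lam.contMDiff.contMDiffAt.comp x Φ.contMDiff_emb.contMDiffAt).clm_apply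
    (contMDiffAt_mvfderiv_apply Φ.contMDiff_emb hY)

theorem mdifferentiableAt_coframe_apply {Y : (x : M) → TangentSpace 𝓘(ℝ, E) x} {x : M}
    (hY : MDiffAt (T% Y) x) :
    MDifferentiableAt 𝓘(ℝ, E) 𝓘(ℝ, 𝔥) (fun z ↦ Φ.coframe z (Y z)) x :=
  ((Φ.contDiff_lam.contMDiff.comp Φ.contMDiff_emb).mdifferentiable (by simp) x).clm_apply
    (mdifferentiableAt_mvfderiv_apply Φ.contMDiff_emb hY)

variable [FiniteDimensional ℝ E] [FiniteDimensional ℝ 𝔥]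

set_option linter.unusedSectionVars false

/-- The Riemannian metric for which the frame is isometric. -/
def metric : RiemMetric E M where
  inner x := ((Φ.coframe x).precomp ℝ).comp ((innerSL ℝ).comp (Φ.coframe x))
  symm x v w := by simp [real_inner_comm]
  pos x v hv := by
    have : Φ.coframe x v ≠ 0 := fun h ↦ hv (by rw [← Φ.frame_coframe x v, h, map_zero])
    have h2 := pow_pos (norm_pos_iff.2 this) 2
    simpa using h2
  isVonNBounded x := by
    refine ((NormedSpace.isVonNBounded_ball ℝ 𝔥 1).image (Φ.frame x)).subset ?_
    intro v hv
    refine ⟨Φ.coframe x v, ?_, Φ.frame_coframe x v⟩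
    have hv' : ‖Φ.coframe x v‖ ^ 2 < 1 := by
      simpa [real_inner_self_eq_norm_sq] using hv
    rw [mem_ball_zero_iff]
    nlinarith [norm_nonneg (Φ.coframe x v)]
  contMDiff := by
    refine contMDiff_bilin_of_coordField _ fun c v w ↦ ?_
    have h := fun v ↦ Φ.contMDiffAt_coframe_apply
      (contMDiffAt_coordField c (mem_extChartAt_source (I := 𝓘(ℝ, E)) c) v)
    exact (contDiff_inner (𝕜 := ℝ)).contMDiff.contMDiffAt.comp c ((h v).prodMk_space (h w))

theorem metric_inner (x : M) (v w : TangentSpace 𝓘(ℝ, E) x) :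
    Φ.metric.inner x v w = ⟪Φ.coframe x v, Φ.coframe x w⟫_ℝ := rfl

/-- The connection coefficients of the Levi-Civita connection in the frame. -/
def christoffel : 𝔥 →ₗ[ℝ] 𝔥 →ₗ[ℝ] 𝔥 :=
  -- Koszul's formula when inner products of frame fields are constant: `2⟪∇_a b, c⟫ = ⟪[a,b], c⟫ -
  -- ⟪[b,c], a⟫ - ⟪[a,c], b⟫`.
  LinearMap.mk₂ ℝ (fun a b ↦ (2 : ℝ)⁻¹ • (Φ.bracket a b -
      ContinuousLinearMap.adjoint (Φ.bracket b) a - ContinuousLinearMap.adjoint (Φ.bracket a) b))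
    (fun a a' b ↦ by simp only [map_add, add_apply]; module)
    (fun r a b ↦ by simp only [map_smul, smul_apply]; module)
    (fun a b b' ↦ by simp only [map_add, add_apply]; module)
    (fun r a b ↦ by simp only [map_smul, smul_apply]; module)

theorem christoffel_apply (a b : 𝔥) : Φ.christoffel a b = (2 : ℝ)⁻¹ • (Φ.bracket a b -
      ContinuousLinearMap.adjoint (Φ.bracket b) a -
      ContinuousLinearMap.adjoint (Φ.bracket a) b) := rfl

theorem rho_injective (x : M) : Function.Injective (Φ.rho (Φ.emb x)) := fun a b h ↦ by
  rw [← Φ.lam_rho x a, h, Φ.lam_rho]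

theorem bracket_antisymm [Nonempty M] (a b : 𝔥) : Φ.bracket a b = - Φ.bracket b a := by
  obtain ⟨x⟩ := ‹Nonempty M›
  apply Φ.rho_injective x
  rw [map_neg, ← Φ.bracket_spec, ← Φ.bracket_spec, neg_sub]

theorem bracket_self [Nonempty M] (a : 𝔥) : Φ.bracket a a = 0 := by
  obtain ⟨x⟩ := ‹Nonempty M›
  apply Φ.rho_injective x
  rw [map_zero, ← Φ.bracket_spec, sub_self]

theorem christoffel_sub [Nonempty M] (a b : 𝔥) :
    Φ.christoffel a b - Φ.christoffel b a = Φ.bracket a b := by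
  rw [christoffel_apply, christoffel_apply, Φ.bracket_antisymm b a]
  module

theorem inner_christoffel [Nonempty M] (v a b : 𝔥) :
    ⟪Φ.christoffel v a, b⟫_ℝ + ⟪a, Φ.christoffel v b⟫_ℝ = 0 := by
  simp only [christoffel_apply, inner_smul_left, inner_smul_right, inner_sub_left, inner_sub_right,
    ContinuousLinearMap.adjoint_inner_left, ContinuousLinearMap.adjoint_inner_right]
  rw [Φ.bracket_antisymm b a, real_inner_comm v]
  simp only [inner_neg_right, conj_trivial]
  ring

/-- The Levi-Civita connection. -/
def connection : Connection E M where
  toFun Y x := (Φ.frame x).comp (mvfderiv 𝓘(ℝ, E) (fun z ↦ Φ.coframe z (Y z)) x +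
    ((Φ.christoffel.flip (Φ.coframe x (Y x))).toContinuousLinearMap).comp (Φ.coframe x))
  isCovariantDerivativeOnUniv :=
    { add := by
        intro σ σ' x hσ hσ' _
        have h : (fun z ↦ Φ.coframe z ((σ + σ') z)) =
            (fun z ↦ Φ.coframe z (σ z)) + fun z ↦ Φ.coframe z (σ' z) := by
          ext z; simp
        ext v
        rw [h, mvfderiv_add (Φ.mdifferentiableAt_coframe_apply hσ)
          (Φ.mdifferentiableAt_coframe_apply hσ')]
        simp only [ContinuousLinearMap.comp_apply, add_apply, map_add,
          Pi.add_apply, LinearMap.coe_toContinuousLinearMap', LinearMap.flip_apply]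
        abel
      leibniz := by
        intro σ f x hσ hf _
        have h : (fun z ↦ Φ.coframe z ((f • σ) z)) = f • (fun z ↦ Φ.coframe z (σ z)) := by
          ext z; simp
        ext v
        rw [h, mvfderiv_smul hf (Φ.mdifferentiableAt_coframe_apply hσ)]
        simp only [ContinuousLinearMap.comp_apply, add_apply, map_add,
          Pi.smul_apply', LinearMap.coe_toContinuousLinearMap', LinearMap.flip_apply,
          smul_apply, map_smul, ContinuousLinearMap.smulRight_apply,
          frame_coframe, smul_add]
        abel }

theorem coframe_connection (Y : (x : M) → TangentSpace 𝓘(ℝ, E) x) (x : M)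
    (v : TangentSpace 𝓘(ℝ, E) x) :
    Φ.coframe x (Φ.connection Y x v) = mvfderiv 𝓘(ℝ, E) (fun z ↦ Φ.coframe z (Y z)) x v +
      Φ.christoffel (Φ.coframe x v) (Φ.coframe x (Y x)) :=
  Φ.coframe_frame x _

/-- This is the Leibniz rule for `rho (emb z) (coframe z (Y z))`. Antisymmetrizing its first term in
two fields produces the structure constants. -/
theorem mvfderiv_mvfderiv_emb {Y : (x : M) → TangentSpace 𝓘(ℝ, E) x} {x : M}
    (hY : MDiffAt (T% Y) x) (v : TangentSpace 𝓘(ℝ, E) x) :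
    mvfderiv 𝓘(ℝ, E) (fun z ↦ mvfderiv 𝓘(ℝ, E) Φ.emb z (Y z)) x v =
      fderiv ℝ Φ.rho (Φ.emb x) (Φ.rho (Φ.emb x) (Φ.coframe x v)) (Φ.coframe x (Y x)) +
        Φ.rho (Φ.emb x) (mvfderiv 𝓘(ℝ, E) (fun z ↦ Φ.coframe z (Y z)) x v) := by
  have hr : HasFDerivAt Φ.rho (fderiv ℝ Φ.rho (Φ.emb x)) (Φ.emb x) :=
    (Φ.contDiff_rho.differentiable (by simp) _).hasFDerivAt
  have hG : HasFDerivAt (fun p : 𝒜 × 𝔥 ↦ Φ.rho p.1 p.2) _ (Φ.emb x, Φ.coframe x (Y x)) :=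
    (HasFDerivAt.comp (Φ.emb x, Φ.coframe x (Y x)) hr hasFDerivAt_fst).clm_apply hasFDerivAt_snd
  rw [funext fun z ↦ Φ.mvfderiv_emb z (Y z),
    mvfderiv_comp₂ (G := fun p a ↦ Φ.rho p a) hG (Φ.contMDiff_emb.mdifferentiable (by simp) x)
      (Φ.mdifferentiableAt_coframe_apply hY), ← Φ.mvfderiv_emb x v, add_comm]
  rfl

theorem isLeviCivita : IsLeviCivita Φ.metric Φ.connection where
  torsion_free X Y x hX hY := by
    have : Nonempty M := ⟨x⟩
    -- On the vector-valued function `emb` the Lie bracket acts as a commutator of derivatives, to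
    -- which `bracket_spec` applies.
    apply Φ.mvfderiv_emb_injective x
    rw [mvfderiv_mlieBracket Φ.contMDiff_emb hX hY
      (mdifferentiableAt_mvfderiv_apply Φ.contMDiff_emb hX)
      (mdifferentiableAt_mvfderiv_apply Φ.contMDiff_emb hY), Φ.mvfderiv_mvfderiv_emb hX,
      Φ.mvfderiv_mvfderiv_emb hY, map_sub, Φ.mvfderiv_emb, Φ.mvfderiv_emb, Φ.coframe_connection,
      Φ.coframe_connection]
    have h := Φ.bracket_spec x (Φ.coframe x (X x)) (Φ.coframe x (Y x))
    rw [← Φ.christoffel_sub] at h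
    simp only [map_add, map_sub] at h ⊢
    rw [sub_eq_iff_eq_add] at h
    rw [h]
    abel
  metric_compatible Y Z x hY hZ v := by
    have : Nonempty M := ⟨x⟩
    have hG : HasFDerivAt (fun p : 𝔥 × 𝔥 ↦ ⟪p.1, p.2⟫_ℝ) _
        (Φ.coframe x (Y x), Φ.coframe x (Z x)) :=
      (hasFDerivAt_fst (𝕜 := ℝ)).inner ℝ (hasFDerivAt_snd (𝕜 := ℝ))
    have h3 := mvfderiv_comp₂ (G := fun a b ↦ ⟪a, b⟫_ℝ) hG (Φ.mdifferentiableAt_coframe_apply hY)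
        (Φ.mdifferentiableAt_coframe_apply hZ) v
    have h4 : mvfderiv 𝓘(ℝ, E) (fun z ↦ Φ.metric.inner z (Y z) (Z z)) x v =
        ⟪Φ.coframe x (Y x), mvfderiv 𝓘(ℝ, E) (fun z ↦ Φ.coframe z (Z z)) x v⟫_ℝ +
          ⟪mvfderiv 𝓘(ℝ, E) (fun z ↦ Φ.coframe z (Y z)) x v, Φ.coframe x (Z x)⟫_ℝ := h3
    rw [h4, metric_inner, metric_inner, Φ.coframe_connection, Φ.coframe_connection,
      inner_add_left, inner_add_right]
    linarith [Φ.inner_christoffel (Φ.coframe x v) (Φ.coframe x (Y x)) (Φ.coframe x (Z x))]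

/-- The coframe pulls a determinant on `𝔥` back to a nowhere vanishing top form. -/
theorem isOrientable (Φ : Framing E M 𝒜 𝔥) [Nonempty M] : IsOrientable E M := by
  obtain ⟨x₀⟩ := ‹Nonempty M›
  let b : Module.Basis (Fin (Module.finrank ℝ E)) ℝ 𝔥 :=
    (Module.finBasis ℝ E).map (Φ.coframeEquiv x₀).toLinearEquiv
  refine ⟨fun x ↦ b.det.compLinearMap (Φ.coframe x).toLinearMap, fun x h ↦ ?_, fun X ↦ ?_⟩
  · have h1 := DFunLike.congr_fun h (fun i ↦ Φ.frame x (b i))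
    have h2 : b.det b = 0 := by simpa [AlternatingMap.compLinearMap_apply] using h1
    simp [b.det_self] at h2
  · have hX : ∀ i, ContMDiff 𝓘(ℝ, E) 𝓘(ℝ, 𝔥) ∞ (fun x ↦ Φ.coframe x (X i x)) :=
      fun i x ↦ Φ.contMDiffAt_coframe_apply ((X i).contMDiff x)
    have hd : ContDiff ℝ ∞ (fun v : Fin (Module.finrank ℝ E) → 𝔥 ↦ b.det v) := by
      have : (fun v : Fin (Module.finrank ℝ E) → 𝔥 ↦ b.det v) =
          fun v ↦ ∑ σ : Equiv.Perm (Fin (Module.finrank ℝ E)),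
            (Equiv.Perm.sign σ : ℝ) * ∏ i, (b.coord (σ i)).toContinuousLinearMap (v i) := by
        funext v
        rw [Module.Basis.det_apply, Matrix.det_apply']
        rfl
      rw [this]
      fun_prop
    exact hd.contMDiff.comp (contMDiff_pi_space.2 hX)

theorem connection_frame (a : 𝔥) (x : M) :
    Φ.connection (fun z ↦ Φ.frame z a) x =
      (Φ.frame x).comp (((Φ.christoffel.flip a).toContinuousLinearMap).comp (Φ.coframe x)) := by
  have h : (fun z ↦ Φ.coframe z (Φ.frame z a)) = fun _ : M ↦ a :=
    funext fun z ↦ Φ.coframe_frame z a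
  change (Φ.frame x).comp (mvfderiv 𝓘(ℝ, E) (fun z ↦ Φ.coframe z (Φ.frame z a)) x +
    ((Φ.christoffel.flip (Φ.coframe x (Φ.frame x a))).toContinuousLinearMap).comp
      (Φ.coframe x)) = _
  rw [h, mvfderiv_const, zero_add, Φ.coframe_frame]

/-- This is the nonlinearity of the Euler–Arnold equation: `∇_a a = - ad_a^* a`. -/
theorem christoffel_self [Nonempty M] (a : 𝔥) :
    Φ.christoffel a a = - ContinuousLinearMap.adjoint (Φ.bracket a) a := by
  have h : Φ.bracket a a = 0 := Φ.bracket_self a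
  rw [christoffel_apply, h]
  module

/-- In an orthonormal basis the diagonal entry of `v ↦ ∇_v a` is `½(⟪[e,a], e⟫ - ⟪e, [a,e]⟫ - ⟪a,
[e,e]⟫) = - ⟪[a,e], e⟫`. Hence frame fields are divergence free exactly when `ad_a` is traceless. -/
theorem divergence_frame [Nonempty M] (a : 𝔥) (x : M) :
    divergence Φ.connection (fun z ↦ Φ.frame z a) x =
      - LinearMap.trace ℝ 𝔥 (Φ.bracket a).toLinearMap := by
  have h0 : (Φ.connection (fun z ↦ Φ.frame z a) x).toLinearMap =
      (Φ.coframeEquiv x).symm.toLinearEquiv.conj (Φ.christoffel.flip a) := by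
    rw [connection_frame]
    rfl
  rw [divergence, h0, LinearMap.trace_conj', LinearMap.trace_eq_sum_inner _ (stdOrthonormalBasis ℝ 𝔥),
    LinearMap.trace_eq_sum_inner _ (stdOrthonormalBasis ℝ 𝔥), ← Finset.sum_neg_distrib]
  refine Finset.sum_congr rfl fun i _ ↦ ?_
  set e := stdOrthonormalBasis ℝ 𝔥 i
  have h : Φ.bracket e e = 0 := Φ.bracket_self e
  rw [LinearMap.flip_apply, christoffel_apply, inner_smul_right, inner_sub_right, inner_sub_right,
    ContinuousLinearMap.adjoint_inner_right, ContinuousLinearMap.adjoint_inner_right, h,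
    inner_zero_left, Φ.bracket_antisymm e a, inner_neg_right, real_inner_comm e]
  simp only [ContinuousLinearMap.coe_coe]
  ring

end Framing

theorem gradient_zero {E : Type*} [NormedAddCommGroup E] [NormedSpace ℝ E] [FiniteDimensional ℝ E]
    {M : Type*} [TopologicalSpace M] [ChartedSpace E M] [IsManifold 𝓘(ℝ, E) ∞ M]
    (g : RiemMetric E M) (x : M) : gradient g (fun _ ↦ 0) x = 0 := by
  by_contra h
  have h1 := g.pos x _ h
  rw [inner_gradient, mvfderiv_const] at h1
  exact lt_irrefl _ h1

/-- A quadratic equation embeds into the Euler equations on a framed manifold if it is the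
restriction of the Euler-Arnold equation of the frame to a linear subspace. -/
theorem Framing.exists_embedsIntoEuler {E M : Type} [NormedAddCommGroup E] [NormedSpace ℝ E]
    [FiniteDimensional ℝ E] [TopologicalSpace M] [ChartedSpace E M] [IsManifold 𝓘(ℝ, E) ∞ M]
    [T2Space M] [CompactSpace M] [ConnectedSpace M]
    {𝒜 : Type*} [NormedAddCommGroup 𝒜] [NormedSpace ℝ 𝒜]
    {𝔥 : Type*} [NormedAddCommGroup 𝔥] [InnerProductSpace ℝ 𝔥] [FiniteDimensional ℝ 𝔥]
    (Φ : Framing E M 𝒜 𝔥)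
    {V : Type*} [NormedAddCommGroup V] [NormedSpace ℝ V] [FiniteDimensional ℝ V]
    (B : V →ₗ[ℝ] V →ₗ[ℝ] V) (U : V →ₗ[ℝ] 𝔥) (hU : Function.Injective U)
    (hB : ∀ y w, ⟪Φ.bracket (U y) w, U y⟫_ℝ = ⟪w, U (B y y)⟫_ℝ)
    (htr : ∀ y, LinearMap.trace ℝ 𝔥 (Φ.bracket (U y)).toLinearMap = 0) :
    ∃ N : CompactRiemannianManifold, EmbedsIntoEuler B N := by
  let N : CompactRiemannianManifold :=
    { E := E, M := M, orientable := Φ.isOrientable, g := Φ.metric }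
  let W : V →ₗ[ℝ] VectorFields E M :=
    { toFun := fun y ↦ ⟨fun x ↦ Φ.frame x (U y), Φ.contMDiff_frame (U y)⟩
      map_add' := fun y z ↦ by ext x; simp
      map_smul' := fun r y ↦ by ext x; simp }
  -- The pressure is zero: `hB` says `ad_a^* a = U (B y y)` for `a = U y`, so the time derivative
  -- cancels `∇_u u` exactly.
  refine ⟨N, Φ.connection, Φ.isLeviCivita, W, fun _ ↦ 0, ?_, ?_⟩
  · intro y z h
    obtain ⟨x⟩ : Nonempty M := inferInstance
    have h1 : Φ.frame x (U y) = Φ.frame x (U z) := congrArg (fun w : VectorFields E M ↦ w x) h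
    apply hU
    rw [← Φ.coframe_frame x (U y), h1, Φ.coframe_frame]
  · intro J y _ hy t ht x
    refine ⟨⟨Φ.frame x (U (B (y t) (y t))), ?_, ?_⟩, ?_⟩
    · let L : V →L[ℝ] E := (Φ.frame x).comp U.toContinuousLinearMap
      exact L.hasFDerivAt.comp_hasDerivWithinAt t (hy t ht)
    · have h1 : ContinuousLinearMap.adjoint (Φ.bracket (U (y t))) (U (y t)) =
          U (B (y t) (y t)) := by
        refine ext_inner_left ℝ fun w ↦ ?_
        rw [ContinuousLinearMap.adjoint_inner_right, hB]
      have h2 : Φ.connection (fun z ↦ Φ.frame z (U (y t))) x (Φ.frame x (U (y t))) =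
          - Φ.frame x (U (B (y t) (y t))) := by
        rw [Φ.connection_frame]
        simp [Φ.christoffel_self, h1]
      have h3 : gradient N.g ((0 : ScalarFields E M) : M → ℝ) x = 0 := gradient_zero N.g x
      change Φ.frame x (U (B (y t) (y t))) +
        Φ.connection (fun z ↦ Φ.frame z (U (y t))) x (Φ.frame x (U (y t))) = _
      rw [h2, add_neg_cancel]
      exact (neg_eq_zero.2 h3).symm
    · exact (Φ.divergence_frame (U (y t)) x).trans (by rw [htr, neg_zero])

/-! ### The Cayley transform between skew and unitary elements. -/

section Cayley

variable {𝒜 : Type*} [NormedRing 𝒜] [NormedAlgebra ℝ 𝒜] [StarRing 𝒜] [CStarRing 𝒜]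
  [FiniteDimensional ℝ 𝒜]

/-- The Cayley transform. -/
def cayley (a : 𝒜) : 𝒜 := (1 + a) * Ring.inverse (1 - a)

/-- The inverse Cayley transform. -/
def cayleyInv (r : 𝒜) : 𝒜 := (r - 1) * Ring.inverse (r + 1)

-- In finite dimension injective left multiplication is surjective, which gives a right inverse;
-- injectivity makes it two-sided.
omit [StarRing 𝒜] [CStarRing 𝒜] in
theorem isUnit_of_mul_left_eq_zero {b : 𝒜} (h : ∀ x, b * x = 0 → x = 0) : IsUnit b := by
  have hinj : Function.Injective (LinearMap.mulLeft ℝ b) :=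
    (injective_iff_map_eq_zero _).2 fun x hx ↦ h x hx
  obtain ⟨c, hc⟩ := (LinearMap.injective_iff_surjective.1 hinj) 1
  have hc' : b * c = 1 := hc
  have hcb : c * b = 1 := by
    apply hinj
    simp only [LinearMap.mulLeft_apply]
    rw [← mul_assoc, hc', one_mul, mul_one]
  exact ⟨⟨b, c, hc', hcb⟩, rfl⟩

/-- If `x = a x` with `a` skew, then `x^* x = (a x)^* x = - x^* x`, so `x = 0` by the C*-identity.
-/
theorem isUnit_one_sub_of_skew {a : 𝒜} (ha : star a = -a) : IsUnit (1 - a) := by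
  apply isUnit_of_mul_left_eq_zero
  intro x hx
  have h1 : x = a * x := by rw [sub_mul, one_mul, sub_eq_zero] at hx; exact hx
  have h2 : star x * x = - (star x * x) := by
    calc star x * x = star (a * x) * x := by rw [← h1]
      _ = - (star x * (a * x)) := by rw [star_mul, ha]; noncomm_ring
      _ = - (star x * x) := by rw [← h1]
  have h3 : (2 : ℝ) • (star x * x) = 0 := by
    rw [two_smul]; nth_rewrite 1 [h2]; simp
  have h4 := (smul_eq_zero.1 h3).resolve_left two_ne_zero
  exact CStarRing.star_mul_self_eq_zero_iff x |>.1 h4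

theorem isUnit_one_add_of_skew {a : 𝒜} (ha : star a = -a) : IsUnit (1 + a) := by
  have := isUnit_one_sub_of_skew (a := -a) (by rw [star_neg, ha])
  rwa [sub_neg_eq_add] at this

omit [StarRing 𝒜] [CStarRing 𝒜] [FiniteDimensional ℝ 𝒜] in
theorem isUnit_two : IsUnit (2 : 𝒜) := by
  have := (isUnit_iff_ne_zero.2 (two_ne_zero (α := ℝ))).map (algebraMap ℝ 𝒜)
  rwa [map_ofNat] at this

theorem cayley_mul {a : 𝒜} (ha : star a = -a) : cayley a * (1 - a) = 1 + a :=
  Ring.inverse_mul_cancel_right _ _ (isUnit_one_sub_of_skew ha)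

theorem star_cayley_mul {a : 𝒜} (ha : star a = -a) : star (cayley a) * (1 + a) = 1 - a := by
  have h1 : (1 + a) * star (cayley a) = 1 - a := by
    have := congrArg star (cayley_mul ha)
    simpa [ha, sub_eq_add_neg] using this
  have hu := isUnit_one_add_of_skew ha
  apply hu.mul_left_cancel
  rw [← mul_assoc, h1]
  noncomm_ring

theorem cayley_mem_unitary {a : 𝒜} (ha : star a = -a) : cayley a ∈ unitary 𝒜 := by
  have hu := isUnit_one_sub_of_skew ha
  have hu' := isUnit_one_add_of_skew ha
  rw [Unitary.mem_iff]
  constructor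
  · apply hu.mul_right_cancel
    rw [mul_assoc, cayley_mul ha, star_cayley_mul ha, one_mul]
  · apply hu'.mul_right_cancel
    rw [mul_assoc, star_cayley_mul ha, cayley_mul ha, one_mul]

/-- Since `(cayley a + 1)(1 - a) = 2`, the transform lands where its inverse is defined. -/
theorem isUnit_cayley_add_one {a : 𝒜} (ha : star a = -a) : IsUnit (cayley a + 1) := by
  have hu := isUnit_one_sub_of_skew ha
  have h : (cayley a + 1) * (1 - a) = 2 := by
    rw [add_mul, cayley_mul ha, one_mul, ← one_add_one_eq_two]; abel
  have h2 : cayley a + 1 = 2 * Ring.inverse (1 - a) := by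
    rw [← h, Ring.mul_inverse_cancel_right _ _ hu]
  rw [h2]
  exact isUnit_two.mul hu.ringInverse

theorem cayleyInv_cayley {a : 𝒜} (ha : star a = -a) : cayleyInv (cayley a) = a := by
  have hu := isUnit_one_sub_of_skew ha
  rw [cayleyInv, eq_comm, Ring.eq_mul_inverse_iff_mul_eq _ _ _ (isUnit_cayley_add_one ha)]
  apply hu.mul_right_cancel
  rw [mul_assoc, add_mul, sub_mul, cayley_mul ha]
  noncomm_ring

omit [StarRing 𝒜] [CStarRing 𝒜] [FiniteDimensional ℝ 𝒜] [NormedAlgebra ℝ 𝒜] in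
theorem cayleyInv_mul {r : 𝒜} (hr : IsUnit (r + 1)) : cayleyInv r * (r + 1) = r - 1 :=
  Ring.inverse_mul_cancel_right _ _ hr

omit [CStarRing 𝒜] [FiniteDimensional ℝ 𝒜] [NormedAlgebra ℝ 𝒜] in
theorem star_cayleyInv {r : 𝒜} (hr : r ∈ unitary 𝒜) (hu : IsUnit (r + 1)) :
    star (cayleyInv r) = - cayleyInv r := by
  have h1 : cayleyInv r * (r + 1) = r - 1 := Ring.inverse_mul_cancel_right _ _ hu
  have hr1 := (Unitary.mem_iff.1 hr).1
  have hr2 := (Unitary.mem_iff.1 hr).2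
  have h2 : (star r + 1) * star (cayleyInv r) = star r - 1 := by
    have := congrArg star h1
    simpa using this
  have h3 : (1 + r) * star (cayleyInv r) = 1 - r := by
    have := congrArg (fun z ↦ r * z) h2
    simp only [← mul_assoc, mul_add, mul_sub, hr2, mul_one] at this
    exact this
  have hu' : IsUnit (1 + r) := by rwa [add_comm]
  apply hu'.mul_left_cancel
  rw [h3]
  apply hu.mul_right_cancel
  rw [mul_assoc, neg_mul, h1]
  noncomm_ring

omit [StarRing 𝒜] [CStarRing 𝒜] [FiniteDimensional ℝ 𝒜] in
theorem cayley_cayleyInv {r : 𝒜} (hu : IsUnit (r + 1)) : cayley (cayleyInv r) = r := by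
  have h1 := cayleyInv_mul hu
  have h2 : (1 - cayleyInv r) * (r + 1) = 2 := by
    rw [sub_mul, h1, ← one_add_one_eq_two]; noncomm_ring
  have h3 : IsUnit (1 - cayleyInv r) := by
    have : 1 - cayleyInv r = 2 * Ring.inverse (r + 1) := by
      rw [← h2, Ring.mul_inverse_cancel_right _ _ hu]
    rw [this]
    exact isUnit_two.mul hu.ringInverse
  rw [cayley, eq_comm, Ring.eq_mul_inverse_iff_mul_eq _ _ _ h3]
  apply hu.mul_right_cancel
  rw [mul_assoc, h2, add_mul, h1]
  noncomm_ring

theorem contDiffAt_cayley {a : 𝒜} (ha : star a = -a) : ContDiffAt ℝ ∞ (cayley : 𝒜 → 𝒜) a := by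
  have : CompleteSpace 𝒜 := FiniteDimensional.complete ℝ 𝒜
  obtain ⟨u, hu⟩ := isUnit_one_sub_of_skew ha
  have h : ContDiffAt ℝ ∞ (fun b : 𝒜 ↦ Ring.inverse (1 - b)) a := by
    apply ContDiffAt.comp (g := Ring.inverse)
    · rw [← hu]; exact contDiffAt_ringInverse ℝ u
    · fun_prop
  exact (contDiffAt_const.add contDiffAt_id).mul h

omit [StarRing 𝒜] [CStarRing 𝒜] in
theorem contDiffAt_cayleyInv {r : 𝒜} (hu : IsUnit (r + 1)) :
    ContDiffAt ℝ ∞ (cayleyInv : 𝒜 → 𝒜) r := by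
  have : CompleteSpace 𝒜 := FiniteDimensional.complete ℝ 𝒜
  obtain ⟨u, hu⟩ := hu
  have h : ContDiffAt ℝ ∞ (fun b : 𝒜 ↦ Ring.inverse (b + 1)) r := by
    apply ContDiffAt.comp (g := Ring.inverse)
    · rw [← hu]; exact contDiffAt_ringInverse ℝ u
    · fun_prop
  exact (contDiffAt_id.sub contDiffAt_const).mul h

-- To first order `(1 + a)(1 - a)⁻¹ = 1 + 2a`. This factor 2 is divided out again in
-- `framingOfUnitary`.
set_option synthInstance.maxHeartbeats 200000 in
omit [StarRing 𝒜] [CStarRing 𝒜] in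
theorem hasFDerivAt_cayley_zero :
    HasFDerivAt (cayley : 𝒜 → 𝒜) ((2 : ℝ) • ContinuousLinearMap.id ℝ 𝒜) 0 := by
  have : CompleteSpace 𝒜 := FiniteDimensional.complete ℝ 𝒜
  have h0 : HasFDerivAt (𝕜 := ℝ) (Ring.inverse : 𝒜 → 𝒜)
      (-ContinuousLinearMap.mulLeftRight ℝ 𝒜 ↑(1 : 𝒜ˣ)⁻¹ ↑(1 : 𝒜ˣ)⁻¹) (1 - (0 : 𝒜)) := by
    rw [sub_zero]; exact hasFDerivAt_ringInverse (𝕜 := ℝ) (1 : 𝒜ˣ)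
  have h1 : HasFDerivAt (fun b : 𝒜 ↦ Ring.inverse (1 - b)) _ 0 :=
    h0.comp (0 : 𝒜) ((hasFDerivAt_id (𝕜 := ℝ) (0 : 𝒜)).const_sub 1)
  have h2 := ((hasFDerivAt_id (𝕜 := ℝ) (0 : 𝒜)).const_add 1).mul' h1
  refine h2.congr_fderiv (ContinuousLinearMap.ext fun v ↦ ?_)
  simp [two_smul]

end Cayley

/-! ### The identity component of a unitary group as a compact manifold with Cayley charts. -/

section UnitaryComponent

set_option linter.unusedSectionVars false

variable (𝒜 : Type*) [NormedRing 𝒜] [NormedAlgebra ℝ 𝒜] [StarRing 𝒜] [CStarRing 𝒜]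
  [StarModule ℝ 𝒜] [FiniteDimensional ℝ 𝒜]

/-- The identity component of the unitary group. -/
abbrev UnitaryComponent : Type _ := connectedComponent (1 : unitary 𝒜)

/-- The Lie algebra of the unitary group. -/
abbrev Skew : Type _ := skewAdjoint.submodule ℝ 𝒜

/-- The skew-adjoint part, as a continuous linear map. -/
def skewPart : 𝒜 →L[ℝ] Skew 𝒜 :=
  LinearMap.toContinuousLinearMap
    { toFun := fun x ↦ ⟨(2 : ℝ)⁻¹ • (x - star x), by
        change star ((2 : ℝ)⁻¹ • (x - star x)) = - ((2 : ℝ)⁻¹ • (x - star x))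
        simp [← smul_neg]⟩
      map_add' := fun x y ↦ Subtype.ext (by simp only [star_add, Submodule.coe_add]; module)
      map_smul' := fun r x ↦ Subtype.ext (by
        simp only [star_smul, star_trivial, RingHom.id_apply, SetLike.val_smul]; module) }

variable {𝒜}

omit [CStarRing 𝒜] [FiniteDimensional ℝ 𝒜] in
theorem Skew.star_eq (a : Skew 𝒜) : star (a : 𝒜) = - a := a.2

theorem skewPart_of_skew {a : 𝒜} (ha : star a = -a) : (skewPart 𝒜 a : 𝒜) = a := by
  change (2 : ℝ)⁻¹ • (a - star a) = a
  rw [ha]; module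

theorem skewPart_coe (a : Skew 𝒜) : skewPart 𝒜 (a : 𝒜) = a :=
  Subtype.ext (skewPart_of_skew a.star_eq)

/-- The inclusion of the identity component of the unitary group. -/
def unitaryVal (P : UnitaryComponent 𝒜) : 𝒜 := ((P : unitary 𝒜) : 𝒜)

theorem continuous_unitaryVal : Continuous (unitaryVal (𝒜 := 𝒜)) :=
  continuous_subtype_val.comp continuous_subtype_val

theorem star_unitaryVal_mul (P : UnitaryComponent 𝒜) : star (unitaryVal P) * unitaryVal P = 1 :=
  Unitary.coe_star_mul_self (P : unitary 𝒜)

theorem unitaryVal_mul_star (P : UnitaryComponent 𝒜) : unitaryVal P * star (unitaryVal P) = 1 :=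
  Unitary.coe_mul_star_self (P : unitary 𝒜)

theorem unitaryVal_injective : Function.Injective (unitaryVal (𝒜 := 𝒜)) :=
  fun _ _ h ↦ Subtype.ext (Subtype.ext h)

/-- The Cayley parametrization based at `p`. -/
def cayleyParam (p : 𝒜) (a : Skew 𝒜) : 𝒜 := p * cayley (a : 𝒜)

/-- The Cayley coordinates based at `p`, defined on the whole algebra. -/
def cayleyCoord (p x : 𝒜) : Skew 𝒜 := skewPart 𝒜 (cayleyInv (star p * x))

theorem contDiff_cayleyParam (p : 𝒜) : ContDiff ℝ ∞ (cayleyParam p) :=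
  contDiff_iff_contDiffAt.2 fun a ↦ contDiffAt_const.mul
    ((contDiffAt_cayley a.star_eq).comp a (skewAdjoint.submodule ℝ 𝒜).subtypeL.contDiff.contDiffAt)

theorem contDiffAt_cayleyCoord {p x : 𝒜} (hx : IsUnit (star p * x + 1)) :
    ContDiffAt ℝ ∞ (cayleyCoord p) x :=
  (skewPart 𝒜).contDiff.contDiffAt.comp x
    ((contDiffAt_cayleyInv hx).comp x (contDiffAt_const.mul contDiffAt_id))

/-- The point of the unitary group with Cayley coordinates `a` with respect to `P`. -/
def cayleyPoint (P : UnitaryComponent 𝒜) (a : Skew 𝒜) : unitary 𝒜 :=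
  (P : unitary 𝒜) * ⟨cayley (a : 𝒜), cayley_mem_unitary a.star_eq⟩

theorem continuous_cayleyPoint (P : UnitaryComponent 𝒜) : Continuous (cayleyPoint P) :=
  Continuous.subtype_mk (contDiff_cayleyParam (unitaryVal P)).continuous _

/-- The skew elements form a connected space, and its continuous image contains `P` (at coordinate
0). -/
theorem cayleyPoint_mem (P : UnitaryComponent 𝒜) (a : Skew 𝒜) :
    cayleyPoint P a ∈ connectedComponent (1 : unitary 𝒜) := by
  have h0 : cayleyPoint P 0 = P := by
    apply Subtype.ext
    change unitaryVal P * cayley ((0 : Skew 𝒜) : 𝒜) = unitaryVal P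
    simp [cayley]
  have h1 : IsPreconnected (range (cayleyPoint P)) :=
    isPreconnected_range (continuous_cayleyPoint P)
  have h2 := h1.subset_connectedComponent (x := (P : unitary 𝒜)) ⟨0, h0⟩
  rw [connectedComponent_eq P.2]
  exact h2 ⟨a, rfl⟩

/-- The Cayley chart based at `P`. -/
def cayleyChart (P : UnitaryComponent 𝒜) :
    OpenPartialHomeomorph (UnitaryComponent 𝒜) (Skew 𝒜) where
  toFun Q := cayleyCoord (unitaryVal P) (unitaryVal Q)
  invFun a := ⟨cayleyPoint P a, cayleyPoint_mem P a⟩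
  source := {Q | IsUnit (star (unitaryVal P) * unitaryVal Q + 1)}
  target := univ
  map_source' _ _ := mem_univ _
  map_target' a _ := by
    change IsUnit (star (unitaryVal P) * (unitaryVal P * cayley (a : 𝒜)) + 1)
    rw [← mul_assoc, star_unitaryVal_mul, one_mul]
    exact isUnit_cayley_add_one a.star_eq
  left_inv' Q hQ := by
    apply unitaryVal_injective
    change unitaryVal P * cayley (skewPart 𝒜 (cayleyInv (star (unitaryVal P) * unitaryVal Q)) : 𝒜)
      = unitaryVal Q
    -- The inverse transform of a unitary element is already skew, so `skewPart` changes nothing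
    -- here; it only extends the coordinate to all of `𝒜`.
    have hm : star (unitaryVal P) * unitaryVal Q ∈ unitary 𝒜 :=
      mul_mem (Unitary.star_mem (P : unitary 𝒜).2) (Q : unitary 𝒜).2
    rw [skewPart_of_skew (star_cayleyInv hm hQ), cayley_cayleyInv hQ, ← mul_assoc,
      unitaryVal_mul_star, one_mul]
  right_inv' a _ := by
    change skewPart 𝒜 (cayleyInv (star (unitaryVal P) * (unitaryVal P * cayley (a : 𝒜)))) = a
    rw [← mul_assoc, star_unitaryVal_mul, one_mul, cayleyInv_cayley a.star_eq, skewPart_coe]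
  open_source := by
    have : CompleteSpace 𝒜 := FiniteDimensional.complete ℝ 𝒜
    exact Units.isOpen.preimage ((continuous_const.mul continuous_unitaryVal).add continuous_const)
  open_target := isOpen_univ
  continuousOn_toFun := fun Q hQ ↦ ContinuousAt.continuousWithinAt
    (ContinuousAt.comp (g := cayleyCoord (unitaryVal P)) (contDiffAt_cayleyCoord hQ).continuousAt
      continuous_unitaryVal.continuousAt)
  continuousOn_invFun := (Continuous.subtype_mk (continuous_cayleyPoint P) _).continuousOn

theorem mem_cayleyChart_source (P : UnitaryComponent 𝒜) : P ∈ (cayleyChart P).source := by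
  change IsUnit (star (unitaryVal P) * unitaryVal P + 1)
  rw [star_unitaryVal_mul, one_add_one_eq_two]
  exact isUnit_two

instance : ChartedSpace (Skew 𝒜) (UnitaryComponent 𝒜) where
  atlas := range cayleyChart
  chartAt := cayleyChart
  mem_chart_source := mem_cayleyChart_source
  chart_mem_atlas P := ⟨P, rfl⟩

/-- A transition map is `cayleyCoord` after `cayleyParam`, a composition of smooth maps through the
ambient algebra. -/
instance : IsManifold 𝓘(ℝ, Skew 𝒜) ∞ (UnitaryComponent 𝒜) := by
  apply isManifold_of_contDiffOn
  rintro _ _ ⟨P, rfl⟩ ⟨Q, rfl⟩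
  intro a ha
  have ha' : IsUnit (star (unitaryVal Q) * cayleyParam (unitaryVal P) a + 1) := by
    have := ha.1
    rw [preimage, mem_ofPred_eq, OpenPartialHomeomorph.trans_source] at this
    exact this.2
  exact ((contDiffAt_cayleyCoord ha').comp a
    (contDiff_cayleyParam (unitaryVal P)).contDiffAt).contDiffWithinAt

instance : CompactSpace (UnitaryComponent 𝒜) := by
  have : ProperSpace 𝒜 := FiniteDimensional.proper ℝ 𝒜
  have h1 : IsCompact (unitary 𝒜 : Set 𝒜) := by
    refine Metric.isCompact_of_isClosed_isBounded isClosed_unitary ?_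
    -- The radius is `‖1‖` rather than 1, as the algebra may be trivial.
    refine (Metric.isBounded_closedBall (x := (0 : 𝒜)) (r := ‖(1 : 𝒜)‖)).subset fun U hU ↦ ?_
    have := CStarRing.norm_mul_mem_unitary (1 : 𝒜) hU
    rw [one_mul] at this
    simp [this]
  have h2 : CompactSpace (unitary 𝒜) := isCompact_iff_compactSpace.1 h1
  exact isCompact_iff_compactSpace.1 isClosed_connectedComponent.isCompact

instance : ConnectedSpace (UnitaryComponent 𝒜) :=
  isConnected_iff_connectedSpace.1 isConnected_connectedComponent

theorem contMDiff_unitaryVal :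
    ContMDiff 𝓘(ℝ, Skew 𝒜) 𝓘(ℝ, 𝒜) ∞ (unitaryVal (𝒜 := 𝒜)) := by
  intro P
  rw [contMDiffAt_iff]
  refine ⟨continuous_unitaryVal.continuousAt, ?_⟩
  exact (contDiff_cayleyParam (unitaryVal P)).contDiffAt.contDiffWithinAt

/-- In its own chart `P` sits at 0, where the Cayley transform has derivative 2. -/
theorem mvfderiv_unitaryVal (P : UnitaryComponent 𝒜) (v : Skew 𝒜) :
    mvfderiv 𝓘(ℝ, Skew 𝒜) (unitaryVal (𝒜 := 𝒜)) P v = (2 : ℝ) • (unitaryVal P * (v : 𝒜)) := by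
  have h0 : extChartAt 𝓘(ℝ, Skew 𝒜) P P = 0 := by
    change skewPart 𝒜 (cayleyInv (star (unitaryVal P) * unitaryVal P)) = 0
    rw [star_unitaryVal_mul, cayleyInv, sub_self, zero_mul, map_zero]
  have h1 := (contMDiff_unitaryVal.mdifferentiable (by simp) P).mvfderiv
  rw [ModelWithCorners.range_eq_univ, fderivWithin_univ, h0] at h1
  have h2 : HasFDerivAt (cayleyParam (unitaryVal P)) _ (0 : Skew 𝒜) :=
    ((hasFDerivAt_cayley_zero (𝒜 := 𝒜)).comp (0 : Skew 𝒜)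
      (skewAdjoint.submodule ℝ 𝒜).subtypeL.hasFDerivAt).const_mul (unitaryVal P)
  have h3 : mvfderiv 𝓘(ℝ, Skew 𝒜) (unitaryVal (𝒜 := 𝒜)) P v =
      fderiv ℝ (cayleyParam (unitaryVal P)) 0 v := DFunLike.congr_fun h1 v
  rw [h3, h2.fderiv]
  simp

/-- Smoothness can be tested in `𝒜`: in the chart at `P` the field reads `D(cayleyCoord)(R)`, which
is smooth near `P`. -/
theorem contMDiff_of_mvfderiv_unitaryVal
    {X : (P : UnitaryComponent 𝒜) → TangentSpace 𝓘(ℝ, Skew 𝒜) P} {R : 𝒜 → 𝒜}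
    (hR : ContDiff ℝ ∞ R)
    (h : ∀ P, mvfderiv 𝓘(ℝ, Skew 𝒜) unitaryVal P (X P) = R (unitaryVal P)) :
    ContMDiff 𝓘(ℝ, Skew 𝒜) (𝓘(ℝ, Skew 𝒜).prod 𝓘(ℝ, Skew 𝒜)) ∞
      (fun P ↦ TotalSpace.mk' (Skew 𝒜) (E := TangentSpace 𝓘(ℝ, Skew 𝒜)) P (X P)) := by
  have : IsManifold 𝓘(ℝ, Skew 𝒜) 1 (UnitaryComponent 𝒜) := IsManifold.of_le (n := ∞) (by simp)
  intro P
  rw [contMDiffAt_section]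
  have hP : IsUnit (star (unitaryVal P) * unitaryVal P + 1) := mem_cayleyChart_source P
  have hD : ContDiffAt ℝ ∞ (fun x ↦ fderiv ℝ (cayleyCoord (unitaryVal P)) x (R x))
      (unitaryVal P) :=
    ((contDiffAt_cayleyCoord hP).fderiv_right (m := ∞) (by simp)).clm_apply hR.contDiffAt
  have hD' := hD.contMDiffAt.comp P contMDiff_unitaryVal.contMDiffAt
  refine hD'.congr_of_eventuallyEq ?_
  filter_upwards [(cayleyChart P).open_source.mem_nhds (mem_cayleyChart_source P)] with Q hQ
  have h1 := TangentBundle.continuousLinearMapAt_trivializationAt (I := 𝓘(ℝ, Skew 𝒜))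
    (x₀ := P) (x := Q) hQ
  have h2 : (trivializationAt (Skew 𝒜) (TangentSpace 𝓘(ℝ, Skew 𝒜)) P ⟨Q, X Q⟩).2 =
      (trivializationAt (Skew 𝒜) (TangentSpace 𝓘(ℝ, Skew 𝒜)) P).continuousLinearMapAt ℝ Q (X Q) := by
    rw [Trivialization.continuousLinearMapAt_apply, Trivialization.linearMapAt_apply, if_pos]
    rw [TangentBundle.trivializationAt_baseSet]
    exact hQ
  have h3 : HasMFDerivAt 𝓘(ℝ, Skew 𝒜) 𝓘(ℝ, Skew 𝒜)
      (cayleyCoord (unitaryVal P) ∘ unitaryVal) Q _ :=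
    ((contDiffAt_cayleyCoord hQ).differentiableAt (by simp)).hasFDerivAt.hasMFDerivAt.comp Q
      (contMDiff_unitaryVal.mdifferentiable (by simp) Q).hasMFDerivAt
  have h4 := DFunLike.congr_fun h3.mfderiv (X Q)
  rw [h2]
  refine (DFunLike.congr_fun h1 (X Q)).trans (h4.trans ?_)
  change fderiv ℝ (cayleyCoord (unitaryVal P)) (unitaryVal Q)
    (mvfderiv 𝓘(ℝ, Skew 𝒜) unitaryVal Q (X Q)) = _
  rw [h Q]
  rfl

/-- A framing of the identity component of the unitary group. -/
def framingOfUnitary {𝔥 : Type*} [NormedAddCommGroup 𝔥] [InnerProductSpace ℝ 𝔥]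
    (rho : 𝒜 → 𝔥 →L[ℝ] 𝒜) (hrho : ContDiff ℝ ∞ rho) (lam : 𝒜 → 𝒜 →L[ℝ] 𝔥)
    (hlam : ContDiff ℝ ∞ lam) (bracket : 𝔥 →L[ℝ] 𝔥 →L[ℝ] 𝔥)
    (hskew : ∀ (P : UnitaryComponent 𝒜) a,
      star (star (unitaryVal P) * rho (unitaryVal P) a) =
        - (star (unitaryVal P) * rho (unitaryVal P) a))
    (hlr : ∀ (P : UnitaryComponent 𝒜) a, lam (unitaryVal P) (rho (unitaryVal P) a) = a)
    (hrl : ∀ (P : UnitaryComponent 𝒜) (v : Skew 𝒜),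
      rho (unitaryVal P) (lam (unitaryVal P) (unitaryVal P * v)) = unitaryVal P * v)
    (hbr : ∀ (x : 𝒜) a b,
      fderiv ℝ rho x (rho x a) b - fderiv ℝ rho x (rho x b) a = rho x (bracket a b)) :
    Framing (Skew 𝒜) (UnitaryComponent 𝒜) 𝒜 𝔥 :=
  -- The half compensates the derivative 2 of the Cayley transform at 0.
  let frame : (P : UnitaryComponent 𝒜) → 𝔥 →L[ℝ] Skew 𝒜 := fun P ↦ (2 : ℝ)⁻¹ •
    (skewPart 𝒜).comp ((ContinuousLinearMap.mul ℝ 𝒜 (star (unitaryVal P))).comp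
      (rho (unitaryVal P)))
  have hframe : ∀ P a, mvfderiv 𝓘(ℝ, Skew 𝒜) unitaryVal P (frame P a) = rho (unitaryVal P) a := by
    intro P a
    rw [mvfderiv_unitaryVal]
    change (2 : ℝ) • (unitaryVal P * ((2 : ℝ)⁻¹ •
      (skewPart 𝒜 (star (unitaryVal P) * rho (unitaryVal P) a) : 𝒜))) = _
    rw [skewPart_of_skew (hskew P a), mul_smul_comm, smul_smul, mul_inv_cancel₀ two_ne_zero,
      one_smul, ← mul_assoc, unitaryVal_mul_star, one_mul]
  have hfl : ∀ P (v : Skew 𝒜),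
      frame P (lam (unitaryVal P) ((2 : ℝ) • (unitaryVal P * (v : 𝒜)))) = v := by
    intro P v
    change (2 : ℝ)⁻¹ • skewPart 𝒜 (star (unitaryVal P) * rho (unitaryVal P)
      (lam (unitaryVal P) ((2 : ℝ) • (unitaryVal P * (v : 𝒜))))) = v
    rw [map_smul, map_smul, hrl, mul_smul_comm, ← mul_assoc, star_unitaryVal_mul, one_mul,
      map_smul, skewPart_coe, smul_smul, inv_mul_cancel₀ two_ne_zero, one_smul]
  { emb := unitaryVal
    contMDiff_emb := contMDiff_unitaryVal
    rho := rho
    contDiff_rho := hrho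
    lam := lam
    contDiff_lam := hlam
    frame := frame
    contMDiff_frame := fun a ↦ contMDiff_of_mvfderiv_unitaryVal (R := fun x ↦ rho x a)
      (hrho.clm_apply contDiff_const) fun P ↦ hframe P a
    mvfderiv_frame := hframe
    frame_lam := by
      intro P v
      rw [mvfderiv_unitaryVal P v]
      exact hfl P v
    lam_rho := hlr
    bracket := bracket
    bracket_spec := fun P ↦ hbr (unitaryVal P) }

end UnitaryComponent

/-! ### The frame of 𝔰𝔬(n) ⋉ ℝⁿ on the rotation group times a torus. -/

section RotationTorus

/-- Euclidean space. -/
abbrev Vec (n : ℕ) : Type := EuclideanSpace ℝ (Fin n)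

/-- The algebra whose unitary group is the product of the orthogonal group and a torus. -/
abbrev RotTorus (n : ℕ) : Type := (Vec n →L[ℝ] Vec n) × (Fin n → ℂ)

/-- The Lie algebra of the orthogonal group. -/
abbrev SkewOp (n : ℕ) : Type := Skew (Vec n →L[ℝ] Vec n)

variable {n : ℕ}

/-- The `j`-th standard basis vector. -/
abbrev stdVec (j : Fin n) : Vec n := EuclideanSpace.basisFun (Fin n) ℝ j

theorem Vec.mul_neg (a b : Vec n →L[ℝ] Vec n) : a * -b = -(a * b) :=
  ContinuousLinearMap.ext fun x ↦ map_neg a (b x)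

theorem Vec.neg_mul (a b : Vec n →L[ℝ] Vec n) : -a * b = -(a * b) := rfl

theorem Vec.mul_smul (r : ℝ) (a b : Vec n →L[ℝ] Vec n) : a * r • b = r • (a * b) :=
  ContinuousLinearMap.ext fun x ↦ map_smul a r (b x)

/-- Left multiplication by an operator. -/
def leftMul (a : Vec n →L[ℝ] Vec n) : RotTorus n →L[ℝ] (Vec n →L[ℝ] Vec n) :=
  LinearMap.toContinuousLinearMap
    { toFun := fun X ↦ a * X.1
      map_add' := fun X Y ↦ mul_add a X.1 Y.1
      map_smul' := fun r X ↦ Vec.mul_smul r a X.1 }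

/-- The frame given by right translations of rotations and by rotated translations of the torus. -/
def rawRho (X : RotTorus n) : (SkewOp n × Vec n) →ₗ[ℝ] RotTorus n where
  -- With torus angles `θ` and `v = Xθ` the flow is `Ẋ = ξX`, `v̇ = ξv + τ`, a right-invariant field
  -- of the Euclidean group. In the variable `θ` it is invariant under lattice shifts, hence lives
  -- on the torus.
  toFun a := ((a.1 : Vec n →L[ℝ] Vec n) * X.1,
    fun j ↦ Complex.I * (⟪X.1 (stdVec j), a.2⟫_ℝ : ℝ) * X.2 j)
  map_add' a b := by
    refine Prod.ext ?_ (funext fun j ↦ ?_)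
    · exact add_mul (a.1 : Vec n →L[ℝ] Vec n) b.1 X.1
    · simp [inner_add_right, mul_add, add_mul]
  map_smul' r a := by
    refine Prod.ext ?_ (funext fun j ↦ ?_)
    · rfl
    · simp [inner_smul_right]; ring

/-- The linear functional `X ↦ i ⟪X.1 eⱼ, τ⟫`. -/
def angularSpeed (τ : Vec n) (j : Fin n) : RotTorus n →L[ℝ] ℂ :=
  LinearMap.toContinuousLinearMap
    { toFun := fun X ↦ Complex.I * (⟪X.1 (stdVec j), τ⟫_ℝ : ℝ)
      map_add' := fun X Y ↦ by simp [inner_add_left, mul_add]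
      map_smul' := fun r X ↦ by simp [inner_smul_left]; ring }

/-- The derivative of `rawRho` in its first argument. -/
def rawRhoDeriv (X : RotTorus n) (a : SkewOp n × Vec n) : RotTorus n →L[ℝ] RotTorus n :=
  (leftMul (a.1 : Vec n →L[ℝ] Vec n)).prod
    (ContinuousLinearMap.pi fun j ↦ angularSpeed a.2 j X • (ContinuousLinearMap.proj j).comp
        (ContinuousLinearMap.snd ℝ (Vec n →L[ℝ] Vec n) (Fin n → ℂ)) +
      X.2 j • angularSpeed a.2 j)

theorem hasFDerivAt_rawRho (X : RotTorus n) (a : SkewOp n × Vec n) :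
    HasFDerivAt (fun Y ↦ rawRho Y a) (rawRhoDeriv X a) X := by
  refine HasFDerivAt.prodMk (leftMul (a.1 : Vec n →L[ℝ] Vec n)).hasFDerivAt (hasFDerivAt_pi.2 fun j ↦ ?_)
  exact (angularSpeed a.2 j).hasFDerivAt.mul (((ContinuousLinearMap.proj j).comp
        (ContinuousLinearMap.snd ℝ (Vec n →L[ℝ] Vec n) (Fin n → ℂ))).hasFDerivAt)

theorem contDiff_rawRho (a : SkewOp n × Vec n) : ContDiff ℝ ∞ (fun X ↦ rawRho X a) := by
  refine ContDiff.prodMk (leftMul (a.1 : Vec n →L[ℝ] Vec n)).contDiff (contDiff_pi.2 fun j ↦ ?_)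
  exact (angularSpeed a.2 j).contDiff.mul (((ContinuousLinearMap.proj j).comp
        (ContinuousLinearMap.snd ℝ (Vec n →L[ℝ] Vec n) (Fin n → ℂ))).contDiff)

/-- The bracket of the frame `rawRho`. -/
def rawBracket : (SkewOp n × Vec n) →ₗ[ℝ] (SkewOp n × Vec n) →ₗ[ℝ] (SkewOp n × Vec n) :=
  LinearMap.mk₂ ℝ
    (fun a b ↦ (⟨(b.1 : Vec n →L[ℝ] Vec n) * a.1 - (a.1 : Vec n →L[ℝ] Vec n) * b.1, by
        change star _ = - _
        rw [star_sub, star_mul, star_mul, a.1.star_eq, b.1.star_eq]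
        simp only [Vec.neg_mul, Vec.mul_neg, neg_neg, neg_sub]⟩,
      (b.1 : Vec n →L[ℝ] Vec n) a.2 - (a.1 : Vec n →L[ℝ] Vec n) b.2))
    (fun a a' b ↦ Prod.ext (Subtype.ext (by simp [mul_add, add_mul]; abel)) (by simp; abel))
    (fun r a b ↦ Prod.ext (Subtype.ext (by simp [smul_sub])) (by simp [smul_sub]))
    (fun a a' b ↦ Prod.ext (Subtype.ext (by simp [mul_add, add_mul]; abel)) (by simp; abel))
    (fun r a b ↦ Prod.ext (Subtype.ext (by simp [smul_sub])) (by simp [smul_sub]))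

theorem rawBracket_fst (a b : SkewOp n × Vec n) : ((rawBracket a b).1 : Vec n →L[ℝ] Vec n) =
    (b.1 : Vec n →L[ℝ] Vec n) * a.1 - (a.1 : Vec n →L[ℝ] Vec n) * b.1 := rfl

theorem rawBracket_snd (a b : SkewOp n × Vec n) : (rawBracket a b).2 =
    (b.1 : Vec n →L[ℝ] Vec n) a.2 - (a.1 : Vec n →L[ℝ] Vec n) b.2 := rfl

theorem SkewOp.inner_apply (ξ : SkewOp n) (x y : Vec n) :
    ⟪(ξ : Vec n →L[ℝ] Vec n) x, y⟫_ℝ = - ⟪x, (ξ : Vec n →L[ℝ] Vec n) y⟫_ℝ := by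
  have h : ContinuousLinearMap.adjoint (ξ : Vec n →L[ℝ] Vec n) = -(ξ : Vec n →L[ℝ] Vec n) :=
    ξ.star_eq
  rw [← ContinuousLinearMap.adjoint_inner_right, h]
  simp

theorem SkewOp.inner_apply_self (ξ : SkewOp n) (x : Vec n) :
    ⟪(ξ : Vec n →L[ℝ] Vec n) x, x⟫_ℝ = 0 := by
  have := ξ.inner_apply x x
  have h := real_inner_comm x ((ξ : Vec n →L[ℝ] Vec n) x)
  linarith

/-- On the torus factor the products of two angular speeds are symmetric and cancel. What remains is
the change of the speeds under rotation, which gives the action of 𝔰𝔬(n) on ℝⁿ. -/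
theorem rawRho_bracket (X : RotTorus n) (a b : SkewOp n × Vec n) :
    rawRhoDeriv X b (rawRho X a) - rawRhoDeriv X a (rawRho X b) = rawRho X (rawBracket a b) := by
  refine Prod.ext ?_ (funext fun j ↦ ?_)
  · change (b.1 : Vec n →L[ℝ] Vec n) * ((a.1 : Vec n →L[ℝ] Vec n) * X.1) -
      (a.1 : Vec n →L[ℝ] Vec n) * ((b.1 : Vec n →L[ℝ] Vec n) * X.1) =
      ((rawBracket a b).1 : Vec n →L[ℝ] Vec n) * X.1
    rw [rawBracket_fst, sub_mul, mul_assoc, mul_assoc]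
  · have h : ∀ a b : SkewOp n × Vec n, (rawRhoDeriv X b (rawRho X a)).2 j =
        (Complex.I * (⟪X.1 (stdVec j), b.2⟫_ℝ : ℝ)) *
            (Complex.I * (⟪X.1 (stdVec j), a.2⟫_ℝ : ℝ) * X.2 j) +
          X.2 j * (Complex.I *
            (⟪(a.1 : Vec n →L[ℝ] Vec n) (X.1 (stdVec j)), b.2⟫_ℝ : ℝ)) := fun _ _ ↦ rfl
    have h2 : (rawRho X (rawBracket a b)).2 j =
      Complex.I * (⟪X.1 (stdVec j), (rawBracket a b).2⟫_ℝ : ℝ) * X.2 j := rfl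
    rw [Prod.snd_sub, Pi.sub_apply, h, h, h2, rawBracket_snd, inner_sub_right,
      SkewOp.inner_apply, SkewOp.inner_apply]
    push_cast
    ring

/-- The left inverse of `rawRho X` for unitary `X`. -/
def rawLam (X : RotTorus n) : RotTorus n →ₗ[ℝ] (SkewOp n × Vec n) where
  toFun Y := (skewPart _ (Y.1 * star X.1), ∑ j, (Y.2 j * star (X.2 j)).im • X.1 (stdVec j))
  map_add' Y Z := by
    refine Prod.ext ?_ ?_
    · exact (congrArg (skewPart _) (add_mul Y.1 Z.1 (star X.1))).trans (map_add (skewPart _) _ _)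
    · simp only [Prod.snd_add, Pi.add_apply, add_mul, Complex.add_im, add_smul,
        Finset.sum_add_distrib]
  map_smul' r Y := by
    refine Prod.ext ?_ ?_
    · exact map_smul (skewPart (Vec n →L[ℝ] Vec n)) r (Y.1 * star X.1)
    · simp only [Prod.smul_snd, Pi.smul_apply, smul_mul_assoc, Complex.smul_im, smul_assoc,
        Finset.smul_sum, RingHom.id_apply]

theorem contDiff_rawLam (Y : RotTorus n) : ContDiff ℝ ∞ (fun X ↦ rawLam X Y) := by
  let f : RotTorus n →ₗ[ℝ] SkewOp n :=
    { toFun := fun X ↦ skewPart _ (Y.1 * star X.1)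
      map_add' := fun X Z ↦ by
        have h : star (X.1 + Z.1) = star X.1 + star Z.1 :=
          map_add ContinuousLinearMap.adjoint X.1 Z.1
        rw [Prod.fst_add, h, mul_add]
        exact map_add (skewPart (Vec n →L[ℝ] Vec n)) _ _
      map_smul' := fun r X ↦ by
        rw [Prod.smul_fst, star_smul, star_trivial, Vec.mul_smul]
        exact map_smul (skewPart (Vec n →L[ℝ] Vec n)) r _ }
  let p : Fin n → RotTorus n →ₗ[ℝ] ℝ := fun j ↦
    { toFun := fun X ↦ (Y.2 j * star (X.2 j)).im
      map_add' := fun X Z ↦ by simp; ring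
      map_smul' := fun r X ↦ by simp; ring }
  let q : Fin n → RotTorus n →ₗ[ℝ] Vec n := fun j ↦
    { toFun := fun X ↦ X.1 (stdVec j)
      map_add' := fun X Z ↦ by simp
      map_smul' := fun r X ↦ by simp }
  refine ContDiff.prodMk f.toContinuousLinearMap.contDiff ?_
  exact ContDiff.sum fun j _ ↦
    (p j).toContinuousLinearMap.contDiff.smul (q j).toContinuousLinearMap.contDiff

section Unitary

variable {X : RotTorus n} (hX : X ∈ unitary (RotTorus n))
include hX

theorem star_fst_mul : star X.1 * X.1 = 1 := congrArg Prod.fst (Unitary.mem_iff.1 hX).1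

theorem fst_mul_star : X.1 * star X.1 = 1 := congrArg Prod.fst (Unitary.mem_iff.1 hX).2

theorem snd_mul_star (j : Fin n) : X.2 j * star (X.2 j) = 1 :=
  congrFun (congrArg Prod.snd (Unitary.mem_iff.1 hX).2) j

theorem inner_fst_apply (x y : Vec n) : ⟪X.1 x, X.1 y⟫_ℝ = ⟪x, y⟫_ℝ := by
  rw [← ContinuousLinearMap.adjoint_inner_right]
  congr 1
  exact DFunLike.congr_fun (star_fst_mul hX) y

-- The frame is tangent to the unitary group: it is a point times a skew element wherever `X` is
-- unitary.
omit hX in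
theorem star_mul_rawRho_skew (X : RotTorus n) (a : SkewOp n × Vec n) :
    star (star X * rawRho X a) = - (star X * rawRho X a) := by
  refine Prod.ext ?_ (funext fun j ↦ ?_)
  · change star (star X.1 * ((a.1 : Vec n →L[ℝ] Vec n) * X.1)) =
      - (star X.1 * ((a.1 : Vec n →L[ℝ] Vec n) * X.1))
    rw [star_mul, star_mul, star_star, a.1.star_eq]
    simp only [Vec.neg_mul, Vec.mul_neg, mul_assoc]
  · change star (star (X.2 j) * (Complex.I * (⟪X.1 (stdVec j), a.2⟫_ℝ : ℝ) * X.2 j)) =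
      - (star (X.2 j) * (Complex.I * (⟪X.1 (stdVec j), a.2⟫_ℝ : ℝ) * X.2 j))
    simp only [star_mul, RCLike.star_def, Complex.conj_I, Complex.conj_ofReal,
      Complex.conj_conj]
    ring

/-- For unitary `X` the vectors `X eⱼ` form an orthonormal basis, so the angular speeds are the
coordinates of the translation part. -/
theorem rawLam_rawRho (a : SkewOp n × Vec n) : rawLam X (rawRho X a) = a := by
  refine Prod.ext ?_ ?_
  · change skewPart _ ((a.1 : Vec n →L[ℝ] Vec n) * X.1 * star X.1) = a.1
    rw [mul_assoc, fst_mul_star hX, mul_one, skewPart_coe]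
  · change ∑ j, (Complex.I * (⟪X.1 (stdVec j), a.2⟫_ℝ : ℝ) * X.2 j * star (X.2 j)).im •
      X.1 (stdVec j) = a.2
    have h : ∀ j, (Complex.I * (⟪X.1 (stdVec j), a.2⟫_ℝ : ℝ) * X.2 j * star (X.2 j)).im =
        ⟪stdVec j, (star X.1) a.2⟫_ℝ := by
      intro j
      rw [mul_assoc, snd_mul_star hX, mul_one]
      simp only [Complex.mul_im, Complex.I_re, Complex.I_im, Complex.ofReal_re, one_mul,
        Complex.ofReal_im, mul_zero, zero_add]
      exact (ContinuousLinearMap.adjoint_inner_right _ _ _).symm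
    simp only [h]
    simp only [← map_smul, ← map_sum]
    rw [(EuclideanSpace.basisFun (Fin n) ℝ).sum_repr']
    exact DFunLike.congr_fun (fst_mul_star hX) a.2

theorem rawRho_rawLam (v : Skew (RotTorus n)) :
    rawRho X (rawLam X (X * (v : RotTorus n))) = X * (v : RotTorus n) := by
  have hv1 : star (v : RotTorus n).1 = - (v : RotTorus n).1 := congrArg Prod.fst v.star_eq
  have hv2 : ∀ j, star ((v : RotTorus n).2 j) = - (v : RotTorus n).2 j :=
    fun j ↦ congrFun (congrArg Prod.snd v.star_eq) j
  refine Prod.ext ?_ (funext fun j ↦ ?_)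
  · change (skewPart _ (X.1 * (v : RotTorus n).1 * star X.1) : Vec n →L[ℝ] Vec n) * X.1 =
      X.1 * (v : RotTorus n).1
    rw [skewPart_of_skew, mul_assoc, star_fst_mul hX, mul_one]
    rw [star_mul, star_mul, star_star, hv1]
    simp only [Vec.neg_mul, Vec.mul_neg, mul_assoc]
  · change Complex.I * (⟪X.1 (stdVec j), ∑ k, (X.2 k * (v : RotTorus n).2 k *
      star (X.2 k)).im • X.1 (stdVec k)⟫_ℝ : ℝ) * X.2 j = X.2 j * (v : RotTorus n).2 j
    have h : ∀ k, X.2 k * (v : RotTorus n).2 k * star (X.2 k) = (v : RotTorus n).2 k := by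
      intro k
      rw [mul_right_comm, snd_mul_star hX, one_mul]
    simp only [h]
    rw [inner_sum, Finset.sum_eq_single j]
    · rw [inner_smul_right, inner_fst_apply hX, real_inner_self_eq_norm_sq]
      have hre : ((v : RotTorus n).2 j).re = 0 := by
        have := congrArg Complex.re (hv2 j)
        simp at this
        linarith
      apply Complex.ext <;> simp [hre] <;> ring
    · intro k _ hk
      rw [inner_smul_right, inner_fst_apply hX]
      rw [(EuclideanSpace.basisFun (Fin n) ℝ).orthonormal.2 hk.symm, mul_zero]
    · simp

end Unitary

end RotationTorus

/-! ### Inner products in coordinates, and traces of skew maps. -/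

section LinearAlgebra

variable {V : Type*} [AddCommGroup V] [Module ℝ V] [FiniteDimensional ℝ V]

/-- A finite-dimensional space with an inner product is linearly isometric to Euclidean space. -/
theorem exists_linearEquiv_inner (κ : LinearMap.BilinForm ℝ V) (hsymm : ∀ x y, κ x y = κ y x)
    (hpos : ∀ x, x ≠ 0 → 0 < κ x x) :
    ∃ T : V ≃ₗ[ℝ] EuclideanSpace ℝ (Fin (Module.finrank ℝ V)), ∀ x y, ⟪T x, T y⟫_ℝ = κ x y := by
  let core : InnerProductSpace.Core ℝ V :=
    { inner := fun x y ↦ κ x y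
      conj_inner_symm := fun x y ↦ hsymm y x
      re_inner_nonneg := fun x ↦ by
        by_cases hx : x = 0
        · simp [hx]
        · exact (hpos x hx).le
      add_left := fun x y z ↦ by simp
      smul_left := fun x y r ↦ by simp
      definite := fun x hx ↦ by
        by_contra h
        exact (hpos x h).ne' hx }
  let _ := core.toNormedAddCommGroup
  let _ : InnerProductSpace ℝ V := InnerProductSpace.ofCore core.toCore
  exact ⟨(stdOrthonormalBasis ℝ V).repr.toLinearEquiv,
    fun x y ↦ (stdOrthonormalBasis ℝ V).repr.inner_map_map x y⟩

variable (V) in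
theorem exists_linearEquiv_euclideanSpace :
    ∃ d : ℕ, Nonempty (EuclideanSpace ℝ (Fin d) ≃ₗ[ℝ] V) :=
  ⟨Module.finrank ℝ V, ⟨LinearEquiv.ofFinrankEq _ _ finrank_euclideanSpace_fin⟩⟩

/-- An endomorphism that is skew for an inner product is traceless. -/
theorem trace_eq_zero_of_skew (κ : LinearMap.BilinForm ℝ V) (hsymm : ∀ x y, κ x y = κ y x)
    (hpos : ∀ x, x ≠ 0 → 0 < κ x x) (f : V →ₗ[ℝ] V) (hf : ∀ x, κ x (f x) = 0) :
    LinearMap.trace ℝ V f = 0 := by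
  obtain ⟨T, hT⟩ := exists_linearEquiv_inner κ hsymm hpos
  rw [← LinearMap.trace_conj' f T,
    LinearMap.trace_eq_sum_inner _ (EuclideanSpace.basisFun _ ℝ)]
  refine Finset.sum_eq_zero fun i _ ↦ ?_
  have h := hf (T.symm (EuclideanSpace.basisFun _ ℝ i))
  rw [← hT, T.apply_symm_apply] at h
  exact h

end LinearAlgebra

/-! ### Unimodularity of 𝔰𝔬(n) ⋉ ℝⁿ. -/

section BracketTrace

variable {n : ℕ}

theorem SkewOp.trace_eq_zero (ξ : SkewOp n) :
    LinearMap.trace ℝ (Vec n) (ξ : Vec n →L[ℝ] Vec n).toLinearMap = 0 := by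
  refine trace_eq_zero_of_skew (innerₗ (Vec n)) (fun x y ↦ real_inner_comm y x)
    (fun x hx ↦ real_inner_self_pos.2 hx) _ fun x ↦ ?_
  exact (real_inner_comm _ _).trans (ξ.inner_apply_self x)

/-- The Hilbert–Schmidt inner product. -/
def hilbertSchmidt (n : ℕ) : LinearMap.BilinForm ℝ (SkewOp n) :=
  LinearMap.mk₂ ℝ (fun ξ η ↦ ∑ j, ⟪(ξ : Vec n →L[ℝ] Vec n) (stdVec j),
      (η : Vec n →L[ℝ] Vec n) (stdVec j)⟫_ℝ)
    (fun ξ ξ' η ↦ by simp [inner_add_left, Finset.sum_add_distrib])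
    (fun r ξ η ↦ by simp [inner_smul_left, Finset.mul_sum])
    (fun ξ η η' ↦ by simp [inner_add_right, Finset.sum_add_distrib])
    (fun r ξ η ↦ by simp [inner_smul_right, Finset.mul_sum])

theorem hilbertSchmidt_apply (ξ η : SkewOp n) : hilbertSchmidt n ξ η =
    ∑ j, ⟪(ξ : Vec n →L[ℝ] Vec n) (stdVec j), (η : Vec n →L[ℝ] Vec n) (stdVec j)⟫_ℝ := rfl

theorem hilbertSchmidt_pos (ξ : SkewOp n) (hξ : ξ ≠ 0) : 0 < hilbertSchmidt n ξ ξ := by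
  rw [hilbertSchmidt_apply]
  refine lt_of_le_of_ne (Finset.sum_nonneg fun j _ ↦ real_inner_self_nonneg) fun h ↦ hξ ?_
  have h2 := (Finset.sum_eq_zero_iff_of_nonneg fun j _ ↦ real_inner_self_nonneg).1 h.symm
  refine Subtype.ext (ContinuousLinearMap.coe_injective
    ((EuclideanSpace.basisFun (Fin n) ℝ).toBasis.ext fun j ↦ ?_))
  rw [OrthonormalBasis.coe_toBasis]
  exact inner_self_eq_zero.1 (h2 j (Finset.mem_univ j))

/-- The adjoint action on the skew operators. -/
def skewAd (ξ : SkewOp n) : SkewOp n →ₗ[ℝ] SkewOp n :=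
  LinearMap.fst ℝ _ _ ∘ₗ rawBracket (ξ, (0 : Vec n)) ∘ₗ LinearMap.inl ℝ _ _

theorem skewAd_coe (ξ η : SkewOp n) : (skewAd ξ η : Vec n →L[ℝ] Vec n) =
    (η : Vec n →L[ℝ] Vec n) * ξ - (ξ : Vec n →L[ℝ] Vec n) * η := rfl

/-- The adjoint action is skew for the Hilbert–Schmidt inner product. -/
theorem trace_skewAd (ξ : SkewOp n) : LinearMap.trace ℝ (SkewOp n) (skewAd ξ) = 0 := by
  refine trace_eq_zero_of_skew (hilbertSchmidt n)
    (fun x y ↦ ?_) hilbertSchmidt_pos _ fun η ↦ ?_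
  · rw [hilbertSchmidt_apply, hilbertSchmidt_apply]
    exact Finset.sum_congr rfl fun j _ ↦ real_inner_comm _ _
  have h1 : ∑ j, ⟪(η : Vec n →L[ℝ] Vec n) (stdVec j),
      (ξ : Vec n →L[ℝ] Vec n) ((η : Vec n →L[ℝ] Vec n) (stdVec j))⟫_ℝ = 0 :=
    Finset.sum_eq_zero fun j _ ↦ (real_inner_comm _ _).trans (ξ.inner_apply_self _)
  let b := EuclideanSpace.basisFun (Fin n) ℝ
  let S : Vec n →ₗ[ℝ] Vec n := ((η : Vec n →L[ℝ] Vec n) * (η : Vec n →L[ℝ] Vec n)).toLinearMap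
  let X : Vec n →ₗ[ℝ] Vec n := (ξ : Vec n →L[ℝ] Vec n).toLinearMap
  -- `S = η²` is symmetric and `ξ` is skew, so transposition gives a minus sign; cyclicity of the
  -- trace then forces zero.
  have h2 : LinearMap.trace ℝ (Vec n) (S ∘ₗ X) = - LinearMap.trace ℝ (Vec n) (X ∘ₗ S) := by
    rw [LinearMap.trace_eq_sum_inner _ b, LinearMap.trace_eq_sum_inner _ b,
      ← Finset.sum_neg_distrib]
    refine Finset.sum_congr rfl fun j _ ↦ ?_
    change ⟪b j, (η : Vec n →L[ℝ] Vec n) ((η : Vec n →L[ℝ] Vec n)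
        ((ξ : Vec n →L[ℝ] Vec n) (b j)))⟫_ℝ =
      - ⟪b j, (ξ : Vec n →L[ℝ] Vec n) ((η : Vec n →L[ℝ] Vec n)
        ((η : Vec n →L[ℝ] Vec n) (b j)))⟫_ℝ
    rw [← ξ.inner_apply, real_inner_comm, η.inner_apply, η.inner_apply, neg_neg]
  rw [LinearMap.trace_comp_comm'] at h2
  have h3 : LinearMap.trace ℝ (Vec n) (S ∘ₗ X) = 0 := by
    rw [LinearMap.trace_comp_comm']
    linarith
  rw [LinearMap.trace_eq_sum_inner _ b] at h3
  rw [hilbertSchmidt_apply]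
  have h4 : ∀ j, ⟪(η : Vec n →L[ℝ] Vec n) (stdVec j), (skewAd ξ η : Vec n →L[ℝ] Vec n)
      (stdVec j)⟫_ℝ = - ⟪b j, (S ∘ₗ X) (b j)⟫_ℝ - ⟪(η : Vec n →L[ℝ] Vec n) (stdVec j),
      (ξ : Vec n →L[ℝ] Vec n) ((η : Vec n →L[ℝ] Vec n) (stdVec j))⟫_ℝ := by
    intro j
    rw [skewAd_coe]
    refine (inner_sub_right _ _ _).trans (congrArg₂ _ ?_ rfl)
    exact η.inner_apply _ _
  rw [Finset.sum_congr rfl fun j _ ↦ h4 j, Finset.sum_sub_distrib, Finset.sum_neg_distrib, h3, h1,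
    neg_zero, sub_zero]

/-- `ad_a` is block triangular, with traceless diagonal blocks `skewAd a.1` and `-a.1`. -/
theorem trace_rawBracket (a : SkewOp n × Vec n) :
    LinearMap.trace ℝ (SkewOp n × Vec n) (rawBracket a) = 0 := by
  let g : SkewOp n →ₗ[ℝ] Vec n :=
    { toFun := fun η ↦ (η : Vec n →L[ℝ] Vec n) a.2
      map_add' := fun _ _ ↦ rfl
      map_smul' := fun _ _ ↦ rfl }
  have h : rawBracket a = (skewAd a.1).prodMap (-(a.1 : Vec n →L[ℝ] Vec n).toLinearMap) +
      LinearMap.inr ℝ (SkewOp n) (Vec n) ∘ₗ (g ∘ₗ LinearMap.fst ℝ (SkewOp n) (Vec n)) := by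
    refine LinearMap.ext fun b ↦ Prod.ext ?_ ?_
    · exact (add_zero _).symm
    · change (b.1 : Vec n →L[ℝ] Vec n) a.2 - (a.1 : Vec n →L[ℝ] Vec n) b.2 =
        -((a.1 : Vec n →L[ℝ] Vec n) b.2) + (b.1 : Vec n →L[ℝ] Vec n) a.2
      abel
  have h0 : (g ∘ₗ LinearMap.fst ℝ (SkewOp n) (Vec n)) ∘ₗ LinearMap.inr ℝ (SkewOp n) (Vec n) = 0 :=
    LinearMap.ext fun x ↦ rfl
  rw [h, map_add, LinearMap.trace_prodMap', trace_skewAd, map_neg, SkewOp.trace_eq_zero,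
    LinearMap.trace_comp_comm', h0, map_zero]
  simp

end BracketTrace

/-! ### Realizing a conservative quadratic system as an Euler–Arnold equation. -/

section Realization

variable {n : ℕ} {V : Type*} [NormedAddCommGroup V] [NormedSpace ℝ V] [FiniteDimensional ℝ V]

/-- The skew part of `B(y, ·)`, scaled so that it sends `y` to `B(y, y)`. -/
def skewPartOf (B : Vec n →ₗ[ℝ] Vec n →ₗ[ℝ] Vec n) : Vec n →ₗ[ℝ] SkewOp n :=
  -- Polarization gives `B_y^* y = -½ B(y,y)`, so the skew part `½(B_y - B_y^*)` sends `y` to `¾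
  -- B(y,y)`.
  ((4 / 3 : ℝ) • (skewPart (Vec n →L[ℝ] Vec n)).toLinearMap) ∘ₗ
    (LinearMap.toContinuousLinearMap (E := Vec n) (F' := Vec n) (𝕜 := ℝ)).toLinearMap ∘ₗ B

theorem skewPartOf_apply_self (B : Vec n →ₗ[ℝ] Vec n →ₗ[ℝ] Vec n) (hB : ∀ y z, B y z = B z y)
    (h : ∀ y, ⟪B y y, y⟫_ℝ = 0) (y : Vec n) :
    (skewPartOf B y : Vec n →L[ℝ] Vec n) y = B y y := by
  refine ext_inner_right ℝ fun w ↦ ?_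
  have h1 : (skewPartOf B y : Vec n →L[ℝ] Vec n) y = (4 / 3 : ℝ) • (2 : ℝ)⁻¹ • (B y y -
      ContinuousLinearMap.adjoint (LinearMap.toContinuousLinearMap (B y)) y) := rfl
  have h2 : ⟪ContinuousLinearMap.adjoint (LinearMap.toContinuousLinearMap (B y)) y, w⟫_ℝ =
    ⟪y, B y w⟫_ℝ := ContinuousLinearMap.adjoint_inner_left _ _ _
  -- The difference of these two is odd in `w`; with `h w` it leaves `2⟪B(y,w), y⟫ + ⟪B(y,y), w⟫ =
  -- 0`.
  have e1 := h (y + w)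
  have e2 := h (y - w)
  simp only [map_add, map_sub, LinearMap.add_apply, LinearMap.sub_apply, inner_add_left,
    inner_add_right, inner_sub_left, inner_sub_right, hB w y] at e1 e2
  have e3 := h y
  have e4 := h w
  have e5 := real_inner_comm y (B y w)
  rw [h1, inner_smul_left, inner_smul_left, inner_sub_left, h2]
  simp only [conj_trivial]
  linarith

/-- The identification that turns the graph of `A` into the second factor. -/
def shear {d : ℕ} (S : Vec d ≃ₗ[ℝ] SkewOp n) (A : Vec n →ₗ[ℝ] SkewOp n) :
    WithLp 2 (Vec d × Vec n) ≃ₗ[ℝ] (SkewOp n × Vec n) :=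
  (WithLp.linearEquiv 2 ℝ _).trans
    -- The transported inner product makes 𝔰𝔬(n) × 0 orthogonal to the graph of `A`, and the graph
    -- isometric to ℝⁿ.
    { toFun := fun w ↦ (S w.1 + A w.2, w.2)
      map_add' := fun v w ↦ by
        refine Prod.ext ?_ rfl
        simp only [Prod.fst_add, Prod.snd_add, map_add]
        abel
      map_smul' := fun r v ↦ by
        refine Prod.ext ?_ rfl
        simp
      invFun := fun a ↦ (S.symm (a.1 - A a.2), a.2)
      left_inv := fun w ↦ Prod.ext ((congrArg S.symm
        (add_sub_cancel_right _ _)).trans (S.symm_apply_apply w.1)) rfl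
      right_inv := fun a ↦ Prod.ext ((congrArg (· + A a.2)
        (S.apply_symm_apply _)).trans (sub_add_cancel _ _)) rfl }

theorem shear_symm_fst {d : ℕ} (S : Vec d ≃ₗ[ℝ] SkewOp n) (A : Vec n →ₗ[ℝ] SkewOp n) (y : Vec n) :
    ((shear S A).symm (A y, y)).ofLp.1 = 0 :=
  (congrArg S.symm (sub_self (A y))).trans S.symm.map_zero

theorem shear_symm_snd {d : ℕ} (S : Vec d ≃ₗ[ℝ] SkewOp n) (A : Vec n →ₗ[ℝ] SkewOp n)
    (a : SkewOp n × Vec n) : ((shear S A).symm a).ofLp.2 = a.2 := rfl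

theorem shear_snd {d : ℕ} (S : Vec d ≃ₗ[ℝ] SkewOp n) (A : Vec n →ₗ[ℝ] SkewOp n)
    (w : WithLp 2 (Vec d × Vec n)) : (shear S A w).2 = w.ofLp.2 := rfl

variable {𝔥 : Type*} [NormedAddCommGroup 𝔥] [InnerProductSpace ℝ 𝔥] [FiniteDimensional ℝ 𝔥]
  (J : 𝔥 ≃ₗ[ℝ] (SkewOp n × Vec n))

/-- The frame in Euclidean coordinates. -/
def rotRho (X : RotTorus n) : 𝔥 →L[ℝ] RotTorus n :=
  LinearMap.toContinuousLinearMap (rawRho X ∘ₗ J.toLinearMap)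

theorem rotRho_apply (X : RotTorus n) (a : 𝔥) :
    rotRho J X a = rawRho X (J a) := rfl

/-- The coframe in Euclidean coordinates. -/
def rotLam (X : RotTorus n) : RotTorus n →L[ℝ] 𝔥 :=
  LinearMap.toContinuousLinearMap (J.symm.toLinearMap ∘ₗ rawLam X)

omit [FiniteDimensional ℝ 𝔥] in
theorem rotLam_apply (X Y : RotTorus n) :
    rotLam J X Y = J.symm (rawLam X Y) := rfl

/-- The bracket in Euclidean coordinates. -/
def rotBracket : 𝔥 →L[ℝ] 𝔥 →L[ℝ] 𝔥 :=
  LinearMap.toContinuousLinearMap (LinearMap.toContinuousLinearMap.toLinearMap ∘ₗ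
    ((rawBracket.compl₁₂ J.toLinearMap J.toLinearMap).compr₂
      J.symm.toLinearMap))

theorem rotBracket_apply (a b : 𝔥) :
    rotBracket J a b = J.symm (rawBracket (J a) (J b)) := rfl

theorem contDiff_rotRho : ContDiff ℝ ∞ (rotRho J) :=
  contDiff_clm_apply_iff.2 fun a ↦ contDiff_rawRho (J a)

omit [FiniteDimensional ℝ 𝔥] in
theorem contDiff_rotLam : ContDiff ℝ ∞ (rotLam J) :=
  contDiff_clm_apply_iff.2 fun Y ↦
    (J.symm.toLinearMap.toContinuousLinearMap.contDiff).comp (contDiff_rawLam Y)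

theorem fderiv_rotRho (X Y : RotTorus n) (a : 𝔥) :
    fderiv ℝ (rotRho J) X Y a = rawRhoDeriv X (J a) Y := by
  have h0 : DifferentiableAt ℝ (rotRho J) X :=
    (contDiff_rotRho J).contDiffAt.differentiableAt (by simp)
  have h1 := h0.hasFDerivAt.clm_apply (hasFDerivAt_const a X)
  have h2 := DFunLike.congr_fun (h1.unique (hasFDerivAt_rawRho X (J a))) Y
  simpa using h2

/-- The framing of the product of the rotation group and the torus. -/
def rotFraming :
    Framing (Skew (RotTorus n)) (UnitaryComponent (RotTorus n)) (RotTorus n) (𝔥) :=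
  framingOfUnitary (rotRho J) (contDiff_rotRho J) (rotLam J) (contDiff_rotLam J) (rotBracket J)
    (fun P a ↦ star_mul_rawRho_skew (unitaryVal P) (J a))
    (fun P a ↦ by
      rw [rotRho_apply, rotLam_apply]
      exact (congrArg J.symm (rawLam_rawRho (P : unitary (RotTorus n)).2 (J a))).trans
        (J.symm_apply_apply a))
    (fun P v ↦ by
      rw [rotRho_apply, rotLam_apply, LinearEquiv.apply_symm_apply]
      exact rawRho_rawLam (P : unitary (RotTorus n)).2 v)
    (fun X a b ↦ by
      rw [fderiv_rotRho, fderiv_rotRho, rotRho_apply, rotRho_apply, rotRho_apply,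
        rotBracket_apply, LinearEquiv.apply_symm_apply, rawRho_bracket])

theorem rotFraming_bracket (a b : 𝔥) :
    (rotFraming J).bracket a b = J.symm (rawBracket (J a) (J b)) := rfl

theorem trace_rotFraming_bracket (a : 𝔥) :
    LinearMap.trace ℝ (𝔥) ((rotFraming J).bracket a).toLinearMap = 0 := by
  have h : ((rotFraming J).bracket a).toLinearMap =
    J.symm.conj (rawBracket (J a)) := rfl
  rw [h, LinearMap.trace_conj', trace_rawBracket]

/-- With `y` placed on the graph of `A`, only the ℝⁿ component of the bracket pairs with `U y`. Its
𝔰𝔬(n)-dependent term `⟪η y, y⟫` vanishes by skewness, and the other gives `⟪w, A(y) y⟫ = ⟪w,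
B(y,y)⟫`. -/
theorem exists_embedsIntoEuler_of_linearEquiv {d : ℕ} (S : Vec d ≃ₗ[ℝ] SkewOp n)
    (T : V ≃ₗ[ℝ] Vec n) (B : V →ₗ[ℝ] V →ₗ[ℝ] V) (hB : ∀ y z, B y z = B z y)
    (hT : ∀ y, ⟪T (B y y), T y⟫_ℝ = 0) : ∃ N : CompactRiemannianManifold, EmbedsIntoEuler B N := by
  let B' : Vec n →ₗ[ℝ] Vec n →ₗ[ℝ] Vec n :=
    (B.compl₁₂ T.symm.toLinearMap T.symm.toLinearMap).compr₂ T.toLinearMap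
  have hB'_apply : ∀ y z, B' y z = T (B (T.symm y) (T.symm z)) := fun _ _ ↦ rfl
  let A := skewPartOf B'
  have hA : ∀ y, (A (T y) : Vec n →L[ℝ] Vec n) (T y) = T (B y y) := fun y ↦ by
    refine (skewPartOf_apply_self B' (fun y z ↦ ?_) (fun y ↦ ?_) (T y)).trans ?_
    · rw [hB'_apply, hB'_apply, hB]
    · have h := hT (T.symm y)
      rw [T.apply_symm_apply] at h
      exact h
    · rw [hB'_apply, T.symm_apply_apply]
  let U : V →ₗ[ℝ] WithLp 2 (Vec d × Vec n) :=
    (shear S A).symm.toLinearMap ∘ₗ (A.prod LinearMap.id) ∘ₗ T.toLinearMap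
  have hU : ∀ y, shear S A (U y) = (A (T y), T y) := fun y ↦ (shear S A).apply_symm_apply _
  have hU1 : ∀ y, (U y).ofLp.1 = 0 := fun y ↦ shear_symm_fst S A (T y)
  have hU2 : ∀ y, (U y).ofLp.2 = T y := fun y ↦ rfl
  refine (rotFraming (shear S A)).exists_embedsIntoEuler B U (fun y z h ↦ ?_) (fun y w ↦ ?_)
    fun y ↦ trace_rotFraming_bracket (shear S A) (U y)
  · exact T.injective (by rw [← hU2, ← hU2, h])
  · rw [WithLp.prod_inner_apply, WithLp.prod_inner_apply, hU1, hU1, inner_zero_right,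
      inner_zero_right, zero_add, zero_add, hU2, hU2, rotFraming_bracket, shear_symm_snd,
      rawBracket_snd, hU, inner_sub_left, SkewOp.inner_apply_self, zero_sub, SkewOp.inner_apply,
      neg_neg, hA, shear_snd]

/-- A quadratic system that conserves a positive definite quadratic form embeds into the Euler
equations on some compact Riemannian manifold. -/
theorem exists_embedsIntoEuler_of_conserved (B : V →ₗ[ℝ] V →ₗ[ℝ] V) (hB : ∀ y z, B y z = B z y)
    (Q : LinearMap.BilinForm ℝ V) (hsymm : ∀ y z, Q y z = Q z y) (hpos : ∀ y, y ≠ 0 → 0 < Q y y)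
    (hQ : ∀ y, Q (B y y) y = 0) : ∃ N : CompactRiemannianManifold, EmbedsIntoEuler B N := by
  obtain ⟨T, hT⟩ := exists_linearEquiv_inner Q hsymm hpos
  obtain ⟨d, ⟨S⟩⟩ := exists_linearEquiv_euclideanSpace (SkewOp (Module.finrank ℝ V))
  exact exists_embedsIntoEuler_of_linearEquiv S T B hB fun y ↦ (hT _ _).trans (hQ y)

end Realization

/-! ### Jacobi's formula. -/

section Jacobi

variable {E : Type*} [NormedAddCommGroup E] [NormedSpace ℝ E] {ι : Type*} [Fintype ι]
  [DecidableEq ι]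

/-- Jacobi's formula for the derivative of a determinant. -/
theorem exists_hasFDerivAt_det {A : E → Matrix ι ι ℝ} {A' : ι → ι → E →L[ℝ] ℝ} {e : E}
    (h : ∀ i j, HasFDerivAt (fun x ↦ A x i j) (A' i j) e) :
    ∃ D : E →L[ℝ] ℝ, HasFDerivAt (fun x ↦ (A x).det) D e ∧
      ∀ v, D v = ((A e).adjugate * Matrix.of fun i j ↦ A' i j v).trace := by
  let det : ContinuousMultilinearMap ℝ (fun _ : ι ↦ ι → ℝ) ℝ :=
    { toMultilinearMap := Matrix.detRowAlternating.toMultilinearMap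
      cont := Continuous.matrix_det continuous_id }
  have hA : HasFDerivAt (fun x i ↦ (A x i : ι → ℝ))
      (ContinuousLinearMap.pi fun i ↦ ContinuousLinearMap.pi fun j ↦ A' i j) e :=
    hasFDerivAt_pi.2 fun i ↦ hasFDerivAt_pi.2 fun j ↦ h i j
  have hdet : HasFDerivAt (fun x ↦ det fun i ↦ A x i) _ e :=
    HasFDerivAt.comp (g := det) (f := fun x i ↦ (A x i : ι → ℝ)) e (det.hasFDerivAt _) hA
  refine ⟨_, hdet, fun v ↦ ?_⟩
  rw [ContinuousLinearMap.comp_apply, ContinuousMultilinearMap.linearDeriv_apply]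
  -- The determinant with one row replaced is a Cramer expansion along the adjugate.
  have h1 : ∀ i, det (Function.update (fun i ↦ A e i) i fun j ↦ A' i j v) =
      ∑ j, (A e).adjugate j i * A' i j v := by
    intro i
    change ((A e).updateRow i fun j ↦ A' i j v).det = _
    rw [← Matrix.cramer_transpose_apply, Matrix.cramer_eq_adjugate_mulVec,
      ← Matrix.adjugate_transpose]
    rfl
  refine (Finset.sum_congr rfl fun i _ ↦ h1 i).trans ?_
  rw [Finset.sum_comm]
  rfl

/-- By cyclicity and `G adj G = adj G G = det G`, each summand contributes `det G · tr N`. This is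
Jacobi's formula for a metric varying by `NᵀG + GN`. -/
theorem trace_adjugate_mul_lie (G N : Matrix ι ι ℝ) :
    (G.adjugate * (N.transpose * G + G * N)).trace = 2 * G.det * N.trace := by
  rw [mul_add, Matrix.trace_add, ← mul_assoc, ← mul_assoc, Matrix.trace_mul_comm, ← mul_assoc,
    Matrix.mul_adjugate, Matrix.adjugate_mul, smul_mul_assoc, smul_mul_assoc, one_mul, one_mul,
    Matrix.trace_smul, Matrix.trace_smul, Matrix.trace_transpose, smul_eq_mul]
  ring

end Jacobi

/-! ### The Riemannian density in charts and its derivative along a field. -/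

section Density

variable {E : Type*} [NormedAddCommGroup E] [NormedSpace ℝ E] [FiniteDimensional ℝ E]
  {M : Type*} [TopologicalSpace M] [ChartedSpace E M] [IsManifold 𝓘(ℝ, E) ∞ M]
  (g : RiemMetric E M) (c : M) {e : E}

/-- The metric in the chart at `c`. -/
def chartMetric (e : E) : LinearMap.BilinForm ℝ E :=
  LinearMap.compl₁₂ (metricForm g ((extChartAt 𝓘(ℝ, E) c).symm e)) (chartDeriv c e).toLinearMap
    (chartDeriv c e).toLinearMap

/-- The Gram matrix of the metric in the chart at `c`. -/
def gram (e : E) : Matrix (Fin (Module.finrank ℝ E)) (Fin (Module.finrank ℝ E)) ℝ :=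
  Matrix.of fun i j ↦ chartMetric g c e (Module.finBasis ℝ E i) (Module.finBasis ℝ E j)

theorem gram_apply (e : E) (i j : Fin (Module.finrank ℝ E)) : gram g c e i j =
    chartMetric g c e (Module.finBasis ℝ E i) (Module.finBasis ℝ E j) := rfl

/-- The Riemannian density in the chart at `c`. -/
def density (e : E) : ℝ := Real.sqrt (gram g c e).det

theorem det_gram_pos (he : e ∈ (extChartAt 𝓘(ℝ, E) c).target) : 0 < (gram g c e).det := by
  let b := Module.finBasis ℝ E
  refine Matrix.PosDef.det_pos (Matrix.PosDef.of_dotProduct_mulVec_pos ?_ fun x hx ↦ ?_)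
  · ext i j
    exact g.symm _ _ _
  · have h : star x ⬝ᵥ (gram g c e).mulVec x =
        chartMetric g c e (∑ i, x i • b i) (∑ i, x i • b i) := by
      simp only [map_sum, map_smul, LinearMap.sum_apply, LinearMap.smul_apply, dotProduct,
        Matrix.mulVec, gram_apply, star_trivial, smul_eq_mul]
      refine Finset.sum_congr rfl fun i _ ↦ ?_
      rw [Finset.mul_sum, Finset.mul_sum]
      refine Finset.sum_congr rfl fun j _ ↦ ?_
      have hs : chartMetric g c e (b i) (b j) = chartMetric g c e (b j) (b i) := g.symm _ _ _
      exact congrArg (x i * ·) ((mul_comm _ _).trans (congrArg (x j * ·) hs))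
    rw [h]
    refine g.pos _ _ fun h0 ↦ hx ?_
    have h1 : ∑ i, x i • b i = 0 :=
      (isInvertible_chartDeriv c he).injective (h0.trans (map_zero _).symm)
    exact funext fun i ↦ Fintype.linearIndependent_iff.1 b.linearIndependent x h1 i

theorem density_pos (he : e ∈ (extChartAt 𝓘(ℝ, E) c).target) : 0 < density g c e :=
  Real.sqrt_pos.2 (det_gram_pos g c he)

theorem contMDiffAt_metric_coordField {x : M} (hx : x ∈ (extChartAt 𝓘(ℝ, E) c).source) (v w : E) :
    ContMDiffAt 𝓘(ℝ, E) 𝓘(ℝ, ℝ) ∞ (fun z ↦ g.inner z (coordField c v z) (coordField c w z)) x := by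
  have h := ContMDiffAt.clm_bundle_apply₂ (F₁ := E) (F₂ := E)
    (g.contMDiff.contMDiffAt (x := x))
    (contMDiffAt_coordField c hx v) (contMDiffAt_coordField c hx w)
  exact (Bundle.contMDiffAt_section (F := ℝ) _).1 h

omit [FiniteDimensional ℝ E] in
theorem chartMetric_eventuallyEq (he : e ∈ (extChartAt 𝓘(ℝ, E) c).target) (v w : E) :
    (fun z ↦ chartMetric g c z v w) =ᶠ[𝓝 e] fun z ↦ g.inner ((extChartAt 𝓘(ℝ, E) c).symm z)
      (coordField c v ((extChartAt 𝓘(ℝ, E) c).symm z))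
      (coordField c w ((extChartAt 𝓘(ℝ, E) c).symm z)) := by
  filter_upwards [target_mem_nhds c he] with z hz
  rw [coordField_symm c hz, coordField_symm c hz]
  rfl

theorem contDiffAt_chartMetric (he : e ∈ (extChartAt 𝓘(ℝ, E) c).target) (v w : E) :
    ContDiffAt ℝ ∞ (fun z ↦ chartMetric g c z v w) e :=
  (contDiffAt_comp_chart_symm c he (contMDiffAt_metric_coordField g c
    ((extChartAt 𝓘(ℝ, E) c).map_target he) v w)).congr_of_eventuallyEq
    (chartMetric_eventuallyEq g c he v w)

theorem contDiffAt_density (he : e ∈ (extChartAt 𝓘(ℝ, E) c).target) :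
    ContDiffAt ℝ ∞ (density g c) e := by
  refine ContDiffAt.sqrt ?_ (det_gram_pos g c he).ne'
  simp only [Matrix.det_apply]
  refine ContDiffAt.sum fun σ _ ↦ ContDiffAt.const_smul _ (contDiffAt_prod fun i _ ↦ ?_)
  exact contDiffAt_chartMetric g c he _ _

/-- Along `X`, the coordinate fields change by the difference of `∇X` and the derivative of the
expression of `X` in the chart. -/
theorem fderiv_chartMetric {cov : Connection E M} (hcov : IsLeviCivita g cov)
    (he : e ∈ (extChartAt 𝓘(ℝ, E) c).target) {X : (x : M) → TangentSpace 𝓘(ℝ, E) x}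
    (hX : MDiffAt (T% X) ((extChartAt 𝓘(ℝ, E) c).symm e)) (N : E →ₗ[ℝ] E)
    (hN : ∀ v, chartDeriv c e (N v) = cov X ((extChartAt 𝓘(ℝ, E) c).symm e) (chartDeriv c e v) -
      chartDeriv c e (fderiv ℝ (fieldInChart c X) e v)) (v w : E) :
    fderiv ℝ (fun z ↦ chartMetric g c z v w) e (fieldInChart c X e) =
      chartMetric g c e (N v) w + chartMetric g c e v (N w) := by
  have hx := (extChartAt 𝓘(ℝ, E) c).map_target he
  -- Torsion-freeness gives `∇_X ∂_v = ∇_{∂_v} X + [X, ∂_v]`, and `[X, ∂_v] = - DX(v)` because `∂_v`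
  -- is constant in the chart.
  have hcov1 : ∀ v, cov (coordField c v) ((extChartAt 𝓘(ℝ, E) c).symm e)
      (X ((extChartAt 𝓘(ℝ, E) c).symm e)) = chartDeriv c e (N v) := by
    intro v
    have h1 := hcov.torsion_free X (coordField c v) _ hX (mdifferentiableAt_coordField c hx v)
    have h2 := chartDeriv_fieldInChart c he (mlieBracket 𝓘(ℝ, E) X (coordField c v))
    have h3 : fderiv ℝ (fieldInChart c (coordField c v)) e = 0 := by
      have : fieldInChart c (coordField c v) =ᶠ[𝓝 e] fun _ ↦ v := by
        filter_upwards [target_mem_nhds c he] with z hz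
        exact fieldInChart_coordField c hz v
      rw [this.fderiv_eq, fderiv_fun_const]
      rfl
    rw [fieldInChart_mlieBracket c he hX (mdifferentiableAt_coordField c hx v), h3,
      fieldInChart_coordField c he] at h2
    rw [← h2, coordField_symm c he, sub_eq_iff_eq_add] at h1
    rw [h1, hN, zero_apply, zero_sub, map_neg]
    abel
  have h1 := (fderiv_comp_chart_symm c he
    ((contMDiffAt_metric_coordField g c hx v w).mdifferentiableAt (by simp))).fderiv
  rw [(chartMetric_eventuallyEq g c he v w).fderiv_eq, h1, ContinuousLinearMap.comp_apply,
    chartDeriv_fieldInChart c he, hcov.metric_compatible _ _ _ (mdifferentiableAt_coordField c hx v)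
      (mdifferentiableAt_coordField c hx w), hcov1, hcov1, coordField_symm c he,
    coordField_symm c he]
  rfl

/-- This is `L_X vol = (div X) vol` in coordinates. The Gram matrix changes along `X` by `N = ∇X -
DX` acting on both arguments, so Jacobi's formula gives `X(√det G) = √det G · tr N`. -/
theorem fderiv_density {cov : Connection E M} (hcov : IsLeviCivita g cov)
    (he : e ∈ (extChartAt 𝓘(ℝ, E) c).target) {X : (x : M) → TangentSpace 𝓘(ℝ, E) x}
    (hX : MDiffAt (T% X) ((extChartAt 𝓘(ℝ, E) c).symm e)) :
    fderiv ℝ (density g c) e (fieldInChart c X e) +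
        density g c e * LinearMap.trace ℝ E (fderiv ℝ (fieldInChart c X) e).toLinearMap =
      density g c e * divergence cov X ((extChartAt 𝓘(ℝ, E) c).symm e) := by
  let b := Module.finBasis ℝ E
  obtain ⟨T, hT⟩ := isInvertible_chartDeriv c he
  have hT' : ∀ v, chartDeriv c e v = T v := fun v ↦ by rw [← hT]; rfl
  let L : E →ₗ[ℝ] E :=
    T.symm.toLinearEquiv.conj (cov X ((extChartAt 𝓘(ℝ, E) c).symm e)).toLinearMap
  have hL : ∀ v, T (L v) = cov X ((extChartAt 𝓘(ℝ, E) c).symm e) (T v) := fun v ↦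
    T.apply_symm_apply _
  let N : E →ₗ[ℝ] E := L - (fderiv ℝ (fieldInChart c X) e).toLinearMap
  have hN : ∀ v, chartDeriv c e (N v) = cov X ((extChartAt 𝓘(ℝ, E) c).symm e) (chartDeriv c e v) -
      chartDeriv c e (fderiv ℝ (fieldInChart c X) e v) := by
    intro v
    rw [hT', hT', hT', ← hL, ← map_sub]
    rfl
  have htr : LinearMap.trace ℝ E N = divergence cov X ((extChartAt 𝓘(ℝ, E) c).symm e) -
      LinearMap.trace ℝ E (fderiv ℝ (fieldInChart c X) e).toLinearMap := by
    rw [map_sub]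
    exact congrArg (· - _) (LinearMap.trace_conj' _ T.symm.toLinearEquiv)
  have hG : ∀ i j, HasFDerivAt (fun z ↦ gram g c z i j)
      (fderiv ℝ (fun z ↦ chartMetric g c z (b i) (b j)) e) e := fun i j ↦
    ((contDiffAt_chartMetric g c he (b i) (b j)).differentiableAt (by simp)).hasFDerivAt
  obtain ⟨D, hD, hDv⟩ := exists_hasFDerivAt_det hG
  have hmat : (Matrix.of fun i j ↦ fderiv ℝ (fun z ↦ chartMetric g c z (b i) (b j)) e
      (fieldInChart c X e)) = (LinearMap.toMatrix b b N).transpose * gram g c e +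
        gram g c e * LinearMap.toMatrix b b N := by
    have hNb : ∀ i, N (b i) = ∑ k, LinearMap.toMatrix b b N k i • b k := fun i ↦ by
      simp only [LinearMap.toMatrix_apply]
      exact (b.sum_repr _).symm
    ext i j
    rw [Matrix.of_apply, fderiv_chartMetric g c hcov he hX N hN, hNb, hNb]
    simp only [map_sum, map_smul, LinearMap.sum_apply, LinearMap.smul_apply, smul_eq_mul,
      Matrix.add_apply, Matrix.mul_apply, Matrix.transpose_apply, gram_apply]
    exact congrArg (_ + ·) (Finset.sum_congr rfl fun k _ ↦ mul_comm _ _)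
  have hs := hD.sqrt (det_gram_pos g c he).ne'
  have hs' : HasFDerivAt (density g c) _ e := hs
  rw [hs'.fderiv]
  have hDX : D (fieldInChart c X e) = 2 * (gram g c e).det * LinearMap.trace ℝ E N := by
    rw [hDv, hmat, trace_adjugate_mul_lie, LinearMap.trace_eq_matrix_trace ℝ b]
  have hpos := det_gram_pos g c he
  have hsq : density g c e * density g c e = (gram g c e).det := Real.mul_self_sqrt hpos.le
  have hdpos := density_pos g c he
  change 1 / (2 * density g c e) * D (fieldInChart c X e) + _ = _
  rw [hDX, ← hsq, htr]
  field_simp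
  ring

-- All tangent spaces unfold to `E`; this allows a change of base point under dependent types.
omit [FiniteDimensional ℝ E] in
theorem metric_congr {x y : M} (h : x = y) (v w : E) :
    g.inner x (show TangentSpace 𝓘(ℝ, E) x from v) (show TangentSpace 𝓘(ℝ, E) x from w) =
      g.inner y (show TangentSpace 𝓘(ℝ, E) y from v) (show TangentSpace 𝓘(ℝ, E) y from w) := by
  subst h
  rfl

variable (d : M)

/-- The change of coordinates from the chart at `c` to the chart at `d`. -/
def transition (e : E) : E := extChartAt 𝓘(ℝ, E) d ((extChartAt 𝓘(ℝ, E) c).symm e)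

omit [FiniteDimensional ℝ E] in
theorem differentiableAt_transition (he : e ∈ (extChartAt 𝓘(ℝ, E) c).target)
    (hd : (extChartAt 𝓘(ℝ, E) c).symm e ∈ (extChartAt 𝓘(ℝ, E) d).source) :
    DifferentiableAt ℝ (transition c d) e :=
  (contMDiffAt_iff_contDiffAt.1 ((contMDiffAt_chart d hd).comp e
    (contMDiffAt_chart_symm c he))).differentiableAt (by simp)

omit [FiniteDimensional ℝ E] in
theorem chartMetric_transition (he : e ∈ (extChartAt 𝓘(ℝ, E) c).target)
    (hd : (extChartAt 𝓘(ℝ, E) c).symm e ∈ (extChartAt 𝓘(ℝ, E) d).source) (v w : E) :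
    chartMetric g c e v w = chartMetric g d (transition c d e)
      (fderiv ℝ (transition c d) e v) (fderiv ℝ (transition c d) e w) := by
  have ht : transition c d e ∈ (extChartAt 𝓘(ℝ, E) d).target :=
    (extChartAt 𝓘(ℝ, E) d).map_source hd
  have hev : (extChartAt 𝓘(ℝ, E) c).symm =ᶠ[𝓝 e]
      fun z ↦ (extChartAt 𝓘(ℝ, E) d).symm (transition c d z) := by
    have h1 : (extChartAt 𝓘(ℝ, E) c).symm ⁻¹' (extChartAt 𝓘(ℝ, E) d).source ∈ 𝓝 e :=
      (contMDiffAt_chart_symm c he).continuousAt.preimage_mem_nhds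
        ((isOpen_extChartAt_source d).mem_nhds hd)
    filter_upwards [h1] with z hz
    exact ((extChartAt 𝓘(ℝ, E) d).left_inv hz).symm
  have hder : mfderiv 𝓘(ℝ, E) 𝓘(ℝ, E) (extChartAt 𝓘(ℝ, E) c).symm e =
      (mfderiv 𝓘(ℝ, E) 𝓘(ℝ, E) (extChartAt 𝓘(ℝ, E) d).symm (transition c d e)).comp
        (mfderiv 𝓘(ℝ, E) 𝓘(ℝ, E) (transition c d) e) := by
    have hcomp := (((contMDiffAt_chart_symm d ht).mdifferentiableAt (by simp)).hasMFDerivAt).comp e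
      (differentiableAt_transition c d he hd).mdifferentiableAt.hasMFDerivAt
    exact (hcomp.congr_of_eventuallyEq hev).mfderiv
  have hv : ∀ v, (chartDeriv c e v : E) =
    (chartDeriv d (transition c d e) (fderiv ℝ (transition c d) e v) : E) :=
    fun v ↦ (DFunLike.congr_fun hder v).trans (congrArg
      (mfderiv 𝓘(ℝ, E) 𝓘(ℝ, E) (extChartAt 𝓘(ℝ, E) d).symm (transition c d e))
      (DFunLike.congr_fun mfderiv_eq_fderiv v))
  have h1 := metric_congr g (show (extChartAt 𝓘(ℝ, E) c).symm e = (extChartAt 𝓘(ℝ, E) d).symm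
    (transition c d e) from hev.self_of_nhds) (chartDeriv c e v) (chartDeriv c e w)
  refine h1.trans ?_
  rw [hv v, hv w]
  rfl

/-- The Gram matrices are congruent through the Jacobian matrix, so the determinants differ by its
squared determinant. -/
theorem density_transition (he : e ∈ (extChartAt 𝓘(ℝ, E) c).target)
    (hd : (extChartAt 𝓘(ℝ, E) c).symm e ∈ (extChartAt 𝓘(ℝ, E) d).source) :
    density g c e = |(fderiv ℝ (transition c d) e).det| * density g d (transition c d e) := by
  let b := Module.finBasis ℝ E
  let A := LinearMap.toMatrix b b (fderiv ℝ (transition c d) e).toLinearMap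
  have hA : ∀ i, fderiv ℝ (transition c d) e (b i) = ∑ k, A k i • b k := fun i ↦ by
    simp only [A, LinearMap.toMatrix_apply]
    exact (b.sum_repr _).symm
  have hmat : gram g c e = A.transpose * gram g d (transition c d e) * A := by
    ext i j
    rw [gram_apply, chartMetric_transition g c d he hd, hA, hA]
    simp only [map_sum, map_smul, LinearMap.sum_apply, LinearMap.smul_apply, smul_eq_mul,
      Matrix.mul_apply, Matrix.transpose_apply, gram_apply]
    refine Finset.sum_congr rfl fun k _ ↦ ?_
    rw [mul_comm]
  have hdet : A.det = (fderiv ℝ (transition c d) e).det := LinearMap.det_toMatrix b _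
  rw [density, hmat, Matrix.det_mul, Matrix.det_mul, Matrix.det_transpose, hdet, density,
    mul_right_comm, Real.sqrt_mul (mul_self_nonneg _), Real.sqrt_mul_self_eq_abs]

end Density

/-! ### Integration in one chart, change of charts and the local divergence theorem. -/

section ChartIntegral

open MeasureTheory

variable {E : Type*} [NormedAddCommGroup E] [NormedSpace ℝ E]
  {M : Type*} [TopologicalSpace M] [ChartedSpace E M]

/-- The product of `w` and of the expression of `h` in the chart at `c`, extended by zero. -/
def extendByZero (c : M) (w : E → ℝ) (h : M → ℝ) : E → ℝ :=
  (extChartAt 𝓘(ℝ, E) c).target.indicator fun e ↦ w e * h ((extChartAt 𝓘(ℝ, E) c).symm e)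

theorem extendByZero_of_mem {c : M} {e : E} (he : e ∈ (extChartAt 𝓘(ℝ, E) c).target) (w : E → ℝ)
    (h : M → ℝ) : extendByZero c w h e = w e * h ((extChartAt 𝓘(ℝ, E) c).symm e) :=
  indicator_of_mem he _

theorem extendByZero_of_notMem {c : M} {e : E} (he : e ∉ (extChartAt 𝓘(ℝ, E) c).target) (w : E → ℝ)
    (h : M → ℝ) : extendByZero c w h e = 0 :=
  indicator_of_notMem he _

variable [CompactSpace M] {c : M} {w : E → ℝ} {h : M → ℝ}

theorem isCompact_chart_image_tsupport (hs : tsupport h ⊆ (extChartAt 𝓘(ℝ, E) c).source) :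
    IsCompact (extChartAt 𝓘(ℝ, E) c '' tsupport h) :=
  (isClosed_tsupport h).isCompact.image_of_continuousOn
    ((continuousOn_extChartAt c).mono hs)

omit [CompactSpace M] in
theorem support_extendByZero_subset :
    Function.support (extendByZero c w h) ⊆ extChartAt 𝓘(ℝ, E) c '' tsupport h := by
  intro e he
  have ht : e ∈ (extChartAt 𝓘(ℝ, E) c).target := by
    by_contra hn
    exact he (extendByZero_of_notMem hn w h)
  rw [Function.mem_support, extendByZero_of_mem ht] at he
  exact ⟨_, subset_tsupport h (right_ne_zero_of_mul he), (extChartAt 𝓘(ℝ, E) c).right_inv ht⟩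

theorem tsupport_extendByZero_subset (hs : tsupport h ⊆ (extChartAt 𝓘(ℝ, E) c).source) :
    tsupport (extendByZero c w h) ⊆ extChartAt 𝓘(ℝ, E) c '' tsupport h :=
  closure_minimal support_extendByZero_subset (isCompact_chart_image_tsupport hs).isClosed

theorem tsupport_extendByZero_subset_target (hs : tsupport h ⊆ (extChartAt 𝓘(ℝ, E) c).source) :
    tsupport (extendByZero c w h) ⊆ (extChartAt 𝓘(ℝ, E) c).target := by
  refine (tsupport_extendByZero_subset hs).trans ?_
  rintro _ ⟨x, hx, rfl⟩
  exact (extChartAt 𝓘(ℝ, E) c).map_source (hs hx)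

theorem hasCompactSupport_extendByZero (hs : tsupport h ⊆ (extChartAt 𝓘(ℝ, E) c).source) :
    HasCompactSupport (extendByZero c w h) :=
  HasCompactSupport.intro' (isCompact_chart_image_tsupport hs)
    (isCompact_chart_image_tsupport hs).isClosed fun _ hx ↦
      Function.notMem_support.1 fun h' ↦ hx (support_extendByZero_subset h')

omit [CompactSpace M] in
theorem extendByZero_eventuallyEq {e : E} (he : e ∈ (extChartAt 𝓘(ℝ, E) c).target) :
    extendByZero c w h =ᶠ[𝓝 e] fun e ↦ w e * h ((extChartAt 𝓘(ℝ, E) c).symm e) := by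
  filter_upwards [(isOpen_extChartAt_target c).mem_nhds he] with z hz
  exact extendByZero_of_mem hz w h

theorem extendByZero_eventuallyEq_zero (hs : tsupport h ⊆ (extChartAt 𝓘(ℝ, E) c).source) {e : E}
    (he : e ∉ (extChartAt 𝓘(ℝ, E) c).target) : extendByZero c w h =ᶠ[𝓝 e] 0 :=
  notMem_tsupport_iff_eventuallyEq.1 fun h' ↦ he (tsupport_extendByZero_subset_target hs h')

theorem continuous_extendByZero (hw : ContinuousOn w (extChartAt 𝓘(ℝ, E) c).target)
    (hh : ContinuousOn h (extChartAt 𝓘(ℝ, E) c).source)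
    (hs : tsupport h ⊆ (extChartAt 𝓘(ℝ, E) c).source) : Continuous (extendByZero c w h) := by
  refine continuous_iff_continuousAt.2 fun e ↦ ?_
  by_cases he : e ∈ (extChartAt 𝓘(ℝ, E) c).target
  · refine ContinuousAt.congr ?_ (extendByZero_eventuallyEq he).symm
    have h1 : ContinuousOn (fun e ↦ w e * h ((extChartAt 𝓘(ℝ, E) c).symm e))
        (extChartAt 𝓘(ℝ, E) c).target :=
      hw.mul (hh.comp (continuousOn_extChartAt_symm c) fun z hz ↦
        (extChartAt 𝓘(ℝ, E) c).map_target hz)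
    exact h1.continuousAt ((isOpen_extChartAt_target c).mem_nhds he)
  · exact continuousAt_const.congr (extendByZero_eventuallyEq_zero hs he).symm

variable [MeasurableSpace E] [BorelSpace E] (μ : Measure E)

theorem integrable_extendByZero [IsFiniteMeasureOnCompacts μ]
    (hw : ContinuousOn w (extChartAt 𝓘(ℝ, E) c).target)
    (hh : ContinuousOn h (extChartAt 𝓘(ℝ, E) c).source)
    (hs : tsupport h ⊆ (extChartAt 𝓘(ℝ, E) c).source) : Integrable (extendByZero c w h) μ :=
  (continuous_extendByZero hw hh hs).integrable_of_hasCompactSupport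
    (hasCompactSupport_extendByZero hs)

variable [FiniteDimensional ℝ E] [IsManifold 𝓘(ℝ, E) ∞ M] (g : RiemMetric E M)

omit [CompactSpace M] [MeasurableSpace E] [BorelSpace E] in
theorem continuousOn_density : ContinuousOn (density g c) (extChartAt 𝓘(ℝ, E) c).target :=
  fun _ he ↦ (contDiffAt_density g c he).continuousAt.continuousWithinAt

/-- The Riemannian integral of a function supported in the domain of the chart at `c`. -/
def chartIntegral (c : M) (h : M → ℝ) : ℝ := ∫ e, extendByZero c (density g c) h e ∂μ

omit [CompactSpace M] in
theorem chartIntegral_eq_setIntegral (c : M) (h : M → ℝ) : chartIntegral μ g c h =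
    ∫ e in (extChartAt 𝓘(ℝ, E) c).target, density g c e * h ((extChartAt 𝓘(ℝ, E) c).symm e) ∂μ :=
  integral_indicator (isOpen_extChartAt_target c).measurableSet

omit [CompactSpace M] in
/-- The integral does not depend on the chart. -/
theorem chartIntegral_eq_of_support [μ.IsAddHaarMeasure] (c d : M)
    (hc : ∀ x ∉ (extChartAt 𝓘(ℝ, E) c).source, h x = 0)
    (hd : ∀ x ∉ (extChartAt 𝓘(ℝ, E) d).source, h x = 0) :
    chartIntegral μ g c h = chartIntegral μ g d h := by
  rw [chartIntegral_eq_setIntegral, chartIntegral_eq_setIntegral]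
  -- The overlap of the two charts; outside it the integrand vanishes, so the change of variables
  -- takes place there.
  let s : M → M → Set E := fun c d ↦ (extChartAt 𝓘(ℝ, E) c).target ∩
    (extChartAt 𝓘(ℝ, E) c).symm ⁻¹' (extChartAt 𝓘(ℝ, E) d).source
  have hs : ∀ c d : M, IsOpen (s c d) := fun c d ↦
    (continuousOn_extChartAt_symm c).isOpen_inter_preimage (isOpen_extChartAt_target c)
      (isOpen_extChartAt_source d)
  have hrestrict : ∀ c d : M, (∀ x ∉ (extChartAt 𝓘(ℝ, E) d).source, h x = 0) →
      ∫ e in (extChartAt 𝓘(ℝ, E) c).target,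
        density g c e * h ((extChartAt 𝓘(ℝ, E) c).symm e) ∂μ =
      ∫ e in s c d, density g c e * h ((extChartAt 𝓘(ℝ, E) c).symm e) ∂μ := by
    intro c d hd
    refine setIntegral_eq_of_subset_of_forall_sdiff_eq_zero
      (isOpen_extChartAt_target c).measurableSet inter_subset_left fun e he ↦ ?_
    rw [hd _ fun h' ↦ he.2 ⟨he.1, h'⟩, mul_zero]
  have hinv : ∀ c d : M, ∀ e ∈ s c d, transition c d e ∈ s d c ∧
      transition d c (transition c d e) = e ∧
      (extChartAt 𝓘(ℝ, E) d).symm (transition c d e) = (extChartAt 𝓘(ℝ, E) c).symm e := by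
    intro c d e he
    have h1 : (extChartAt 𝓘(ℝ, E) d).symm (transition c d e) = (extChartAt 𝓘(ℝ, E) c).symm e :=
      (extChartAt 𝓘(ℝ, E) d).left_inv he.2
    refine ⟨⟨(extChartAt 𝓘(ℝ, E) d).map_source he.2, ?_⟩, ?_, h1⟩
    · rw [mem_preimage, h1]
      exact (extChartAt 𝓘(ℝ, E) c).map_target he.1
    · rw [transition, h1]
      exact (extChartAt 𝓘(ℝ, E) c).right_inv he.1
  have himage : transition c d '' s c d = s d c := by
    refine Subset.antisymm ?_ fun e he ↦ ⟨_, (hinv d c e he).1, (hinv d c e he).2.1⟩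
    rintro _ ⟨e, he, rfl⟩
    exact (hinv c d e he).1
  rw [hrestrict c d hd, hrestrict d c hc, ← himage,
    integral_image_eq_integral_abs_det_fderiv_smul μ (hs c d).measurableSet
      (fun e he ↦ (differentiableAt_transition c d he.1 he.2).hasFDerivAt.hasFDerivWithinAt)
      (fun e he e' he' heq ↦ by rw [← (hinv c d e he).2.1, heq, (hinv c d e' he').2.1])]
  refine setIntegral_congr_fun (hs c d).measurableSet fun e he ↦ ?_
  simp only [smul_eq_mul]
  rw [(hinv c d e he).2.2, density_transition g c d he.1 he.2, mul_assoc]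

omit [CompactSpace M] [MeasurableSpace E] [BorelSpace E] [FiniteDimensional ℝ E]
  [IsManifold 𝓘(ℝ, E) ∞ M] in
theorem tsupport_mvfderiv_subset (f : M → ℝ) (X : (x : M) → TangentSpace 𝓘(ℝ, E) x) :
    tsupport (fun x ↦ mvfderiv 𝓘(ℝ, E) f x (X x)) ⊆ tsupport f := by
  refine closure_minimal (fun x hx ↦ ?_) (isClosed_tsupport f)
  by_contra hn
  refine hx ?_
  have h1 := notMem_tsupport_iff_eventuallyEq.1 hn
  have h2 : mvfderiv 𝓘(ℝ, E) f x = 0 := by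
    have h3 : HasMFDerivAt 𝓘(ℝ, E) 𝓘(ℝ, ℝ) f x 0 :=
      (hasMFDerivAt_const (0 : ℝ) x).congr_of_eventuallyEq h1
    exact h3.mfderiv
  exact DFunLike.congr_fun h2 (X x)

omit [CompactSpace M] [MeasurableSpace E] [BorelSpace E] in
/-- The flux density of a divergence free field is divergence free in every chart. -/
theorem sum_fderiv_density_mul_eq_zero {cov : Connection E M} (hcov : IsLeviCivita g cov)
    (X : VectorFields E M) (hdiv : ∀ x, divergence cov X x = 0) {e : E}
    (he : e ∈ (extChartAt 𝓘(ℝ, E) c).target) :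
    ∑ i, fderiv ℝ (fun z ↦ density g c z * (Module.finBasis ℝ E).coord i (fieldInChart c X z)) e
      (Module.finBasis ℝ E i) = 0 := by
  let b := Module.finBasis ℝ E
  have hX : MDiffAt (T% (X : (x : M) → TangentSpace 𝓘(ℝ, E) x))
    ((extChartAt 𝓘(ℝ, E) c).symm e) := X.contMDiff.mdifferentiableAt (by simp)
  have hs := ((contDiffAt_density g c he).differentiableAt (by simp)).hasFDerivAt
  have hd := (differentiableAt_fieldInChart c he hX).hasFDerivAt
  have h1 : ∀ i, fderiv ℝ (fun z ↦ density g c z * b.coord i (fieldInChart c X z)) e (b i) =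
      b.coord i (fieldInChart c X e) * fderiv ℝ (density g c) e (b i) +
        density g c e * b.coord i (fderiv ℝ (fieldInChart c X) e (b i)) := by
    intro i
    have h2 := hs.mul (((b.coord i).toContinuousLinearMap.hasFDerivAt).comp e hd)
    have h3 : HasFDerivAt (fun z ↦ density g c z * b.coord i (fieldInChart c X z)) _ e := h2
    rw [h3.fderiv]
    exact add_comm _ _
  have h4 := fderiv_density g c hcov he hX
  rw [hdiv, mul_zero, LinearMap.trace_eq_matrix_trace ℝ b] at h4
  refine (Finset.sum_congr rfl fun i _ ↦ h1 i).trans ?_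
  rw [Finset.sum_add_distrib, ← Finset.mul_sum]
  refine Eq.trans (congrArg₂ _ ?_ ?_) h4
  · conv_rhs => rw [← b.sum_repr (fieldInChart c X e)]
    rw [map_sum]
    exact Finset.sum_congr rfl fun i _ ↦ (map_smul (fderiv ℝ (density g c) e) _ (b i)).symm
  · refine congrArg _ (Finset.sum_congr rfl fun i _ ↦ ?_)
    rw [Matrix.diag_apply, LinearMap.toMatrix_apply]
    rfl

/-- The divergence theorem for functions supported in the domain of a chart. -/
theorem chartIntegral_mvfderiv_eq_zero [μ.IsAddHaarMeasure] {cov : Connection E M}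
    (hcov : IsLeviCivita g cov) (X : VectorFields E M) (hdiv : ∀ x, divergence cov X x = 0)
    {f : M → ℝ} (hf : ContMDiff 𝓘(ℝ, E) 𝓘(ℝ, ℝ) ∞ f)
    (hs : tsupport f ⊆ (extChartAt 𝓘(ℝ, E) c).source) :
    chartIntegral μ g c (fun x ↦ mvfderiv 𝓘(ℝ, E) f x (X x)) = 0 := by
  let b := Module.finBasis ℝ E
  -- The components of the flux `√det G · X`, whose coordinate divergence vanishes.
  let W : Fin (Module.finrank ℝ E) → E → ℝ :=
    fun i z ↦ density g c z * b.coord i (fieldInChart c X z)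
  let F : E → ℝ := extendByZero c (fun _ ↦ 1) f
  have hW : ∀ i, ContDiffOn ℝ ∞ (W i) (extChartAt 𝓘(ℝ, E) c).target := fun i e he ↦
    ((contDiffAt_density g c he).mul ((b.coord i).toContinuousLinearMap.contDiff.contDiffAt.comp e
      (contDiffAt_fieldInChart c he X.contMDiff.contMDiffAt))).contDiffWithinAt
  have hF : ∀ e ∈ (extChartAt 𝓘(ℝ, E) c).target, HasFDerivAt F
      ((mvfderiv 𝓘(ℝ, E) f ((extChartAt 𝓘(ℝ, E) c).symm e)).comp (chartDeriv c e)) e := by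
    intro e he
    refine HasFDerivAt.congr_of_eventuallyEq
      (fderiv_comp_chart_symm c he (hf.mdifferentiableAt (by simp))) ?_
    filter_upwards [extendByZero_eventuallyEq (w := fun _ ↦ 1) (h := f) he] with z hz
    exact hz.trans (one_mul _)
  have hF0 : ∀ e ∉ (extChartAt 𝓘(ℝ, E) c).target, HasFDerivAt F (0 : E →L[ℝ] ℝ) e := fun e he ↦
    (hasFDerivAt_const (0 : ℝ) e).congr_of_eventuallyEq (extendByZero_eventuallyEq_zero hs he)
  have hFdiff : Differentiable ℝ F := fun e ↦ by
    by_cases he : e ∈ (extChartAt 𝓘(ℝ, E) c).target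
    · exact (hF e he).differentiableAt
    · exact (hF0 e he).differentiableAt
  have hopen := isOpen_extChartAt_target (I := 𝓘(ℝ, E)) c
  have i1 : ∀ i, Integrable (fun e ↦ W i e * fderiv ℝ F e (b i)) μ := fun i ↦ by
    have h1 := integrable_extendByZero μ (c := c) (w := W i)
      (h := fun x ↦ mvfderiv 𝓘(ℝ, E) f x (coordField c (b i) x)) (hW i).continuousOn
      (fun x hx ↦ (contMDiffAt_mvfderiv_apply hf
        (contMDiffAt_coordField c hx (b i))).continuousAt.continuousWithinAt)
      ((tsupport_mvfderiv_subset f _).trans hs)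
    refine h1.congr (Eventually.of_forall fun e ↦ ?_)
    by_cases he : e ∈ (extChartAt 𝓘(ℝ, E) c).target
    · simp only
      rw [extendByZero_of_mem he, (hF e he).fderiv, coordField_symm c he]
      rfl
    · simp only
      rw [extendByZero_of_notMem he, (hF0 e he).fderiv, zero_apply, mul_zero]
  have hprod : ∀ w : E → ℝ, (fun e ↦ w e * F e) = extendByZero c w f := fun w ↦ by
    funext e
    by_cases he : e ∈ (extChartAt 𝓘(ℝ, E) c).target
    · simp only [F]
      rw [extendByZero_of_mem he, extendByZero_of_mem he, one_mul]
    · simp only [F]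
      rw [extendByZero_of_notMem he, extendByZero_of_notMem he, mul_zero]
  have hfc : ContinuousOn f (extChartAt 𝓘(ℝ, E) c).source := hf.continuous.continuousOn
  have i2 : ∀ i, Integrable (fun e ↦ W i e * F e) μ := fun i ↦ by
    rw [hprod]
    exact integrable_extendByZero μ (hW i).continuousOn hfc hs
  have i3 : ∀ i, Integrable (fun e ↦ fderiv ℝ (W i) e (b i) * F e) μ := fun i ↦ by
    rw [hprod fun e ↦ fderiv ℝ (W i) e (b i)]
    exact integrable_extendByZero μ (((hW i).continuousOn_fderiv_of_isOpen hopen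
      (by simp)).clm_apply continuousOn_const) hfc hs
  have hpt : ∀ e, extendByZero c (density g c) (fun x ↦ mvfderiv 𝓘(ℝ, E) f x (X x)) e =
      ∑ i, W i e * fderiv ℝ F e (b i) := by
    intro e
    by_cases he : e ∈ (extChartAt 𝓘(ℝ, E) c).target
    · rw [extendByZero_of_mem he, (hF e he).fderiv, ← chartDeriv_fieldInChart c he X]
      conv_lhs => rw [← b.sum_repr (fieldInChart c X e)]
      rw [map_sum, map_sum, Finset.mul_sum]
      refine Finset.sum_congr rfl fun i _ ↦ ?_
      rw [map_smul, map_smul, smul_eq_mul, ← mul_assoc]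
      rfl
    · rw [extendByZero_of_notMem he, (hF0 e he).fderiv]
      simp
  rw [chartIntegral, integral_congr_ae (Eventually.of_forall hpt),
    integral_finsetSum _ fun i _ ↦ i1 i]
  -- `W i` is uncontrolled outside the chart; integration by parts needs its differentiability only
  -- on the support of `F`.
  have hparts : ∀ i, ∫ e, W i e * fderiv ℝ F e (b i) ∂μ = - ∫ e, fderiv ℝ (W i) e (b i) * F e ∂μ :=
    fun i ↦ integral_mul_fderiv_eq_neg_fderiv_mul_of_integrable (i3 i) (i1 i) (i2 i)
      (fun e he ↦ ((hW i).contDiffAt (hopen.mem_nhds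
        (tsupport_extendByZero_subset_target hs he))).differentiableAt (by simp))
      fun e _ ↦ hFdiff e
  rw [Finset.sum_congr rfl fun i _ ↦ hparts i, Finset.sum_neg_distrib,
    ← integral_finsetSum _ fun i _ ↦ i3 i, neg_eq_zero]
  refine (integral_congr_ae (Eventually.of_forall fun e ↦ ?_)).trans (integral_zero _ _)
  rw [← Finset.sum_mul]
  by_cases he : e ∈ (extChartAt 𝓘(ℝ, E) c).target
  · exact mul_eq_zero_of_left (sum_fderiv_density_mul_eq_zero g hcov X hdiv he) _
  · exact mul_eq_zero_of_right _ (extendByZero_of_notMem he _ _)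

end ChartIntegral

/-! ### The global integral as a positive functional. -/

section RiemannianIntegral

open MeasureTheory

variable {E : Type*} [NormedAddCommGroup E] [NormedSpace ℝ E] [FiniteDimensional ℝ E]
  {M : Type*} [TopologicalSpace M] [ChartedSpace E M] [IsManifold 𝓘(ℝ, E) ∞ M] [CompactSpace M]

variable (E M) in
/-- A finite smooth partition of unity subordinate to the charts. -/
theorem exists_finite_partition [T2Space M] : ∃ (S : Finset M) (ρ : M → M → ℝ),
    (∀ i, ContMDiff 𝓘(ℝ, E) 𝓘(ℝ, ℝ) ∞ (ρ i)) ∧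
    (∀ i, tsupport (ρ i) ⊆ (extChartAt 𝓘(ℝ, E) i).source) ∧ (∀ i x, 0 ≤ ρ i x) ∧
    ∀ x, ∑ i ∈ S, ρ i x = 1 := by
  obtain ⟨ρ, hρ⟩ := SmoothPartitionOfUnity.exists_isSubordinate_chartAt_source 𝓘(ℝ, E) M
  have hfin := ρ.locallyFinite.finite_nonempty_of_compact
  refine ⟨hfin.toFinset, fun i ↦ ρ i, fun i ↦ (ρ i).contMDiff, fun i ↦ ?_,
    fun i x ↦ ρ.nonneg i x, fun x ↦ ?_⟩
  · rw [extChartAt_source]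
    exact hρ i
  · rw [← ρ.sum_eq_one (mem_univ x)]
    refine (finsum_eq_sum_of_support_subset _ fun i hi ↦ ?_).symm
    rw [Set.Finite.coe_toFinset]
    exact ⟨x, hi⟩

omit [CompactSpace M] [FiniteDimensional ℝ E] in
theorem mvfderiv_sum_apply {κ : Type*} (S : Finset κ) {f : κ → M → ℝ} {x : M}
    (hf : ∀ i ∈ S, ContMDiffAt 𝓘(ℝ, E) 𝓘(ℝ, ℝ) ∞ (f i) x) (v : TangentSpace 𝓘(ℝ, E) x) :
    mvfderiv 𝓘(ℝ, E) (fun z ↦ ∑ i ∈ S, f i z) x v = ∑ i ∈ S, mvfderiv 𝓘(ℝ, E) (f i) x v := by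
  obtain ⟨c, e, he, rfl⟩ : ∃ c : M, ∃ e ∈ (extChartAt 𝓘(ℝ, E) c).target,
    (extChartAt 𝓘(ℝ, E) c).symm e = x := ⟨x, _, mem_extChartAt_target x, extChartAt_to_inv x⟩
  have h1 := HasFDerivAt.fun_sum fun i hi ↦ fderiv_comp_chart_symm c he
    ((hf i hi).mdifferentiableAt (by simp))
  have h2 := fderiv_comp_chart_symm c he (f := fun z ↦ ∑ i ∈ S, f i z)
    ((contMDiffAt_finsetSum hf).mdifferentiableAt (by simp))
  obtain ⟨w, rfl⟩ := (isInvertible_chartDeriv c he).surjective v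
  have h3 := DFunLike.congr_fun (h2.unique h1) w
  rw [sum_apply] at h3
  exact h3

variable [MeasurableSpace E] [BorelSpace E] (μ : Measure E) (g : RiemMetric E M)

theorem chartIntegral_sum [IsFiniteMeasureOnCompacts μ] (c : M) {κ : Type*} (S : Finset κ)
    {h : κ → M → ℝ} (hc : ∀ i ∈ S, Continuous (h i))
    (hs : ∀ i ∈ S, tsupport (h i) ⊆ (extChartAt 𝓘(ℝ, E) c).source) :
    chartIntegral μ g c (fun x ↦ ∑ i ∈ S, h i x) = ∑ i ∈ S, chartIntegral μ g c (h i) := by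
  simp only [chartIntegral]
  rw [← integral_finsetSum _ fun i hi ↦ integrable_extendByZero μ (continuousOn_density g)
    (hc i hi).continuousOn (hs i hi)]
  refine integral_congr_ae (Eventually.of_forall fun e ↦ ?_)
  by_cases he : e ∈ (extChartAt 𝓘(ℝ, E) c).target
  · simp only [extendByZero_of_mem he, Finset.mul_sum]
  · simp only [extendByZero_of_notMem he, Finset.sum_const_zero]

theorem chartIntegral_add [IsFiniteMeasureOnCompacts μ] (c : M) {h k : M → ℝ} (hh : Continuous h)
    (hk : Continuous k) (hhs : tsupport h ⊆ (extChartAt 𝓘(ℝ, E) c).source)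
    (hks : tsupport k ⊆ (extChartAt 𝓘(ℝ, E) c).source) :
    chartIntegral μ g c (fun x ↦ h x + k x) = chartIntegral μ g c h + chartIntegral μ g c k := by
  simp only [chartIntegral]
  rw [← integral_add (integrable_extendByZero μ (continuousOn_density g) hh.continuousOn hhs)
    (integrable_extendByZero μ (continuousOn_density g) hk.continuousOn hks)]
  refine integral_congr_ae (Eventually.of_forall fun e ↦ ?_)
  by_cases he : e ∈ (extChartAt 𝓘(ℝ, E) c).target
  · simp only [extendByZero_of_mem he, mul_add]
  · simp only [extendByZero_of_notMem he, add_zero]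

omit [CompactSpace M] [BorelSpace E] in
theorem chartIntegral_const_mul (c : M) (r : ℝ) (h : M → ℝ) :
    chartIntegral μ g c (fun x ↦ r * h x) = r * chartIntegral μ g c h := by
  simp only [chartIntegral]
  rw [← integral_const_mul]
  refine integral_congr_ae (Eventually.of_forall fun e ↦ ?_)
  by_cases he : e ∈ (extChartAt 𝓘(ℝ, E) c).target
  · simp only [extendByZero_of_mem he]
    ring
  · simp only [extendByZero_of_notMem he, mul_zero]

omit [CompactSpace M] [MeasurableSpace E] [BorelSpace E] in
theorem extendByZero_density_nonneg (c : M) {h : M → ℝ} (hh : ∀ x, 0 ≤ h x) (e : E) :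
    0 ≤ extendByZero c (density g c) h e :=
  indicator_nonneg (fun _ _ ↦ mul_nonneg (Real.sqrt_nonneg _) (hh _)) e

theorem chartIntegral_pos [μ.IsAddHaarMeasure] (c : M) {h : M → ℝ} (hc : Continuous h)
    (hs : tsupport h ⊆ (extChartAt 𝓘(ℝ, E) c).source) (hh : ∀ x, 0 ≤ h x) {x : M} (hx : h x ≠ 0) :
    0 < chartIntegral μ g c h := by
  have hxs : x ∈ (extChartAt 𝓘(ℝ, E) c).source := hs (subset_tsupport h hx)
  refine (continuous_extendByZero (continuousOn_density g) hc.continuousOn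
    hs).integral_pos_of_hasCompactSupport_nonneg_nonzero (x := extChartAt 𝓘(ℝ, E) c x)
    (hasCompactSupport_extendByZero hs) (extendByZero_density_nonneg g c hh) ?_
  have ht := (extChartAt 𝓘(ℝ, E) c).map_source hxs
  rw [extendByZero_of_mem ht, (extChartAt 𝓘(ℝ, E) c).left_inv hxs]
  exact mul_ne_zero (density_pos g c ht).ne' hx

omit [MeasurableSpace E] [BorelSpace E] in
/-- The Riemannian integral on a compact manifold, characterized by the divergence theorem. -/
theorem exists_riemannianIntegral [T2Space M] : ∃ I : C(M, ℝ) →ₗ[ℝ] ℝ,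
    (∀ h : C(M, ℝ), (∀ x, 0 ≤ h x) → (∃ x, h x ≠ 0) → 0 < I h) ∧
    ∀ cov : Connection E M, IsLeviCivita g cov → ∀ X : VectorFields E M,
      (∀ x, divergence cov X x = 0) → ∀ (f : M → ℝ), ContMDiff 𝓘(ℝ, E) 𝓘(ℝ, ℝ) ∞ f →
      ∀ k : C(M, ℝ), (∀ x, k x = mvfderiv 𝓘(ℝ, E) f x (X x)) → I k = 0 := by
  let _ : MeasurableSpace E := borel E
  have : BorelSpace E := ⟨rfl⟩
  let μ : Measure E := Measure.addHaar
  obtain ⟨S, ρ, hρ, hρs, hρ0, hρ1⟩ := exists_finite_partition E M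
  have hts : ∀ i (h : M → ℝ), tsupport (fun x ↦ ρ i x * h x) ⊆ (extChartAt 𝓘(ℝ, E) i).source :=
    fun i h ↦ (tsupport_mul_subset_left (f := ρ i) (g := h)).trans (hρs i)
  have hcont : ∀ i (h : C(M, ℝ)), Continuous fun x ↦ ρ i x * h x :=
    fun i h ↦ (hρ i).continuous.mul h.continuous
  let I : C(M, ℝ) →ₗ[ℝ] ℝ :=
    { toFun := fun h ↦ ∑ i ∈ S, chartIntegral μ g i fun x ↦ ρ i x * h x
      map_add' := fun h k ↦ by
        rw [← Finset.sum_add_distrib]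
        refine Finset.sum_congr rfl fun i _ ↦ ?_
        rw [← chartIntegral_add μ g i (hcont i h) (hcont i k) (hts i h) (hts i k)]
        simp only [ContinuousMap.add_apply, mul_add]
      map_smul' := fun r h ↦ by
        rw [RingHom.id_apply, smul_eq_mul, Finset.mul_sum]
        refine Finset.sum_congr rfl fun i _ ↦ ?_
        rw [← chartIntegral_const_mul]
        refine congrArg _ (funext fun x ↦ ?_)
        rw [ContinuousMap.smul_apply, smul_eq_mul]
        ring }
  refine ⟨I, fun h hh ⟨x, hx⟩ ↦ ?_, fun cov hcov X hdiv f hf k hk ↦ ?_⟩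
  · obtain ⟨i, hi, hix⟩ : ∃ i ∈ S, ρ i x ≠ 0 := by
      by_contra! hn
      have := hρ1 x
      rw [Finset.sum_eq_zero hn] at this
      exact zero_ne_one this
    refine Finset.sum_pos' (fun j _ ↦ ?_) ⟨i, hi, ?_⟩
    · exact integral_nonneg (extendByZero_density_nonneg g j fun x ↦ mul_nonneg (hρ0 j x) (hh x))
    · exact chartIntegral_pos μ g i (hcont i h) (hts i h) (fun x ↦ mul_nonneg (hρ0 i x) (hh x))
        (mul_ne_zero hix hx)
  -- Split `f = Σⱼ ρⱼ f`, so that each derivative `X(ρⱼ f)` is supported in one chart.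
  · let kk : M → M → ℝ := fun j x ↦ mvfderiv 𝓘(ℝ, E) (fun z ↦ ρ j z * f z) x (X x)
    have hsm : ∀ j, ContMDiff 𝓘(ℝ, E) 𝓘(ℝ, ℝ) ∞ (fun z ↦ ρ j z * f z) := fun j ↦ (hρ j).mul hf
    have hkc : ∀ j, Continuous (kk j) := fun j ↦ continuous_iff_continuousAt.2 fun x ↦
      (contMDiffAt_mvfderiv_apply (hsm j) X.contMDiff.contMDiffAt).continuousAt
    have hks : ∀ j, tsupport (kk j) ⊆ (extChartAt 𝓘(ℝ, E) j).source := fun j ↦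
      (tsupport_mvfderiv_subset _ _).trans (hts j f)
    have hk' : ∀ x, k x = ∑ j ∈ S, kk j x := fun x ↦ by
      rw [hk, ← mvfderiv_sum_apply S fun j _ ↦ (hsm j).contMDiffAt]
      simp only [← Finset.sum_mul, hρ1, one_mul]
    have hs1 : ∀ i j, tsupport (fun x ↦ ρ i x * kk j x) ⊆ (extChartAt 𝓘(ℝ, E) j).source :=
      fun i j ↦ (tsupport_mul_subset_right (f := ρ i) (g := kk j)).trans (hks j)
    have hc1 : ∀ i j, Continuous fun x ↦ ρ i x * kk j x :=
      fun i j ↦ (hρ i).continuous.mul (hkc j)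
    -- `ρᵢ X(ρⱼ f)` is supported in both charts, so its integral can be moved from chart `i` to
    -- chart `j`.
    have hstep : ∀ i, chartIntegral μ g i (fun x ↦ ρ i x * k x) =
        ∑ j ∈ S, chartIntegral μ g j (fun x ↦ ρ i x * kk j x) := by
      intro i
      simp only [hk', Finset.mul_sum]
      rw [chartIntegral_sum μ g i S (fun j _ ↦ hc1 i j) fun j _ ↦ hts i (kk j)]
      refine Finset.sum_congr rfl fun j _ ↦ chartIntegral_eq_of_support μ g i j
        (fun x hx ↦ ?_) fun x hx ↦ ?_
      · exact image_eq_zero_of_notMem_tsupport (f := fun x ↦ ρ i x * kk j x) fun h' ↦ hx (hts i (kk j) h')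
      · exact image_eq_zero_of_notMem_tsupport (f := fun x ↦ ρ i x * kk j x) fun h' ↦ hx (hs1 i j h')
    change ∑ i ∈ S, chartIntegral μ g i (fun x ↦ ρ i x * k x) = 0
    -- With `j` outermost, summing over `i` removes `ρᵢ` and leaves the integral of `X(ρⱼ f)` in its
    -- own chart.
    rw [Finset.sum_congr rfl fun i _ ↦ hstep i, Finset.sum_comm]
    refine Finset.sum_eq_zero fun j _ ↦ ?_
    rw [← chartIntegral_sum μ g j S (fun i _ ↦ hc1 i j) fun i _ ↦ hs1 i j]
    simp only [← Finset.sum_mul, hρ1, one_mul]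
    exact chartIntegral_mvfderiv_eq_zero μ g hcov X hdiv (hsm j) (hts j f)

end RiemannianIntegral

/-! ### Conservation of kinetic energy. -/

section Conservation

variable {V : Type*} [NormedAddCommGroup V] [NormedSpace ℝ V] [FiniteDimensional ℝ V]

/-- A quadratic differential equation has local solutions. -/
theorem exists_solvesODEOn (B : V →ₗ[ℝ] V →ₗ[ℝ] V) (y₀ : V) :
    ∃ (y : ℝ → V) (J : Set ℝ), IsTimeInterval J ∧ J ∈ 𝓝 0 ∧ y 0 = y₀ ∧ SolvesODEOn B y J := by
  have hB : ContDiff ℝ 1 fun y ↦ B y y := by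
    let B' : V →L[ℝ] V →L[ℝ] V :=
      (LinearMap.toContinuousLinearMap.toLinearMap ∘ₗ B).toContinuousLinearMap
    exact (B'.contDiff).clm_apply contDiff_id
  obtain ⟨y, hy0, ε, hε, hy⟩ :=
    hB.contDiffAt.exists_forall_mem_closedBall_exists_eq_forall_mem_Ioo_hasDerivAt₀ (x₀ := y₀) 0
  rw [zero_sub, zero_add] at hy
  refine ⟨y, Ioo (-ε) ε, ⟨ordConnected_Ioo, ?_⟩, Ioo_mem_nhds (by linarith) hε, hy0,
    fun t ht ↦ (hy t ht).hasDerivWithinAt⟩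
  exact ⟨0, ⟨by linarith, hε⟩, ε / 2, ⟨by linarith, by linarith⟩, by linarith⟩

/-- A local solution of the ODE through `y` at time 0 turns the hypothesis on solutions into an
identity at every point of `V`; the time interval is a neighbourhood of 0, so the derivative there
is unique. -/
theorem euler_of_embedding {B : V →ₗ[ℝ] V →ₗ[ℝ] V} {N : CompactRiemannianManifold}
    {cov : Connection N.E N.M} {U : V →ₗ[ℝ] VectorFields N.E N.M} {P : V → ScalarFields N.E N.M}
    (h : ∀ (J : Set ℝ) (y : ℝ → V), IsTimeInterval J → SolvesODEOn B y J →
      SolvesEulerOn N cov (fun t ↦ U (y t)) (fun t ↦ P (y t)) J) (y : V) (x : N.M) :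
    U (B y y) x + cov (U y) x (U y x) = - gradient N.g (P y) x ∧ divergence cov (U y) x = 0 := by
  obtain ⟨z, J, hJ, hJ0, rfl, hz⟩ := exists_solvesODEOn B y
  obtain ⟨⟨w, hw, heq⟩, hdiv⟩ := h J z hJ hz 0 (mem_of_mem_nhds hJ0) x
  refine ⟨?_, hdiv⟩
  let L : V →ₗ[ℝ] N.E :=
    { toFun := fun y ↦ U y x
      map_add' := fun y z ↦ by rw [map_add]; rfl
      map_smul' := fun r y ↦ by rw [map_smul]; rfl }
  let u : ℝ → N.E := fun s ↦ U (z s) x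
  have h1 : HasDerivWithinAt u (L (B (z 0) (z 0))) J 0 :=
    L.toContinuousLinearMap.hasFDerivAt.comp_hasDerivWithinAt 0
      (hz 0 (mem_of_mem_nhds hJ0))
  have h2 : HasDerivWithinAt u w J 0 := hw
  have h3 : w = L (B (z 0) (z 0)) := (h2.hasDerivAt hJ0).unique (h1.hasDerivAt hJ0)
  rw [h3] at heq
  exact heq

/-- The kinetic energy gives a positive definite conserved quadratic form. -/
theorem exists_conserved_of_embedsIntoEuler {B : V →ₗ[ℝ] V →ₗ[ℝ] V}
    {N : CompactRiemannianManifold} (h : EmbedsIntoEuler B N) :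
    ∃ Q : LinearMap.BilinForm ℝ V, (∀ y z, Q y z = Q z y) ∧ (∀ y, y ≠ 0 → 0 < Q y y) ∧
      ∀ y, Q (B y y) y = 0 := by
  obtain ⟨cov, hcov, U, P, hU, hsol⟩ := h
  obtain ⟨I, hpos, hint⟩ := exists_riemannianIntegral N.g
  have hsmooth : ∀ X Y : VectorFields N.E N.M, ContMDiff 𝓘(ℝ, N.E) 𝓘(ℝ, ℝ) ∞
      (fun x ↦ N.g.inner x (X x) (Y x)) := fun X Y x ↦ by
    have h1 := ContMDiffAt.clm_bundle_apply₂ (F₁ := N.E) (F₂ := N.E)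
      (N.g.contMDiff.contMDiffAt (x := x)) X.contMDiff.contMDiffAt Y.contMDiff.contMDiffAt
    exact (Bundle.contMDiffAt_section (F := ℝ) _).1 h1
  let G : VectorFields N.E N.M → VectorFields N.E N.M → C(N.M, ℝ) := fun X Y ↦
    ⟨fun x ↦ N.g.inner x (X x) (Y x), (hsmooth X Y).continuous⟩
  have hG : ∀ X Y x, G X Y x = N.g.inner x (X x) (Y x) := fun _ _ _ ↦ rfl
  let Q : LinearMap.BilinForm ℝ V := LinearMap.mk₂ ℝ (fun y z ↦ I (G (U y) (U z)))
    (fun y y' z ↦ by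
      rw [← map_add]
      refine congrArg I (ContinuousMap.ext fun x ↦ ?_)
      simp [hG])
    (fun r y z ↦ by
      rw [← map_smul]
      refine congrArg I (ContinuousMap.ext fun x ↦ ?_)
      simp [hG])
    (fun y z z' ↦ by
      rw [← map_add]
      refine congrArg I (ContinuousMap.ext fun x ↦ ?_)
      simp [hG])
    (fun r y z ↦ by
      rw [← map_smul]
      refine congrArg I (ContinuousMap.ext fun x ↦ ?_)
      simp [hG])
  have hQ : ∀ y z, Q y z = I (G (U y) (U z)) := fun _ _ ↦ rfl
  refine ⟨Q, fun y z ↦ ?_, fun y hy ↦ ?_, fun y ↦ ?_⟩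
  · rw [hQ, hQ]
    exact congrArg I (ContinuousMap.ext fun x ↦ N.g.symm x _ _)
  · obtain ⟨x, hx⟩ : ∃ x, U y x ≠ 0 := by
      by_contra! hn
      refine hy (hU ?_)
      rw [map_zero]
      exact ContMDiffSection.ext hn
    rw [hQ]
    refine hpos _ (fun z ↦ ?_) ⟨x, (N.g.pos x _ hx).ne'⟩
    by_cases hz : U y z = 0
    · rw [hG, hz, map_zero]
    · exact (N.g.pos z _ hz).le
  · have hcontinuous : ∀ f : N.M → ℝ, ContMDiff 𝓘(ℝ, N.E) 𝓘(ℝ, ℝ) ∞ f →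
        Continuous fun x ↦ mvfderiv 𝓘(ℝ, N.E) f x (U y x) := fun f hf ↦
      continuous_iff_continuousAt.2 fun x ↦
        (contMDiffAt_mvfderiv_apply hf (U y).contMDiff.contMDiffAt).continuousAt
    let k₁ : C(N.M, ℝ) := ⟨_, hcontinuous _ (hsmooth (U y) (U y))⟩
    let k₂ : C(N.M, ℝ) := ⟨_, hcontinuous (P y) (P y).contMDiff⟩
    have hdiv : ∀ x, divergence cov (U y) x = 0 := fun x ↦ (euler_of_embedding hsol y x).2
    have h1 : I k₁ = 0 := hint cov hcov (U y) hdiv _ (hsmooth (U y) (U y)) k₁ fun _ ↦ rfl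
    have h2 : I k₂ = 0 := hint cov hcov (U y) hdiv _ (P y).contMDiff k₂ fun _ ↦ rfl
    -- Energy balance: `g(∂ₜu, u) = -½ u(|u|²) - u(p)`, where both terms are derivatives along the
    -- divergence free field `u`.
    have h3 : G (U (B y y)) (U y) = (-(1 / 2 : ℝ)) • k₁ - k₂ := by
      ext x
      have e1 : k₁ x = N.g.inner x (cov (U y) x (U y x)) (U y x) +
          N.g.inner x (U y x) (cov (U y) x (U y x)) :=
        hcov.metric_compatible _ _ x ((U y).contMDiff.mdifferentiableAt (by simp))
          ((U y).contMDiff.mdifferentiableAt (by simp)) (U y x)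
      rw [N.g.symm x (U y x)] at e1
      have e2 : k₂ x = N.g.inner x (gradient N.g (P y) x) (U y x) :=
        (inner_gradient N.g (P y) x (U y x)).symm
      have e3 : U (B y y) x = - gradient N.g (P y) x - cov (U y) x (U y x) :=
        eq_sub_of_add_eq (euler_of_embedding hsol y x).1
      have e4 : G (U (B y y)) (U y) x = - N.g.inner x (gradient N.g (P y) x) (U y x) -
          N.g.inner x (cov (U y) x (U y x)) (U y x) := by
        rw [hG, e3, map_sub, map_neg]
        rfl
      rw [e4, ContinuousMap.sub_apply, ContinuousMap.smul_apply, smul_eq_mul, e1, e2]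
      ring
    rw [hQ, h3, map_sub, map_smul, h1, h2, smul_zero, sub_zero]

end Conservation

end EulerEmbedding

end

theorem theorem1p1 (n : ℕ)
    (B : EuclideanSpace ℝ (Fin n) →ₗ[ℝ] EuclideanSpace ℝ (Fin n) →ₗ[ℝ] EuclideanSpace ℝ (Fin n))
    (hB : ∀ y z, B y z = B z y) :
    (∃ N : EulerEmbedding.CompactRiemannianManifold, EulerEmbedding.EmbedsIntoEuler B N) ↔
      ∃ Q : LinearMap.BilinForm ℝ (EuclideanSpace ℝ (Fin n)),
        (∀ y z, Q y z = Q z y) ∧ (∀ y, y ≠ 0 → 0 < Q y y) ∧ ∀ y, Q (B y y) y = 0 := by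
  refine ⟨fun ⟨_, h⟩ ↦ EulerEmbedding.exists_conserved_of_embedsIntoEuler h, ?_⟩
  rintro ⟨Q, hsymm, hpos, hQ⟩
  exact EulerEmbedding.exists_embedsIntoEuler_of_conserved B hB Q hsymm hpos hQ
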